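/- All graphs are finite, simple and nonempty. An asteroidal triple is a triple of vertices such that any two of them are joined by a path that contains neither the third vertex nor a neighbour of it; a graph is AT-free if it has no asteroidal triple. A graph $G$ is distance-hereditary if $d_{G[S]}(x,y)=d_G(x,y)$ for every $S\subseteq V(G)$ with $G[S]$ connected and all $x,y\in S$. It is a permutation graph if there are two linear orderings of $V(G)$ such that two vertices are adjacent if and only if the two orderings order them differently. It is prime if each of its modules has at most one element or equals $V(G)$. A trigraph has disjoint sets of black and red edges; contracting two vertices $u,v$ replaces them by one vertex whose edge to any other vertex $y$ is black if $y$ is a black neighbour of both $u$ and $v$, absent if $y$ is adjacent to neither, and red otherwise. A $1$-sequence of $G$ is a sequence of trigraphs that starts with $G$ (all edges black), ends with a single vertex, in which each trigraph arises from the previous one by contracting two vertices and has maximum red degree at most $1$; $G$ has twin-width at most $1$ if it has a $1$-sequence. The canonical split decomposition of a connected graph $G$ is a tree $T$ whose leaves are the vertices of $G$, whose internal vertices ("nodes") have degree at least $3$, and in which each node $n$ carries a label: a graph on the set of tree-edges at $n$ that is a clique, a star, or a connected graph without a split. No tree-edge joins two clique nodes, and no tree-edge joins two star nodes while being the centre of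 exactly one of the two stars. Distinct $x,y\in V(G)$ are adjacent in $G$ if and only if any two consecutive edges of the $x$–$y$ path in $T$ are adjacent in the label of the node they share. **Statement.** Let $G$ be a graph. 1. $G$ is AT-free and distance-hereditary if and only if $G$ is a permutation graph and distance-hereditary. 2. If $G$ is AT-free and distance-hereditary, then its twin-width is at most $1$. 3. Suppose that $G$ is AT-free, distance-hereditary and prime, with at least three vertices. Then $G$ has a canonical split decomposition $T$, and for every such $T$ a $1$-sequence of $G$ can be read off as follows. The nodes of $T$ can be listed along a path $n_1,\dots,n_k$ of $T$, and the leaves as $a,b,c_1,\dots,c_r$ in the order of the nodes to which they are attached, such that $a,b$ are exactly the leaves attached to $n_1$, and $n_1$ is labelled by a star whose centre is (the tree-edge to) $b$. For every such listing, start with the pair (pendant vertex $a$, its neighbour $b$) and treat $c=c_1,\dots,c_r$ in turn, according to the label of the node $n_i$ to which $c$ is attached: - if it is a clique, contract $b$ and $c$, and call the new vertex $b$; - if it is a star with centre $c$, contract $a$ and $b$, call the new vertex $a$, and let $c$ be the new $b$; - if it is a star whose centre is $n_{i-1}$ or a leaf listed before $c$, contract $a$ and $c$, and call the new vertex $a$;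 - if it is a star whose centre is $n_{i+1}$ or a leaf listed after $c$, contract $b$ and $c$, and call the new vertex $b$. Finally contract $a$ and $b$. These rules always apply, and the resulting sequence is a $1$-sequence of $G$; moreover each of its trigraphs has at most one red edge, and such a red edge is pendant (one of its ends has no other neighbour). -/

import Mathlib

/-! ### Graph classes -/

namespace SimpleGraph

/-- There is a path from `x` to `y` that does not dominate `z`: neither `z` nor a neighbour of `z`
lies on it. -/
def JoinedMissing {V : Type*} (G : SimpleGraph V) (x y z : V) : Prop :=
  ∃ p : G.Walk x y, p.IsPath ∧ ∀ w ∈ p.support, w ≠ z ∧ ¬ G.Adj w z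

/-- `x, y, z` form an asteroidal triple. -/
def IsAsteroidalTriple {V : Type*} (G : SimpleGraph V) (x y z : V) : Prop :=
  G.JoinedMissing x y z ∧ G.JoinedMissing y z x ∧ G.JoinedMissing x z y

/-- Asteroidal triple-free graphs. -/
def IsATFree {V : Type*} (G : SimpleGraph V) : Prop :=
  ∀ x y z : V, ¬ G.IsAsteroidalTriple x y z

/-- Distance-hereditary graphs: every connected induced subgraph preserves distances. -/
def IsDistanceHereditary {V : Type*} (G : SimpleGraph V) : Prop :=
  ∀ S : Set V, (G.induce S).Connected → ∀ x y : S, (G.induce S).dist x y = G.dist (x : V) (y : V)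

/-- Permutation graphs: two linear orderings `σ`, `τ` of the vertices such that two vertices are
adjacent exactly when `σ` and `τ` order them differently. -/
def IsPermutationGraph {V : Type*} (G : SimpleGraph V) : Prop :=
  ∃ σ τ : V ≃ Fin (Nat.card V), ∀ u v : V,
    G.Adj u v ↔ (σ u < σ v ∧ τ v < τ u) ∨ (σ v < σ u ∧ τ u < τ v)

/-- Modules of a graph. -/
def IsModule {V : Type*} (G : SimpleGraph V) (M : Set V) : Prop :=
  ∀ v, v ∉ M → (∀ m ∈ M, G.Adj v m) ∨ (∀ m ∈ M, ¬ G.Adj v m)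

/-- Prime graphs (with respect to modules): all modules are trivial. -/
def IsModularPrime {V : Type*} (G : SimpleGraph V) : Prop :=
  ∀ M : Set V, G.IsModule M → M.Subsingleton ∨ M = Set.univ

/-- `A` is one side of a split: both sides have at least two vertices, and the edges crossing
between `A` and its complement form a biclique. -/
def IsSplit {V : Type*} (G : SimpleGraph V) (A : Set V) : Prop :=
  A.Nontrivial ∧ Aᶜ.Nontrivial ∧
    ∀ x ∈ A, ∀ x' ∈ A, ∀ y ∈ Aᶜ, ∀ y' ∈ Aᶜ, G.Adj x y → G.Adj x' y' → G.Adj x y'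

end SimpleGraph

/-! ### Trigraphs and twin-width -/

/-- A trigraph whose vertices are taken from the type `V`. -/
structure Trigraph (V : Type*) where
  verts : Set V
  black : SimpleGraph V
  red : SimpleGraph V
  black_mem : ∀ {x y : V}, black.Adj x y → x ∈ verts
  red_mem : ∀ {x y : V}, red.Adj x y → x ∈ verts
  not_black_and_red : ∀ {x y : V}, black.Adj x y → ¬ red.Adj x y

namespace Trigraph

/-- A graph, seen as a trigraph without red edges. -/
def ofGraph {V : Type*} (G : SimpleGraph V) : Trigraph V where
  verts := Set.univ
  black := G
  red := ⊥
  black_mem := fun _ => Set.mem_univ _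
  red_mem := fun _ => Set.mem_univ _
  not_black_and_red := fun _ h => h

/-- The underlying graph: all edges, black and red. -/
def underlying {V : Type*} (T : Trigraph V) : SimpleGraph V := T.black ⊔ T.red

/-- Black adjacency after `u` and `v` are contracted; the new vertex is called `u`. -/
def contractBlack {V : Type*} (T : Trigraph V) (u v : V) : SimpleGraph V where
  Adj x y := (x ∈ T.verts ∧ x ≠ v) ∧ (y ∈ T.verts ∧ y ≠ v) ∧ T.black.Adj x y ∧
    (x = u → T.black.Adj v y) ∧ (y = u → T.black.Adj v x)
  symm := ⟨fun _ _ h => ⟨h.2.1, h.1, h.2.2.1.symm, h.2.2.2.2, h.2.2.2.1⟩⟩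
  loopless := ⟨fun x h => T.black.loopless.irrefl x h.2.2.1⟩

/-- Adjacency, in black or red, after `u` and `v` are contracted; the new vertex is called `u`. -/
def contractUnderlying {V : Type*} (T : Trigraph V) (u v : V) : SimpleGraph V where
  Adj x y := (x ∈ T.verts ∧ x ≠ v) ∧ (y ∈ T.verts ∧ y ≠ v) ∧ x ≠ y ∧
    (T.underlying.Adj x y ∨ (x = u ∧ T.underlying.Adj v y) ∨ (y = u ∧ T.underlying.Adj v x))
  symm := ⟨fun _ _ h => ⟨h.2.1, h.1, h.2.2.1.symm,
    h.2.2.2.elim (fun k => Or.inl k.symm)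
      (fun k => k.elim (fun a => Or.inr (Or.inr a)) (fun a => Or.inr (Or.inl a)))⟩⟩
  loopless := ⟨fun _ h => h.2.2.1 rfl⟩

/-- The trigraph obtained by contracting two distinct vertices `u` and `v`; the new vertex is
called `u`. Its edge to another vertex `y` is black when `y` is a black neighbour of both, absent
when `y` is adjacent to neither, and red otherwise; all other edges are kept. -/
def contract {V : Type*} (T : Trigraph V) (u v : V) : Trigraph V where
  verts := T.verts \ {v}
  black := T.contractBlack u v
  red := T.contractUnderlying u v \ T.contractBlack u v
  black_mem := fun h => h.1
  red_mem := fun h => h.1.1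
  not_black_and_red := fun hb hr => hr.2 hb

/-- `T'` is obtained from `T` by contracting a pair of vertices. -/
def IsContraction {V : Type*} (T T' : Trigraph V) : Prop :=
  ∃ u v, u ∈ T.verts ∧ v ∈ T.verts ∧ u ≠ v ∧ T' = T.contract u v

/-- Contraction sequences of the graph `G`. -/
def IsContractionSequence {V : Type*} (G : SimpleGraph V) (l : List (Trigraph V)) : Prop :=
  l.head? = some (ofGraph G) ∧ l.IsChain IsContraction ∧
    ∃ T, l.getLast? = some T ∧ ∃ v, T.verts = {v}

/-- `d`-sequences of the graph `G`: contraction sequences of maximum red degree at most `d`. -/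
def IsDSequence {V : Type*} (G : SimpleGraph V) (d : ℕ) (l : List (Trigraph V)) : Prop :=
  IsContractionSequence G l ∧ ∀ T ∈ l, ∀ x, (T.red.neighborSet x).encard ≤ d

/-- The trigraph has at most one red edge, and if it has one, that edge is pendant: one of its two
ends has no neighbour but the other. -/
def HasAtMostPendantRedEdge {V : Type*} (T : Trigraph V) : Prop :=
  T.red.edgeSet.Subsingleton ∧
    ∀ x y, T.red.Adj x y → T.underlying.neighborSet x = {y} ∨ T.underlying.neighborSet y = {x}

/-- The trigraphs met when the listed pairs are contracted one after the other. -/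
def trace {V : Type*} (T : Trigraph V) : List (V × V) → List (Trigraph V)
  | [] => [T]
  | (u, v) :: s => T :: trace (T.contract u v) s

end Trigraph

/-- Twin-width of a graph. -/
noncomputable def SimpleGraph.twinWidth {V : Type*} (G : SimpleGraph V) : ℕ∞ :=
  sInf {d : ℕ∞ | ∃ n : ℕ, d = n ∧ ∃ l, Trigraph.IsDSequence G n l}

/-! ### Graph-labelled trees and split decompositions -/

universe u

/-- A graph-labelled tree with leaf set `V`. Its vertices are the leaves `Sum.inl v` and the nodes
`Sum.inr n`. The marker vertices of the label of a node are the tree-edges at this node, each given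
by its other end. -/
structure GraphLabelledTree (V : Type u) : Type (u + 1) where
  Node : Type u
  finite_node : Finite Node
  tree : SimpleGraph (V ⊕ Node)
  isTree : tree.IsTree
  leaf_degree : ∀ v : V, (tree.neighborSet (Sum.inl v)).encard = 1
  node_degree : ∀ n : Node, 2 ≤ (tree.neighborSet (Sum.inr n)).encard
  label : ∀ n : Node, SimpleGraph (tree.neighborSet (Sum.inr n))

namespace GraphLabelledTree

variable {V : Type u} (D : GraphLabelledTree V)

/-- `y` is `x`-accessible: for any two successive edges `w n`, `n w'` of the tree path from `x` to
`y`, their marker vertices are adjacent in the label of `n`. -/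
def Accessible (x y : V) : Prop :=
  ∃ p : D.tree.Walk (Sum.inl x) (Sum.inl y), p.IsPath ∧
    ∀ (n : D.Node) (w w' : D.tree.neighborSet (Sum.inr n)),
      [(w : V ⊕ D.Node), Sum.inr n, (w' : V ⊕ D.Node)] <:+: p.support → (D.label n).Adj w w'

theorem Accessible.symm {D : GraphLabelledTree V} {x y : V} (h : D.Accessible x y) :
    D.Accessible y x := by
  obtain ⟨p, hp, h⟩ := h
  refine ⟨p.reverse, hp.reverse, fun n w w' hw => (h n w' w ?_).symm⟩
  rw [SimpleGraph.Walk.support_reverse, ← List.reverse_infix, List.reverse_reverse] at hw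
  simpa using hw

/-- The accessibility graph of a graph-labelled tree. -/
def accessibilityGraph : SimpleGraph V where
  Adj x y := x ≠ y ∧ D.Accessible x y
  symm := ⟨fun _ _ h => ⟨h.1.symm, h.2.symm⟩⟩
  loopless := ⟨fun _ h => h.1 rfl⟩

/-- The label of `n` is a clique. -/
def IsCliqueNode (n : D.Node) : Prop := D.label n = ⊤

/-- The label of `n` is a star, with centre the marker vertex of the tree-edge from `n` to `z`. -/
def IsStarNode (n : D.Node) (z : V ⊕ D.Node) : Prop :=
  ∃ h : z ∈ D.tree.neighborSet (Sum.inr n), D.label n = SimpleGraph.starGraph ⟨z, h⟩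

/-- `D` is the canonical split decomposition of `G`: its accessibility graph is `G`, every node has
degree at least three and is labelled by a clique, a star, or a connected graph without split, and
neither two cliques nor two stars can be merged: no tree-edge joins two clique nodes, and no
tree-edge joins two star nodes whose markers on it are the centre of one star and not the centre of
the other. -/
structure IsCanonicalSplitDecomposition (G : SimpleGraph V) : Prop where
  accessibilityGraph_eq : D.accessibilityGraph = G
  three_le_degree : ∀ n : D.Node, 3 ≤ (D.tree.neighborSet (Sum.inr n)).encard
  label_cases : ∀ n : D.Node, D.IsCliqueNode n ∨ (∃ z, D.IsStarNode n z) ∨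
    ((D.label n).Connected ∧ ∀ A, ¬ (D.label n).IsSplit A)
  clique_clique : ∀ m n : D.Node, D.tree.Adj (Sum.inr m) (Sum.inr n) →
    ¬ (D.IsCliqueNode m ∧ D.IsCliqueNode n)
  star_star : ∀ m n : D.Node, D.tree.Adj (Sum.inr m) (Sum.inr n) →
    ∀ z, D.IsStarNode m (Sum.inr n) → D.IsStarNode n z → z = Sum.inr m

/-- A linear reading of `D`, as it exists when `D` is a caterpillar: `nodes` lists all nodes along a
path of the tree, and `a, b, rest` lists all leaves, in the order in which their nodes appear on
this path. The first node is labelled by a star and has exactly the two leaves `a` and `b`, of which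
`b` is the centre, so that `a` is a pendant vertex with neighbour `b`. -/
structure IsReading (nodes : List D.Node) (a b : V) (rest : List V) : Prop where
  nodes_nodup : nodes.Nodup
  mem_nodes : ∀ n, n ∈ nodes
  nodes_chain : nodes.IsChain (fun m n => D.tree.Adj (Sum.inr m) (Sum.inr n))
  leaves_nodup : (a :: b :: rest).Nodup
  mem_leaves : ∀ v, v ∈ a :: b :: rest
  leaves_sorted : (a :: b :: rest).Pairwise (fun v w => ∀ m n : D.Node,
    D.tree.Adj (Sum.inl v) (Sum.inr m) → D.tree.Adj (Sum.inl w) (Sum.inr n) →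
      m = n ∨ [m, n].Sublist nodes)
  pendant : ∃ n, nodes.head? = some n ∧ D.IsStarNode n (Sum.inl b) ∧
    ∀ v, D.tree.Adj (Sum.inl v) (Sum.inr n) ↔ v = a ∨ v = b

/-- The tree-neighbour `z` of the node `n` comes before the leaf `c` of `n` in the reading: `z` is
an earlier node or an earlier leaf. -/
def Before (nodes : List D.Node) (leaves : List V) (n : D.Node) (c : V) :
    V ⊕ D.Node → Prop
  | Sum.inl v => [v, c].Sublist leaves
  | Sum.inr m => [m, n].Sublist nodes

/-- The tree-neighbour `z` of the node `n` comes after the leaf `c` of `n` in the reading. -/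
def After (nodes : List D.Node) (leaves : List V) (n : D.Node) (c : V) :
    V ⊕ D.Node → Prop
  | Sum.inl v => [c, v].Sublist leaves
  | Sum.inr m => [n, m].Sublist nodes

/-- `D.ReadsOff nodes leaves a b cs s`: when `a` is the current pendant vertex, `b` its neighbour and
`cs` the list of leaves still to be read, `s` is the list of pairs to be contracted, as read off the
labels of `D`. A contraction of `(x, y)` names the new vertex `x`. The next leaf `c`, at the node
`n`, is treated by the label of `n`:
* a clique: contract `b` and `c`;
* a star with centre `c`: contract `a` and `b`; the result becomes the pendant vertex, attached
  to `c`;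
* a star whose centre was already passed: contract `a` and `c`;
* a star whose centre is still to come: contract `b` and `c`.
When no leaf remains, contract `a` and `b`. -/
inductive ReadsOff (nodes : List D.Node) (leaves : List V) :
    V → V → List V → List (V × V) → Prop
  | last (a b : V) : ReadsOff nodes leaves a b [] [(a, b)]
  | clique (a b c : V) (cs : List V) (s : List (V × V)) (n : D.Node)
      (hc : D.tree.Adj (Sum.inl c) (Sum.inr n)) (hn : D.IsCliqueNode n)
      (hs : ReadsOff nodes leaves a b cs s) : ReadsOff nodes leaves a b (c :: cs) ((b, c) :: s)
  | starAtLeaf (a b c : V) (cs : List V) (s : List (V × V)) (n : D.Node)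
      (hc : D.tree.Adj (Sum.inl c) (Sum.inr n)) (hn : D.IsStarNode n (Sum.inl c))
      (hs : ReadsOff nodes leaves a c cs s) : ReadsOff nodes leaves a b (c :: cs) ((a, b) :: s)
  | starBefore (a b c : V) (cs : List V) (s : List (V × V)) (n : D.Node) (z : V ⊕ D.Node)
      (hc : D.tree.Adj (Sum.inl c) (Sum.inr n)) (hn : D.IsStarNode n z)
      (hz : D.Before nodes leaves n c z)
      (hs : ReadsOff nodes leaves a b cs s) : ReadsOff nodes leaves a b (c :: cs) ((a, c) :: s)
  | starAfter (a b c : V) (cs : List V) (s : List (V × V)) (n : D.Node) (z : V ⊕ D.Node)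
      (hc : D.tree.Adj (Sum.inl c) (Sum.inr n)) (hn : D.IsStarNode n z)
      (hz : D.After nodes leaves n c z)
      (hs : ReadsOff nodes leaves a b cs s) : ReadsOff nodes leaves a b (c :: cs) ((b, c) :: s)

end GraphLabelledTree

/-! The metric input is one observation. The support of a walk from `r` to `w` induces a connected
subgraph, so in a distance-hereditary graph the walk contains a neighbour of `w` that is one step
closer to `r` (`IsDistanceHereditary.exists_adj_dist`). Applied to short walks between the distance
levels of `r`, it shows which vertices cannot be told apart from below. In a prime graph it follows
that the last level is independent and that a last-level vertex with fewest neighbours has a module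
as its neighbourhood. This vertex is therefore pendant, and deleting it together with its neighbour
leaves a connected graph (`IsDistanceHereditary.exists_extremePendant`). Moreover, a connected
distance-hereditary graph without twins is already prime.

Three such pendant vertices, none being the neighbour of another, form an asteroidal triple, because
any two are joined in the graph that remains when the third and its neighbour are deleted. So an
AT-free graph without twins has a linear shape. In the connected case, root it at an extreme pendant
vertex. If nothing were a twin of the root or a pendant neighbour of it, and the root were not
pendant itself, there would be two extreme pendant vertices away from the root, hence an asteroidal
triple (`exists_thread_step`). Stripping one vertex after the other yields a `Thread`; disconnected
graphs are handled by concatenation.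

Threads give the first two claims. Read backwards, a thread builds a permutation representation
whose root stays extremal in one order. Read forwards, it is a contraction sequence in which only
the edge between a pendant vertex and the root can be red. Twins present in the given graph are
contracted, or inserted next to each other, without harm. Conversely, a path that misses a vertex of
a permutation graph stays on one side of it, so permutation graphs are AT-free.

For the third claim, a thread of a connected graph is encoded as a word in four letters. Maximal
runs of merging letters become the nodes of a caterpillar, and maximality is what makes this
decomposition canonical. For an arbitrary canonical decomposition `D`, all labels are cliques or
stars, since each label is an induced subgraph of the graph. Every end node carries an extreme
pendant vertex, so there are at most two end nodes and the nodes form a path. While the leaves are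
read along it, the root `b` is accessible through an earlier marker, which is the centre of the
current star if that centre was passed (`RootBefore`). Under this invariant each rule is a step of a
thread. Uniqueness of the decomposition is never needed. -/

namespace SimpleGraph

/-! ### Connection inside a set of vertices -/

/-- `u` and `v` are joined by a walk of `G` inside the vertex set `X`. -/
def ConnIn {V : Type*} (G : SimpleGraph V) (X : Set V) (u v : V) : Prop :=
  u ∈ X ∧ Relation.ReflTransGen (fun x y => G.Adj x y ∧ y ∈ X) u v

namespace ConnIn

variable {V : Type*} {G : SimpleGraph V} {X Y : Set V} {u v w : V}

theorem refl (h : u ∈ X) : G.ConnIn X u u := ⟨h, .refl⟩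

theorem right_mem (h : G.ConnIn X u v) : v ∈ X := by
  obtain ⟨h1, h2⟩ := h
  induction h2 with
  | refl => exact h1
  | tail _ h _ => exact h.2

theorem tail (h : G.ConnIn X u v) (ha : G.Adj v w) (hw : w ∈ X) : G.ConnIn X u w :=
  ⟨h.1, h.2.tail ⟨ha, hw⟩⟩

theorem single (hu : u ∈ X) (ha : G.Adj u w) (hw : w ∈ X) : G.ConnIn X u w :=
  (refl hu).tail ha hw

theorem trans (h : G.ConnIn X u v) (h' : G.ConnIn X v w) : G.ConnIn X u w :=
  ⟨h.1, h.2.trans h'.2⟩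

theorem symm (h : G.ConnIn X u v) : G.ConnIn X v u := by
  obtain ⟨h1, h2⟩ := h
  induction h2 with
  | refl => exact refl h1
  | tail h3 h4 ih =>
    exact (single h4.2 h4.1.symm (right_mem ⟨h1, h3⟩)).trans ih

theorem mono (h : G.ConnIn X u v) (hXY : X ⊆ Y) : G.ConnIn Y u v :=
  ⟨hXY h.1, Relation.ReflTransGen.mono (fun _ _ k => ⟨k.1, hXY k.2⟩) _ _ h.2⟩

/-- Edges may be collapsed by `f`. This is what allows a walk to be rerouted around a vertex, by
sending that vertex to a substitute. -/
theorem map {W : Type*} {H : SimpleGraph W} {Z : Set W} {a b : W} (f : W → V)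
    (hf : ∀ x ∈ Z, ∀ y ∈ Z, H.Adj x y → f x = f y ∨ G.Adj (f x) (f y)) (hZ : ∀ x ∈ Z, f x ∈ X)
    (h : H.ConnIn Z a b) : G.ConnIn X (f a) (f b) := by
  obtain ⟨h1, h2⟩ := h
  induction h2 with
  | refl => exact refl (hZ _ h1)
  | tail h3 h4 ih =>
    rcases hf _ (right_mem ⟨h1, h3⟩) _ h4.2 h4.1 with h | h
    · rwa [← h]
    · exact ih.tail h (hZ _ h4.2)

theorem exists_isPath (h : G.ConnIn X u v) :
    ∃ p : G.Walk u v, p.IsPath ∧ ∀ w ∈ p.support, w ∈ X := by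
  classical
  obtain ⟨h1, h2⟩ := h
  have : ∃ p : G.Walk u v, ∀ w ∈ p.support, w ∈ X := by
    induction h2 with
    | refl => exact ⟨.nil, by simpa using h1⟩
    | tail _ h ih =>
      obtain ⟨p, hp⟩ := ih
      refine ⟨p.concat h.1, fun w hw => ?_⟩
      rw [Walk.support_concat] at hw
      rcases (by simpa using hw : w ∈ p.support ∨ w = _) with hw | rfl
      · exact hp _ hw
      · exact h.2
  obtain ⟨p, hp⟩ := this
  exact ⟨p.bypass, p.bypass_isPath, fun w hw => hp _ (p.support_bypass_subset_support hw)⟩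

theorem of_walk (p : G.Walk u v) (hp : ∀ w ∈ p.support, w ∈ X) : G.ConnIn X u v := by
  induction p with
  | nil => exact refl (hp _ (by simp))
  | cons h p ih =>
    exact (single (hp _ (by simp)) h (hp _ (by simp))).trans (ih fun w hw => hp _ (by simp [hw]))

end ConnIn

theorem Reachable.connIn_univ {V : Type*} {G : SimpleGraph V} {u v : V} (h : G.Reachable u v) :
    G.ConnIn Set.univ u v := by
  obtain ⟨p⟩ := h
  exact .of_walk p fun _ _ => Set.mem_univ _

theorem ConnIn.reachable {V : Type*} {G : SimpleGraph V} {X : Set V} {u v : V}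
    (h : G.ConnIn X u v) : G.Reachable u v := by
  obtain ⟨p, -⟩ := h.exists_isPath
  exact ⟨p⟩

theorem ConnIn.induce {V : Type*} {G : SimpleGraph V} {S X : Set V} {u v : S}
    (h : G.ConnIn X u v) (hX : X ⊆ S) : (G.induce S).ConnIn (Subtype.val ⁻¹' X) u v := by
  obtain ⟨u, hu⟩ := u
  obtain ⟨v, hv⟩ := v
  obtain ⟨h1, h2⟩ := h
  dsimp only at h1 h2
  induction h2 with
  | refl => exact .refl h1
  | tail h3 h4 ih => exact (ih (hX (ConnIn.right_mem ⟨h1, h3⟩))).tail h4.1 h4.2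

/-! ### Distances and distance-hereditary graphs -/

section Dist

variable {V W : Type*} {G : SimpleGraph V} {H : SimpleGraph W}

theorem Reachable.dist_map_le (f : H →g G) {x y : W} (h : H.Reachable x y) :
    G.dist (f x) (f y) ≤ H.dist x y := by
  obtain ⟨p, hp⟩ := h.exists_walk_length_eq_dist
  rw [← hp, ← Walk.length_map f p]
  exact dist_le _

theorem Reachable.exists_adj_dist {x y : V} (h : G.Reachable x y) (hne : x ≠ y) :
    ∃ u, G.Adj y u ∧ G.dist x u + 1 = G.dist x y := by
  obtain ⟨p, hp⟩ := h.symm.exists_walk_length_eq_dist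
  cases p with
  | nil => exact absurd rfl hne
  | @cons _ u _ hadj p =>
    refine ⟨u, hadj, ?_⟩
    rw [Walk.length_cons] at hp
    have h1 := dist_le p
    have h2 : G.dist y x ≤ G.dist u x + 1 := by
      obtain ⟨q, hq⟩ := p.reachable.exists_walk_length_eq_dist
      rw [← hq]
      exact dist_le (Walk.cons hadj q)
    rw [dist_comm, dist_comm (u := x) (v := y)]
    omega

/-- An embedding need not preserve distances, but the distance in `H.induce S` is at most that in
the image, which is the distance in `G`, which is at most the distance in `H`, which is at most the
distance in `H.induce S`. -/
theorem IsDistanceHereditary.of_embedding (f : H ↪g G) (hG : G.IsDistanceHereditary) :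
    H.IsDistanceHereditary := by
  intro S hS x y
  let e : H.induce S ≃g G.induce (f '' S) :=
    { toEquiv := Equiv.Set.image f S f.injective
      map_rel_iff' := by
        intro a b
        exact f.map_rel_iff }
  have hc : (G.induce (f '' S)).Connected := e.connected_iff.1 hS
  apply le_antisymm
  · have h1 := Reachable.dist_map_le e.symm.toHom (hc.preconnected (e x) (e y))
    have h2 := hG _ hc (e x) (e y)
    have h3 := Reachable.dist_map_le f.toHom
      ((hS.preconnected x y).map (Embedding.induce S).toHom)
    have e1 : ((e x : f '' S) : V) = f x := rfl
    have e2 : ((e y : f '' S) : V) = f y := rfl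
    have e3 : e.symm.toHom (e x) = x := e.symm_apply_apply x
    have e4 : e.symm.toHom (e y) = y := e.symm_apply_apply y
    rw [e3, e4] at h1
    rw [e1, e2] at h2
    exact h1.trans (h2.le.trans h3)
  · exact Reachable.dist_map_le (Embedding.induce S).toHom (hS.preconnected x y)

theorem IsDistanceHereditary.induce (hG : G.IsDistanceHereditary) (S : Set V) :
    (G.induce S).IsDistanceHereditary :=
  hG.of_embedding (Embedding.induce S)

/-- Inside the connected subgraph induced by the support of `p`, take the last step of a shortest
path to `w`; distances there are those of `G`. -/
theorem IsDistanceHereditary.exists_adj_dist (hG : G.IsDistanceHereditary) {r w : V}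
    (p : G.Walk r w) (hne : r ≠ w) :
    ∃ t ∈ p.support, G.Adj w t ∧ G.dist r t + 1 = G.dist r w := by
  have hc := p.connected_induce_support
  set S : Set V := {v | v ∈ p.support} with hS
  let r' : S := ⟨r, p.start_mem_support⟩
  let w' : S := ⟨w, p.end_mem_support⟩
  obtain ⟨t, ht, hd⟩ := (hc.preconnected r' w').exists_adj_dist (by simpa [r', w'] using hne)
  rw [hG S hc, hG S hc] at hd
  exact ⟨t, t.2, ht, hd⟩

/-- At distance two, the vertex one step before `w` must be adjacent to `z`. Below, this is applied
to explicit walks of length three or four, whose vertices are excluded one by one. -/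
theorem IsDistanceHereditary.exists_common_adj (hG : G.IsDistanceHereditary) {z w c : V}
    (p : G.Walk z w) (hne : z ≠ w) (hadj : ¬ G.Adj z w) (h1 : G.Adj z c) (h2 : G.Adj c w) :
    ∃ t ∈ p.support, G.Adj z t ∧ G.Adj t w := by
  obtain ⟨t, ht, hwt, hd⟩ := hG.exists_adj_dist p hne
  refine ⟨t, ht, ?_, hwt.symm⟩
  have h3 : G.dist z w ≤ 2 := dist_le (Walk.cons h1 (Walk.cons h2 .nil))
  have h4 : G.Reachable z t := p.reachable.trans hwt.reachable
  have h5 : G.dist z t ≠ 0 := by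
    intro h0
    rw [h4.dist_eq_zero_iff] at h0
    subst h0
    exact hadj hwt.symm
  exact dist_eq_one_iff_adj.1 (by omega)

theorem Walk.eq_or_dist_lt_of_mem_support {r y t : V} (p : G.Walk r y)
    (hp : p.length = G.dist r y) (ht : t ∈ p.support) : t = y ∨ G.dist r t < G.dist r y := by
  classical
  by_cases h : t = y
  · exact .inl h
  · exact .inr ((dist_le (p.takeUntil t ht)).trans_lt (hp ▸ p.length_takeUntil_lt_length ht h))

end Dist

theorem ncard_pair_le {V : Type*} (u v : V) : ({u, v} : Set V).ncard ≤ 2 :=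
  (Set.ncard_insert_le u {v}).trans (by simp)

/-! ### Modules -/

section Modules

variable {V : Type*} {G : SimpleGraph V}

/-- A component and its complement are both modules. If both are nonempty, primality makes them
singletons, which leaves only two vertices. -/
theorem IsModularPrime.connected [Finite V] (hp : G.IsModularPrime) (h3 : 3 ≤ Nat.card V) :
    G.Connected := by
  have hne : Nonempty V := (Nat.card_pos_iff.1 (by omega)).1
  refine (connected_iff _).2 ⟨fun u v => ?_, hne⟩
  by_contra huv
  have h1 : G.IsModule {w | G.Reachable u w} := fun y hy =>
    .inr fun m hm h => hy (hm.trans h.symm.reachable)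
  have h2 : G.IsModule {w | ¬ G.Reachable u w} := fun y hy =>
    .inr fun m hm h => hm ((not_not.1 hy).trans h.reachable)
  have h1' := (hp _ h1).resolve_right fun h => huv (h ▸ Set.mem_univ v : v ∈ {w | G.Reachable u w})
  have h2' := (hp _ h2).resolve_right fun h =>
    (h ▸ Set.mem_univ u : u ∈ {w | ¬ G.Reachable u w}) .rfl
  have h4 : (Set.univ : Set V) ⊆ {u, v} := by
    intro w _
    by_cases hw : G.Reachable u w
    · exact .inl (h1' hw .rfl)
    · exact .inr (h2' hw huv)
  have h5 := Set.ncard_le_ncard h4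
  rw [Set.ncard_univ] at h5
  have := ncard_pair_le u v
  omega

theorem IsModule.image_val {M : Set V} (hM : G.IsModule M) {N : Set M}
    (hN : (G.induce M).IsModule N) : G.IsModule (Subtype.val '' N) := by
  intro v hv
  by_cases hvM : v ∈ M
  · rcases hN ⟨v, hvM⟩ (fun h => hv ⟨_, h, rfl⟩) with h | h
    · exact .inl (by rintro _ ⟨m, hm, rfl⟩; exact h m hm)
    · exact .inr (by rintro _ ⟨m, hm, rfl⟩; exact h m hm)
  · rcases hM v hvM with h | h
    · exact .inl (by rintro _ ⟨m, hm, rfl⟩; exact h m m.2)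
    · exact .inr (by rintro _ ⟨m, hm, rfl⟩; exact h m m.2)

/-- Two vertices that no third vertex distinguishes. -/
def AreTwins {V : Type*} (G : SimpleGraph V) (u v : V) : Prop :=
  u ≠ v ∧ ∀ y, y ≠ u → y ≠ v → (G.Adj u y ↔ G.Adj v y)

theorem AreTwins.isModule {u v : V} (h : G.AreTwins u v) : G.IsModule {u, v} := by
  intro y hy
  simp only [Set.mem_insert_iff, Set.mem_singleton_iff, not_or] at hy
  have := h.2 y hy.1 hy.2
  by_cases hu : G.Adj u y
  · left
    rintro m (rfl | rfl)
    · exact hu.symm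
    · exact (this.1 hu).symm
  · right
    rintro m (rfl | rfl) hm
    · exact hu hm.symm
    · exact hu (this.2 hm.symm)

theorem IsModularPrime.not_areTwins [Finite V] (hp : G.IsModularPrime) (h3 : 3 ≤ Nat.card V)
    (u v : V) : ¬ G.AreTwins u v := by
  intro h
  rcases hp _ h.isModule with h1 | h1
  · exact h.1 (h1 (by simp) (by simp))
  · have := ncard_pair_le u v
    rw [h1, Set.ncard_univ] at this
    omega

end Modules

end SimpleGraph

namespace SimpleGraph

/-! ### Levels of a distance-hereditary graph -/

section Levels

variable {V : Type*} {G : SimpleGraph V} {r u v w x y z : V}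

theorem Connected.dist_le_succ (hc : G.Connected) (r : V) (h : G.Adj x y) :
    G.dist r y ≤ G.dist r x + 1 := by
  have := hc.dist_triangle (u := r) (v := x) (w := y)
  rwa [dist_eq_one_iff_adj.2 h] at this

/-- Adjacent vertices of the same level have the same neighbours in the level below. -/
theorem IsDistanceHereditary.adj_of_adj_level (hG : G.IsDistanceHereditary) (hc : G.Connected)
    (huv : G.Adj u v) (hl : G.dist r u = G.dist r v) (hyu : G.Adj y u)
    (hy : G.dist r y + 1 = G.dist r u) : G.Adj y v := by
  obtain ⟨p, hp⟩ := (hc.preconnected r y).exists_walk_length_eq_dist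
  have hne : r ≠ v := by
    rintro rfl
    rw [dist_self] at hl
    omega
  -- On a geodesic to `y` continued by `u` and `v`, the only vertex in the level just below `v` is
  -- `y`.
  obtain ⟨t, ht, hvt, hd⟩ := hG.exists_adj_dist ((p.concat hyu).concat huv) hne
  have ht' : t ∈ p.support ∨ t = u ∨ t = v := by
    simpa [Walk.support_concat, or_assoc] using ht
  rcases ht' with ht | rfl | rfl
  · rcases p.eq_or_dist_lt_of_mem_support hp ht with rfl | h
    · exact hvt.symm
    · omega
  · omega
  · exact absurd hvt (G.loopless.irrefl _)

/-- The neighbours of a vertex in the level below have the same neighbours one more level below. -/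
theorem IsDistanceHereditary.adj_of_adj_below (hG : G.IsDistanceHereditary) (hc : G.Connected)
    (hxu : G.Adj x u) (hxw : G.Adj x w) (hu : G.dist r u + 1 = G.dist r x)
    (hw : G.dist r w + 1 = G.dist r x) (hzu : G.Adj z u) (hz : G.dist r z + 1 = G.dist r u) :
    G.Adj z w := by
  obtain ⟨p, hp⟩ := (hc.preconnected r z).exists_walk_length_eq_dist
  have hne : r ≠ w := by
    rintro rfl
    rw [dist_self] at hw
    omega
  obtain ⟨t, ht, hvt, hd⟩ :=
    hG.exists_adj_dist (((p.concat hzu).concat hxu.symm).concat hxw) hne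
  have ht' : t ∈ p.support ∨ t = u ∨ t = x ∨ t = w := by
    simpa [Walk.support_concat, or_assoc] using ht
  rcases ht' with ht | rfl | rfl | rfl
  · rcases p.eq_or_dist_lt_of_mem_support hp ht with rfl | h
    · exact hvt.symm
    · omega
  · omega
  · omega
  · exact absurd hvt (G.loopless.irrefl _)

/-- The neighbours of a vertex in the level below are not distinguished by a vertex of their own
level which is not one of them. -/
theorem IsDistanceHereditary.adj_of_adj_same (hG : G.IsDistanceHereditary) (hc : G.Connected)
    (hxu : G.Adj x u) (hxw : G.Adj x w) (hu : G.dist r u + 1 = G.dist r x)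
    (hw : G.dist r w + 1 = G.dist r x) (hzu : G.Adj z u) (hz : G.dist r z = G.dist r u)
    (hxz : ¬ G.Adj x z) (hu0 : 0 < G.dist r u) : G.Adj z w := by
  by_contra hzw
  obtain ⟨t, hut, htd⟩ := (hc.preconnected r u).exists_adj_dist (by
    rintro rfl
    simp at hu0)
  have htw : G.Adj t w := hG.adj_of_adj_below hc hxu hxw hu hw hut.symm htd
  have htz : G.Adj t z := hG.adj_of_adj_level hc hzu.symm hz.symm hut.symm htd
  have hxt : ¬ G.Adj x t := fun h => by
    have := hc.dist_le_succ r h.symm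
    omega
  have hzx : z ≠ x := by rintro rfl; omega
  have hzw' : z ≠ w := by rintro rfl; exact hxz hxw
  -- The vertex `t` is a common lower neighbour of `u`, `w` and `z`. If `u` and `w` are adjacent,
  -- then `z` and `x` share `u`, but the walk `z, t, w, x` has none of their common neighbours.
  -- Otherwise `z` and `w` share `t`, but the walk `z, u, x, w` has none of theirs.
  by_cases huw : G.Adj u w
  · obtain ⟨s, hs, h1, h2⟩ := hG.exists_common_adj
      (Walk.cons htz.symm (Walk.cons htw (Walk.cons hxw.symm .nil))) hzx
      (fun h => hxz h.symm) hzu hxu.symm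
    have hs' : s = z ∨ s = t ∨ s = w ∨ s = x := by simpa using hs
    rcases hs' with rfl | rfl | rfl | rfl
    · exact G.loopless.irrefl _ h1
    · exact hxt h2.symm
    · exact hzw h1
    · exact G.loopless.irrefl _ h2
  · obtain ⟨s, hs, h1, h2⟩ := hG.exists_common_adj
      (Walk.cons hzu (Walk.cons hxu.symm (Walk.cons hxw .nil))) hzw' hzw htz.symm htw
    have hs' : s = z ∨ s = u ∨ s = x ∨ s = w := by simpa using hs
    rcases hs' with rfl | rfl | rfl | rfl
    · exact G.loopless.irrefl _ h1
    · exact huw h2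
    · exact hxz h1.symm
    · exact G.loopless.irrefl _ h2

/-- The neighbourhoods in the level below of two nonadjacent vertices of the same level are
disjoint or nested. -/
theorem IsDistanceHereditary.nested (hG : G.IsDistanceHereditary) (hc : G.Connected)
    {w' : V} (hxy : ¬ G.Adj x y) (hl : G.dist r x = G.dist r y)
    (hxu : G.Adj x u) (hyu : G.Adj y u) (hu : G.dist r u + 1 = G.dist r x)
    (hxw : G.Adj x w) (hw : G.dist r w + 1 = G.dist r x) (hyw : ¬ G.Adj y w)
    (hyw' : G.Adj y w') (hw' : G.dist r w' + 1 = G.dist r x) (hu0 : 0 < G.dist r u) :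
    G.Adj x w' := by
  by_contra hxw'
  obtain ⟨t, hut, htd⟩ := (hc.preconnected r u).exists_adj_dist (by
    rintro rfl
    simp at hu0)
  have htw : G.Adj t w := hG.adj_of_adj_below hc hxu hxw hu hw hut.symm htd
  have htw' : G.Adj t w' :=
    hG.adj_of_adj_below hc hyu hyw' (hl ▸ hu) (hl ▸ hw') hut.symm htd
  have hyt : ¬ G.Adj t y := fun h => by
    have := hc.dist_le_succ r h
    omega
  have hne : x ≠ y := by rintro rfl; exact hyw hxw
  -- The vertices `x` and `y` share `u`, whereas no vertex of the walk `x, w, t, w', y` is adjacent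
  -- to both.
  obtain ⟨s, hs, h1, h2⟩ := hG.exists_common_adj
    (Walk.cons hxw (Walk.cons htw.symm (Walk.cons htw' (Walk.cons hyw'.symm .nil)))) hne hxy
    hxu hyu.symm
  have hs' : s = x ∨ s = w ∨ s = t ∨ s = w' ∨ s = y := by simpa using hs
  rcases hs' with rfl | rfl | rfl | rfl | rfl
  · exact G.loopless.irrefl _ h1
  · exact hyw h2.symm
  · exact hyt h2
  · exact hxw' h1
  · exact G.loopless.irrefl _ h2

end Levels

/-! ### Pendant vertices -/

/-- `x` is a pendant vertex with neighbour `q`, and removing both leaves a connected graph. -/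
def IsExtremePendant {V : Type*} (G : SimpleGraph V) (x q : V) : Prop :=
  (∀ y, G.Adj x y ↔ y = q) ∧
    ∀ u v, u ≠ x → u ≠ q → v ≠ x → v ≠ q → G.ConnIn {x, q}ᶜ u v

/-- The component of `u` within the last level is a module: a vertex outside that sees it lies one
level below, and `adj_of_adj_level` carries its adjacency along the edges of the component. As `r`
is not in it, primality leaves a single vertex. -/
theorem IsDistanceHereditary.last_level_independent {V : Type*} {G : SimpleGraph V}
    (hG : G.IsDistanceHereditary) (hc : G.Connected) (hp : G.IsModularPrime) {r : V} {k : ℕ}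
    (hk : 0 < k) (hmax : ∀ v, G.dist r v ≤ k) {u v : V} (hu : G.dist r u = k)
    (hv : G.dist r v = k) : ¬ G.Adj u v := by
  intro huv
  let C : Set V := {w | G.ConnIn {w | G.dist r w = k} u w}
  have hM : G.IsModule C := by
    intro y hy
    by_cases h : ∃ m ∈ C, G.Adj y m
    · left
      obtain ⟨m, hm, hym⟩ := h
      have hmk : G.dist r m = k := hm.right_mem
      have hyk : G.dist r y + 1 = k := by
        have h1 := hmax y
        have h2 := hc.dist_le_succ r hym
        have h3 : G.dist r y ≠ k := fun h3 => hy (hm.tail hym.symm h3)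
        omega
      have key : ∀ a b, G.ConnIn {w | G.dist r w = k} a b → G.Adj y a → G.Adj y b := by
        rintro a b ⟨ha, hab⟩ hya
        induction hab with
        | refl => exact hya
        | @tail b c h3 h4 ih =>
          have hb : b ∈ {w | G.dist r w = k} := ConnIn.right_mem (G := G) ⟨ha, h3⟩
          replace hb : G.dist r b = k := hb
          exact hG.adj_of_adj_level hc h4.1 (hb.trans h4.2.symm) ih (by omega)
      exact fun m' hm' => key m m' (hm.symm.trans hm') hym
    · push Not at h
      exact .inr h
  have huC : u ∈ C := ConnIn.refl hu
  rcases hp C hM with h | h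
  · exact huv.ne (h huC (huC.tail huv hv))
  · have hr : r ∈ C := h ▸ Set.mem_univ r
    have : G.dist r r = k := hr.right_mem
    rw [dist_self] at this
    omega

/-- Take `x` in the last level with fewest neighbours. A vertex that sees part of the neighbourhood
of `x` sees all of it, by nestedness and minimality in the last level, by `adj_of_adj_same` one
level below, and by `adj_of_adj_below` two levels below. So this neighbourhood is a module, hence a
single vertex `q`. The base `r` is free, so that the pendant vertex and its neighbour can be kept
away from a prescribed vertex. -/
theorem IsDistanceHereditary.exists_extremePendant {V : Type*} [Finite V] {G : SimpleGraph V}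
    (hG : G.IsDistanceHereditary) (hp : G.IsModularPrime) (h3 : 3 ≤ Nat.card V) (r : V) :
    ∃ x q, x ≠ r ∧ q ≠ r ∧ G.IsExtremePendant x q := by
  have hc := hp.connected h3
  obtain ⟨x₀, -, hx₀⟩ := Set.exists_max_image Set.univ (G.dist r) Set.finite_univ ⟨r, trivial⟩
  set k := G.dist r x₀ with hk
  have hmax : ∀ v, G.dist r v ≤ k := fun v => hx₀ v trivial
  -- With only one level, `r` would dominate the graph and its complement would be a nontrivial
  -- proper module.
  have hk2 : 2 ≤ k := by
    by_contra hlt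
    have h1 : ∀ v, v ≠ r → G.Adj r v := fun v hv => by
      have := hmax v
      have := hc.pos_dist_of_ne hv.symm
      exact dist_eq_one_iff_adj.1 (by omega)
    have hM : G.IsModule {r}ᶜ := by
      intro v hv
      have : v = r := by simpa using hv
      subst this
      exact .inl fun m hm => h1 m hm
    rcases hp _ hM with h | h
    · have h2 := Set.ncard_add_ncard_compl ({r} : Set V)
      have h4 := Set.ncard_le_one_iff_subsingleton.2 h
      rw [Set.ncard_singleton] at h2
      omega
    · have : r ∈ ({r}ᶜ : Set V) := h ▸ Set.mem_univ r
      simp at this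
  have hind : ∀ u v, G.dist r u = k → G.dist r v = k → ¬ G.Adj u v := fun u v =>
    hG.last_level_independent hc hp (by omega) hmax
  have hlow : ∀ u v, G.dist r u = k → G.Adj u v → G.dist r v + 1 = k := by
    intro u v hu huv
    have h1 := hmax v
    have h2 := hc.dist_le_succ r huv.symm
    have h4 : G.dist r v ≠ k := fun h => hind u v hu h huv
    omega
  obtain ⟨x, hxk, hxmin⟩ := Set.exists_min_image {v | G.dist r v = k}
    (fun v => (G.neighborSet v).ncard) (Set.toFinite _) ⟨x₀, rfl⟩
  replace hxk : G.dist r x = k := hxk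
  have hM : G.IsModule (G.neighborSet x) := by
    intro y hy
    have hxy : ¬ G.Adj x y := hy
    by_cases h : ∃ m ∈ G.neighborSet x, G.Adj y m
    · left
      obtain ⟨u, hxu, hyu⟩ := h
      have hxu' : G.Adj x u := hxu
      have hu := hlow x u hxk hxu
      intro w hw
      have hw' := hlow x w hxk hw
      have h5 := hc.dist_le_succ r hyu
      have h6 := hc.dist_le_succ r hyu.symm
      have h7 : G.dist r y = k ∨ G.dist r y + 1 = k ∨ G.dist r y + 2 = k := by
        have := hmax y
        omega
      rcases h7 with h7 | h7 | h7
      · by_contra hyw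
        have hss : G.neighborSet y ⊂ G.neighborSet x := by
          refine ⟨fun w' hw'' => ?_, fun h => hyw (h hw)⟩
          exact hG.nested (u := u) (w := w) hc hxy (hxk.trans h7.symm) hxu hyu (by omega) hw
            (by omega) hyw hw'' (by have := hlow y w' h7 hw''; omega) (by omega)
        have := Set.ncard_lt_ncard hss
        have := hxmin y h7
        omega
      · exact hG.adj_of_adj_same (r := r) hc hxu hw (by omega) (by omega) hyu (by omega) hxy (by omega)
      · exact hG.adj_of_adj_below (r := r) hc hxu hw (by omega) (by omega) hyu (by omega)
    · push Not at h
      exact .inr h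
  have hxr : x ≠ r := by
    rintro rfl
    rw [dist_self] at hxk
    omega
  obtain ⟨q, hxq, -⟩ := (hc.preconnected r x).exists_adj_dist hxr.symm
  have hss : (G.neighborSet x).Subsingleton := by
    refine (hp _ hM).resolve_right fun h => ?_
    have : x ∈ G.neighborSet x := h ▸ Set.mem_univ x
    exact G.loopless.irrefl _ this
  have hxq' : ∀ y, G.Adj x y ↔ y = q :=
    fun y => ⟨fun h => hss h hxq, fun h => h ▸ hxq⟩
  have hqk := hlow x q hxk hxq
  have hqr : q ≠ r := by
    rintro rfl
    rw [dist_self] at hqk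
    omega
  refine ⟨x, q, hxr, hqr, hxq', ?_⟩
  have hmem : ∀ v, v ≠ x → v ≠ q → v ∈ ({x, q}ᶜ : Set V) := fun v h1 h2 => by
    simp [h1, h2]
  -- Descend to `r` while avoiding `q`. Below the last level, the next vertex is too close to `r` to
  -- be `q`. In the last level, a vertex whose only neighbour is `q` would be a twin of `x`.
  have key : ∀ j v, G.dist r v = j → v ≠ x → v ≠ q → G.ConnIn {x, q}ᶜ r v := by
    intro j
    induction j with
    | zero =>
      intro v hv h1 h2
      have := hc.dist_eq_zero_iff.1 hv
      subst this
      exact .refl (hmem _ h1 h2)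
    | succ j ih =>
      intro v hv h1 h2
      have hvr : r ≠ v := by
        rintro rfl
        simp at hv
      have : ∃ t, G.Adj v t ∧ G.dist r t + 1 = G.dist r v ∧ t ≠ q := by
        obtain ⟨t, ht, htd⟩ := (hc.preconnected r v).exists_adj_dist hvr
        by_cases hjk : G.dist r v = k
        · by_contra hcon
          push Not at hcon
          have h4 : ∀ y, G.Adj v y ↔ y = q := by
            intro y
            refine ⟨fun h => hcon y h (by have := hlow v y hjk h; omega), ?_⟩
            rintro rfl
            exact (hcon t ht htd) ▸ ht
          exact hp.not_areTwins h3 x v ⟨h1.symm, fun y _ _ => (hxq' y).trans (h4 y).symm⟩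
        · refine ⟨t, ht, htd, ?_⟩
          rintro rfl
          omega
      obtain ⟨t, ht, htd, htq⟩ := this
      have htx : t ≠ x := by
        rintro rfl
        have := hmax v
        omega
      exact (ih t (by omega) htx htq).tail ht.symm (hmem v h1 h2)
  intro u v h1 h2 h4 h5
  exact (key _ u rfl h1 h2).symm.trans (key _ v rfl h4 h5)

/-- A connected distance-hereditary graph without twins is prime. -/
theorem IsDistanceHereditary.isModularPrime {V : Type*} [Finite V] {G : SimpleGraph V}
    (hG : G.IsDistanceHereditary) (hc : G.Connected) (ht : ∀ u v, ¬ G.AreTwins u v) :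
    G.IsModularPrime := by
  by_contra hnp
  have hne : {M : Set V | G.IsModule M ∧ M.Nontrivial ∧ M ≠ Set.univ}.Nonempty := by
    unfold IsModularPrime at hnp
    push Not at hnp
    obtain ⟨M, h1, h2, h3⟩ := hnp
    exact ⟨M, h1, by simpa using h2, h3⟩
  -- A smallest nontrivial proper module `M` induces a prime graph, and it has at least three
  -- vertices because there are no twins. Some `d` outside is complete to `M`, so `M` induces a
  -- graph of diameter at most two. The neighbour of a pendant vertex then dominates it, and the
  -- other vertices of `M` form a forbidden module.
  obtain ⟨M, ⟨hM, hMn, hMu⟩, hmin⟩ := Set.exists_min_image _ Set.ncard (Set.toFinite _) hne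
  have h2 : 3 ≤ M.ncard := by
    by_contra hlt
    have h1 : 1 < M.ncard := Set.one_lt_ncard_iff_nontrivial.2 hMn
    obtain ⟨u, v, huv, rfl⟩ := Set.ncard_eq_two.1 (by omega : M.ncard = 2)
    refine ht u v ⟨huv, fun y hyu hyv => ?_⟩
    rcases hM y (by simp [hyu, hyv]) with h | h
    · exact ⟨fun _ => (h v (by simp)).symm, fun _ => (h u (by simp)).symm⟩
    · exact ⟨fun k => (h u (by simp) k.symm).elim, fun k => (h v (by simp) k.symm).elim⟩
  have h3 : 3 ≤ Nat.card M := h2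
  have hp : (G.induce M).IsModularPrime := by
    intro N hN
    by_contra hcon
    push Not at hcon
    have h4 := hmin _ (show _ ∈ _ from ⟨hM.image_val hN,
      (by simpa using hcon.1 : N.Nontrivial).image Subtype.val_injective, fun h => ?_⟩)
    · have h5 : Subtype.val '' N ⊂ M := by
        refine ⟨by rintro _ ⟨m, _, rfl⟩; exact m.2, fun h => hcon.2 ?_⟩
        ext m
        obtain ⟨m', hm', he⟩ := h m.2
        simpa [← Subtype.ext he] using hm'
      have := Set.ncard_lt_ncard h5
      omega
    · refine hMu (Set.eq_univ_of_univ_subset ?_)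
      rw [← h]
      rintro _ ⟨m, _, rfl⟩
      exact m.2
  obtain ⟨d, hd, hdM⟩ : ∃ d, d ∉ M ∧ ∀ m ∈ M, G.Adj d m := by
    obtain ⟨m, hm⟩ := hMn.nonempty
    obtain ⟨y, hy⟩ := (Set.ne_univ_iff_exists_notMem M).1 hMu
    obtain ⟨p⟩ := hc.preconnected m y
    obtain ⟨e, -, h4, h5⟩ := p.exists_boundary_dart M hm hy
    refine ⟨e.snd, h5, (hM _ h5).resolve_right fun h => h _ h4 e.adj.symm⟩
  obtain ⟨m₀, hm₀⟩ := hMn.nonempty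
  obtain ⟨x, q, -, -, hx, -⟩ := (hG.induce M).exists_extremePendant hp h3 ⟨m₀, hm₀⟩
  have hcM := hp.connected h3
  have hq : ∀ y : M, y ≠ q → G.Adj q y := by
    intro y hy
    by_cases hyx : y = x
    · subst hyx
      exact ((hx q).2 rfl).symm
    obtain ⟨p⟩ := hcM.preconnected x y
    obtain ⟨t, -, h4, h5⟩ := (hG.induce M).exists_adj_dist p (Ne.symm hyx)
    obtain ⟨p'⟩ := hcM.preconnected x t
    have h6 : (G.induce M).dist x y ≤ 2 := by
      rw [hG M hcM]
      exact dist_le (Walk.cons (hdM x x.2).symm (Walk.cons (hdM y y.2) .nil))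
    have hxt : (G.induce M).Adj x t := by
      refine dist_eq_one_iff_adj.1 ?_
      have h8 : x ≠ t := by
        rintro rfl
        exact hy ((hx y).1 h4.symm)
      have := hcM.pos_dist_of_ne h8
      omega
    have := (hx t).1 hxt
    subst this
    exact h4.symm
  have hM' : (G.induce M).IsModule {q}ᶜ := by
    intro v hv
    have : v = q := by simpa using hv
    subst this
    exact .inl fun m hm => hq m hm
  rcases hp _ hM' with h | h
  · have h4 := Set.ncard_add_ncard_compl ({q} : Set M)
    have h5 := Set.ncard_le_one_iff_subsingleton.2 h
    rw [Set.ncard_singleton] at h4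
    omega
  · have : q ∈ ({q}ᶜ : Set M) := h ▸ Set.mem_univ q
    simp at this

end SimpleGraph

namespace SimpleGraph

/-! ### Threads -/

/-- `G.Thread b cs`: the subgraph induced by `b` and `cs` is reduced to a single vertex by treating
the vertices of `cs` in turn. The next vertex `c` is a twin of the root `b` or has no neighbour
among the vertices still to come, and is removed; or the root has no neighbour among the vertices
still to come, and is removed, while `c` becomes the root. -/
inductive Thread {V : Type*} (G : SimpleGraph V) : V → List V → Prop
  | nil (b : V) : Thread G b []
  | twin {b c : V} {cs : List V} (h : ∀ y ∈ cs, G.Adj b y ↔ G.Adj c y) (hs : Thread G b cs) :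
      Thread G b (c :: cs)
  | pendant {b c : V} {cs : List V} (h : ∀ y ∈ cs, ¬ G.Adj c y) (hs : Thread G b cs) :
      Thread G b (c :: cs)
  | shift {b c : V} {cs : List V} (h : ∀ y ∈ cs, ¬ G.Adj b y) (hs : Thread G c cs) :
      Thread G b (c :: cs)

/-- The list `b :: cs` enumerates the set `S` and is a thread. -/
def IsThreadOf {V : Type*} (G : SimpleGraph V) (S : Set V) (b : V) (cs : List V) : Prop :=
  (b :: cs).Nodup ∧ (∀ x, x ∈ b :: cs ↔ x ∈ S) ∧ G.Thread b cs

variable {V : Type*} {G : SimpleGraph V} {S : Set V}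

/-- Vertices of the second list see nothing of the first, so the steps of the first thread stay
valid. Its last root is isolated from what remains and is dropped by `shift`. -/
theorem Thread.append {b b' : V} {cs cs' : List V} (h : G.Thread b cs) (h' : G.Thread b' cs')
    (hd : ∀ x ∈ b :: cs, ∀ y ∈ b' :: cs', ¬ G.Adj x y) : G.Thread b (cs ++ b' :: cs') := by
  induction h with
  | nil b => exact .shift (fun y hy => hd b (by simp) y (by simp [hy])) h'
  | @twin b c cs h hs ih =>
    refine .twin (fun y hy => ?_) (ih fun x hx => hd x (by
      rcases List.mem_cons.1 hx with rfl | hx <;> simp [*]))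
    rcases List.mem_append.1 hy with hy | hy
    · exact h y hy
    · exact iff_of_false (hd b (by simp) y hy) (hd c (by simp) y hy)
  | @pendant b c cs h hs ih =>
    refine .pendant (fun y hy => ?_) (ih fun x hx => hd x (by
      rcases List.mem_cons.1 hx with rfl | hx <;> simp [*]))
    rcases List.mem_append.1 hy with hy | hy
    · exact h y hy
    · exact hd c (by simp) y hy
  | @shift b c cs h hs ih =>
    refine .shift (fun y hy => ?_) (ih fun x hx => hd x (by simp [hx]))
    rcases List.mem_append.1 hy with hy | hy
    · exact h y hy
    · exact hd b (by simp) y hy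

/-- Two vertices that no third vertex of `S` distinguishes. -/
def TwinsIn (G : SimpleGraph V) (S : Set V) (u v : V) : Prop :=
  u ≠ v ∧ ∀ y ∈ S, y ≠ u → y ≠ v → (G.Adj u y ↔ G.Adj v y)

theorem TwinsIn.symm {u v : V} (h : G.TwinsIn S u v) : G.TwinsIn S v u :=
  ⟨h.1.symm, fun y hy h1 h2 => (h.2 y hy h2 h1).symm⟩

theorem AreTwins.twinsIn {u v : S} (h : (G.induce S).AreTwins u v) : G.TwinsIn S u v :=
  ⟨fun e => h.1 (Subtype.ext e), fun y hy h1 h2 =>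
    h.2 ⟨y, hy⟩ (fun e => h1 (congrArg Subtype.val e)) (fun e => h2 (congrArg Subtype.val e))⟩

theorem ConnIn.connected_induce {b : V} (hb : b ∈ S) (h : ∀ x ∈ S, G.ConnIn S b x) :
    (G.induce S).Connected := by
  refine (connected_iff _).2 ⟨fun u v => ?_, ⟨⟨b, hb⟩⟩⟩
  exact (((h u u.2).symm.trans (h v v.2)).induce le_rfl).reachable

/-- Replacing `v` by `u` turns a walk into a walk up to repetitions, since `u` dominates the
neighbours of `v`. -/
theorem ConnIn.diff_singleton {u v x y : V} (h : G.ConnIn S x y) (hu : u ∈ S) (huv : u ≠ v)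
    (hN : ∀ z ∈ S, G.Adj v z → z = u ∨ G.Adj u z) (hx : x ≠ v) (hy : y ≠ v) :
    G.ConnIn (S \ {v}) x y := by
  classical
  have := h.map (G := G) (X := S \ {v}) (fun z => if z = v then u else z) ?_ ?_
  · simpa [hx, hy] using this
  · intro a ha c hc hac
    by_cases h1 : a = v
    · subst h1
      simpa [hac.ne', eq_comm] using hN c hc hac
    · by_cases h2 : c = v
      · subst h2
        simpa [h1, G.adj_comm] using hN a ha hac.symm
      · simp [h1, h2, hac]
  · intro a ha
    by_cases h1 : a = v
    · simp [h1, hu, huv]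
    · simp [h1, ha]

/-- The vertices of `S` that are neither `y` nor adjacent to `y`. -/
def missing (G : SimpleGraph V) (S : Set V) (y : V) : Set V := {z ∈ S | z ≠ y ∧ ¬ G.Adj z y}

theorem IsExtremePendant.connIn_missing {x q u v : S} (h : (G.induce S).IsExtremePendant x q)
    (hu : u ≠ x) (hu' : u ≠ q) (hv : v ≠ x) (hv' : v ≠ q) :
    G.ConnIn (G.missing S x) u v := by
  refine (h.2 u v hu hu' hv hv').map Subtype.val (fun _ _ _ _ h => .inr h) fun z hz => ?_
  simp only [Set.mem_compl_iff, Set.mem_insert_iff, Set.mem_singleton_iff, not_or] at hz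
  exact ⟨z.2, fun e => hz.1 (Subtype.ext e), fun e => hz.2 ((h.1 z).1 (G.symm.symm _ _ e))⟩

/-- The condition on the root `b` of `S` which keeps `b` at the end of a thread. -/
def IsEndOf (G : SimpleGraph V) (S : Set V) (b : V) : Prop :=
  ∀ x ∈ S, ∀ y ∈ S, ¬ (G.ConnIn (G.missing S y) b x ∧ G.ConnIn (G.missing S x) b y)

/-- Otherwise `S` has no twins at all and is prime. Choose an extreme pendant vertex `x` away from
`b`, then a second one `y` away from `x`. By assumption `b` is neither pendant nor the neighbour of
a pendant vertex, so `y` and its neighbour also differ from `b`. Hence `b` reaches each of `x`, `y`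
while missing the other, against `IsEndOf`. -/
theorem IsDistanceHereditary.exists_thread_step (hG : G.IsDistanceHereditary) (hf : S.Finite)
    {b : V} (hb : b ∈ S) (hS : S.Nontrivial) (hc : ∀ x ∈ S, G.ConnIn S b x)
    (ht : ∀ u ∈ S, ∀ v ∈ S, u ≠ b → v ≠ b → ¬ G.TwinsIn S u v) (he : G.IsEndOf S b) :
    ∃ c ∈ S, c ≠ b ∧ (G.TwinsIn S b c ∨ (∀ y ∈ S, G.Adj c y → y = b) ∨
      (∀ y ∈ S, G.Adj b y → y = c)) := by
  by_contra hcon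
  push Not at hcon
  have := hf.to_subtype
  have hcS := ConnIn.connected_induce hb hc
  have htw : ∀ u v : S, ¬ (G.induce S).AreTwins u v := by
    intro u v huv
    have h := huv.twinsIn
    by_cases hu : (u : V) = b
    · exact (hcon v v.2 (hu ▸ h.1.symm)).1 (hu ▸ h)
    · by_cases hv : (v : V) = b
      · exact (hcon u u.2 hu).1 (hv ▸ h.symm)
      · exact ht u u.2 v v.2 hu hv h
  have hp := (hG.induce S).isModularPrime hcS htw
  have h3 : 3 ≤ Nat.card S := by
    by_contra hlt
    have h1 : 1 < S.ncard := (Set.one_lt_ncard_iff_nontrivial_and_finite.2 ⟨hS, hf⟩)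
    have h2 : ¬ 3 ≤ S.ncard := hlt
    obtain ⟨u, v, huv, he⟩ := Set.ncard_eq_two.1 (by omega : S.ncard = 2)
    refine htw ⟨u, by simp [he]⟩ ⟨v, by simp [he]⟩ ⟨by simpa using huv, fun y h1 h2 => ?_⟩
    have h3 : (y : V) = u ∨ (y : V) = v := by simpa [he] using y.2
    rcases h3 with h3 | h3
    · exact absurd (Subtype.ext h3) h1
    · exact absurd (Subtype.ext h3) h2
  obtain ⟨x, q, hxb, hqb, hx⟩ := (hG.induce S).exists_extremePendant hp h3 ⟨b, hb⟩
  obtain ⟨y, p, hyx, hpx, hy⟩ := (hG.induce S).exists_extremePendant hp h3 x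
  have hval : ∀ {a : S}, a ≠ ⟨b, hb⟩ → (a : V) ≠ b := fun h e => h (Subtype.ext e)
  have hyb : y ≠ ⟨b, hb⟩ := by
    rintro rfl
    have hpb : p ≠ ⟨b, hb⟩ := ((hy.1 p).2 rfl).ne'
    obtain ⟨z, hz, hbz, hzp⟩ := (hcon p p.2 (hval hpb)).2.2
    exact hzp (congrArg Subtype.val ((hy.1 ⟨z, hz⟩).1 hbz))
  have hpb : p ≠ ⟨b, hb⟩ := by
    rintro rfl
    obtain ⟨z, hz, hyz, hzb⟩ := (hcon y y.2 (hval hyb)).2.1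
    exact hzb (congrArg Subtype.val ((hy.1 ⟨z, hz⟩).1 hyz))
  have hyq : y ≠ q := by
    rintro rfl
    exact hpx ((hy.1 x).1 ((hx.1 y).2 rfl).symm).symm
  exact he x x.2 y y.2 ⟨hy.connIn_missing (u := ⟨b, hb⟩) hyb.symm hpb.symm hyx.symm hpx.symm,
    hx.connIn_missing (u := ⟨b, hb⟩) hxb.symm hqb.symm hyx hyq⟩

theorem missing_mono {T : Set V} (h : T ⊆ S) (y : V) : G.missing T y ⊆ G.missing S y :=
  fun _ hz => ⟨h hz.1, hz.2⟩

/-- Induction on the size of `S`, removing the vertex found by `exists_thread_step`. Twins are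
excluded only among vertices other than the root, because a removal may well create a twin of the
root; that twin is then removed next or later. -/
theorem IsDistanceHereditary.exists_thread_of_isEndOf (hG : G.IsDistanceHereditary) (k : ℕ) :
    ∀ (S : Set V) (b : V), S.Finite → S.ncard = k → b ∈ S → (∀ x ∈ S, G.ConnIn S b x) →
      (∀ u ∈ S, ∀ v ∈ S, u ≠ b → v ≠ b → ¬ G.TwinsIn S u v) → G.IsEndOf S b →
      ∃ cs, G.IsThreadOf S b cs := by
  induction k with
  | zero =>
    intro S b hf hk hb
    rw [Set.ncard_eq_zero hf] at hk
    simp [hk] at hb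
  | succ k ih =>
    intro S b hf hk hb hc ht he
    by_cases hS : S.Nontrivial
    swap
    · have hS' := Set.not_nontrivial_iff.1 hS
      exact ⟨[], by simp, fun x => ⟨by simp only [List.mem_singleton]; rintro rfl; exact hb,
        fun hx => by simpa using hS' hx hb⟩, .nil b⟩
    have hcard : ∀ c ∈ S, (S \ {c}).ncard = k := fun c hc => by
      rw [Set.ncard_sdiff_singleton_of_mem hc]
      omega
    have hmem : ∀ {c d : V} {cs : List V}, c ∈ S → G.IsThreadOf (S \ {c}) d cs →
        (c :: d :: cs).Nodup ∧ ∀ x, x ∈ c :: d :: cs ↔ x ∈ S := by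
      intro c d cs hc h
      refine ⟨List.nodup_cons.2 ⟨fun h' => ((h.2.1 c).1 h').2 rfl, h.1⟩, fun x => ?_⟩
      rw [List.mem_cons, h.2.1 x]
      by_cases hx : x = c
      · simp [hx, hc]
      · simp [hx]
    have hswap : ∀ {c d : V} {cs : List V}, ((c :: d :: cs).Nodup ∧
        ∀ x, x ∈ c :: d :: cs ↔ x ∈ S) → (d :: c :: cs).Nodup ∧
        ∀ x, x ∈ d :: c :: cs ↔ x ∈ S := fun h =>
      ⟨(List.Perm.swap _ _ _).nodup_iff.1 h.1, fun x => ((List.Perm.swap _ _ _).mem_iff).trans (h.2 x)⟩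
    -- Both removals that keep the root are treated together. The last condition says that a pair
    -- distinguished by `c` is also distinguished by `b`, so no new pair of twins appears away from
    -- the root.
    have hrem : ∀ c ∈ S, c ≠ b → (∀ z ∈ S, G.Adj c z → z = b ∨ G.Adj b z) →
        (∀ u ∈ S, ∀ v ∈ S, u ≠ b → v ≠ b → u ≠ c → v ≠ c → (G.Adj u c ↔ G.Adj v c) ∨
          ¬ (G.Adj u b ↔ G.Adj v b)) →
        ∃ cs, G.IsThreadOf (S \ {c}) b cs := by
      intro c hcS hcb hN htc
      refine ih (S \ {c}) b (hf.sdiff) (hcard c hcS) ⟨hb, hcb.symm⟩ (fun x hx => ?_) ?_ ?_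
      · exact (hc x hx.1).diff_singleton hb hcb.symm hN hcb.symm hx.2
      · rintro u ⟨hu, huc⟩ v ⟨hv, hvc⟩ hub hvb huv
        refine ht u hu v hv hub hvb ⟨huv.1, fun y hy h1 h2 => ?_⟩
        by_cases hyc : y = c
        · subst hyc
          refine (htc u hu v hv hub hvb huc hvc).resolve_right fun h => h ?_
          exact huv.2 b ⟨hb, hcb.symm⟩ hub.symm hvb.symm
        · exact huv.2 y ⟨hy, hyc⟩ h1 h2
      · rintro x ⟨hx, -⟩ y ⟨hy, -⟩ ⟨h1, h2⟩
        exact he x hx y hy ⟨h1.mono (missing_mono Set.sdiff_subset _),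
          h2.mono (missing_mono Set.sdiff_subset _)⟩
    obtain ⟨c, hcS, hcb, h | h | h⟩ := hG.exists_thread_step hf hb hS hc ht he
    · obtain ⟨cs, hcs⟩ := hrem c hcS hcb
        (fun z hz hcz => by
          by_cases hzb : z = b
          · exact .inl hzb
          · exact .inr ((h.2 z hz hzb hcz.ne').2 hcz))
        (fun u hu v hv hub hvb huc hvc => by
          by_cases h1 : G.Adj u b ↔ G.Adj v b
          · left
            rw [G.adj_comm u c, G.adj_comm v c, ← h.2 u hu hub huc, ← h.2 v hv hvb hvc,
              G.adj_comm, h1, G.adj_comm]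
          · exact .inr h1)
      have h1 := hswap (hmem hcS hcs)
      refine ⟨c :: cs, h1.1, h1.2, .twin (fun y hy => ?_) hcs.2.2⟩
      have h2 := h1.1
      simp only [List.nodup_cons, List.mem_cons, not_or] at h2
      exact h.2 y ((hcs.2.1 y).1 (by simp [hy])).1 (by rintro rfl; exact h2.1.2 hy)
        (by rintro rfl; exact h2.2.1 hy)
    · obtain ⟨cs, hcs⟩ := hrem c hcS hcb (fun z hz hcz => .inl (h z hz hcz))
        (fun u hu v hv hub hvb huc hvc => .inl (iff_of_false
          (fun h1 => hub (h u hu h1.symm)) (fun h1 => hvb (h v hv h1.symm))))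
      have h1 := hswap (hmem hcS hcs)
      refine ⟨c :: cs, h1.1, h1.2, .pendant (fun y hy hcy => ?_) hcs.2.2⟩
      have h2 := h1.1
      simp only [List.nodup_cons, List.mem_cons, not_or] at h2
      have := h y ((hcs.2.1 y).1 (by simp [hy])).1 hcy
      subst this
      exact h2.1.2 hy
    · have hbc : G.Adj b c := by
        obtain ⟨-, h2⟩ := hc c hcS
        rcases Relation.ReflTransGen.cases_head h2 with h3 | ⟨d, hd, -⟩
        · exact absurd h3.symm hcb
        · exact (h d hd.2 hd.1) ▸ hd.1
      obtain ⟨cs, hcs⟩ := ih (S \ {b}) c hf.sdiff (hcard b hb) ⟨hcS, hcb⟩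
        (fun x hx => (((hc c hcS).symm.trans (hc x hx.1)).diff_singleton hcS hcb
          (fun z hz hbz => .inl (h z hz hbz)) hcb hx.2))
        (by
          rintro u ⟨hu, hub⟩ v ⟨hv, hvb⟩ huc hvc huv
          refine ht u hu v hv hub hvb ⟨huv.1, fun y hy h1 h2 => ?_⟩
          by_cases hyb : y = b
          · subst hyb
            exact iff_of_false (fun h1 => huc (h u hu h1.symm)) (fun h1 => hvc (h v hv h1.symm))
          · exact huv.2 y ⟨hy, hyb⟩ h1 h2)
        (by
          -- A walk from the new root `c` extends back to `b`. Since `c` is the only neighbour of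
          -- `b` and `y` is not `c`, the vertex `b` misses `y` as well.
          have key : ∀ x y, y ∈ S \ {b} → G.ConnIn (G.missing (S \ {b}) y) c x →
              G.ConnIn (G.missing S y) b x := by
            intro x y hy h1
            have h2 := h1.mono (missing_mono Set.sdiff_subset _)
            refine ConnIn.trans (ConnIn.single ⟨hb, ?_, fun h3 => ?_⟩ hbc h2.1) h2
            · exact fun h3 => hy.2 h3.symm
            · exact h1.1.2.1 (h y hy.1 h3).symm
          rintro x hx y hy ⟨h1, h2⟩
          exact he x hx.1 y hy.1 ⟨key x y hy h1, key y x hx h2⟩)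
      have h1 := hmem hb hcs
      refine ⟨c :: cs, h1.1, h1.2, .shift (fun y hy hby => ?_) hcs.2.2⟩
      have h2 := h1.1
      simp only [List.nodup_cons, List.mem_cons, not_or] at h2
      have := h y ((hcs.2.1 y).1 (by simp [hy])).1 hby
      subst this
      exact h2.2.1 hy

/-- Two vertices reached from `x` as in `IsEndOf` are joined without `x` and `q`, because deleting
these leaves a connected graph. This is the third path of an asteroidal triple. -/
theorem IsATFree.isEndOf (hA : G.IsATFree) {x q : S} (h : (G.induce S).IsExtremePendant x q) :
    G.IsEndOf S x := by
  rintro y hy z hz ⟨h1, h2⟩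
  have hxy : ¬ G.Adj x y ∧ (x : V) ≠ y := ⟨h2.1.2.2, h2.1.2.1⟩
  have hxz : ¬ G.Adj x z ∧ (x : V) ≠ z := ⟨h1.1.2.2, h1.1.2.1⟩
  have hq : G.Adj x q := (h.1 q).2 rfl
  have h3 := h.connIn_missing (u := ⟨y, hy⟩) (v := ⟨z, hz⟩)
    (fun e => hxy.2 (congrArg Subtype.val e).symm) (by rintro rfl; exact hxy.1 hq)
    (fun e => hxz.2 (congrArg Subtype.val e).symm) (by rintro rfl; exact hxz.1 hq)
  refine hA x y z ⟨?_, ?_, ?_⟩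
  · obtain ⟨p, hp, hp'⟩ := h1.exists_isPath
    exact ⟨p, hp, fun w hw => (hp' w hw).2⟩
  · obtain ⟨p, hp, hp'⟩ := h3.exists_isPath
    exact ⟨p, hp, fun w hw => (hp' w hw).2⟩
  · obtain ⟨p, hp, hp'⟩ := h2.exists_isPath
    exact ⟨p, hp, fun w hw => (hp' w hw).2⟩

/-- Induced subgraphs of AT-free distance-hereditary graphs without twins have a thread. -/
theorem IsDistanceHereditary.exists_thread (hG : G.IsDistanceHereditary) (hA : G.IsATFree)
    (k : ℕ) : ∀ S : Set V, S.Finite → S.ncard = k → S.Nonempty →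
      (∀ u ∈ S, ∀ v ∈ S, ¬ G.TwinsIn S u v) → ∃ b cs, G.IsThreadOf S b cs := by
  induction k using Nat.strong_induction_on with
  | _ k ih =>
    rintro S hf hk ⟨b, hb⟩ ht
    have := hf.to_subtype
    by_cases hc : ∀ x ∈ S, G.ConnIn S b x
    · by_cases h3 : 3 ≤ Nat.card S
      · have hp := (hG.induce S).isModularPrime (ConnIn.connected_induce hb hc)
          fun u v h => ht u u.2 v v.2 h.twinsIn
        obtain ⟨x, q, -, -, hx⟩ := (hG.induce S).exists_extremePendant hp h3 ⟨b, hb⟩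
        obtain ⟨cs, hcs⟩ := hG.exists_thread_of_isEndOf k S x hf hk x.2
          (fun y hy => (hc x x.2).symm.trans (hc y hy))
          (fun u hu v hv _ _ => ht u hu v hv) (hA.isEndOf hx)
        exact ⟨x, cs, hcs⟩
      · have h3' : ¬ 3 ≤ S.ncard := h3
        have h1 : S.ncard = 1 := by
          have h0 : S.ncard ≠ 0 := fun h => by
            rw [Set.ncard_eq_zero hf] at h
            simp [h] at hb
          by_contra h1
          obtain ⟨u, v, huv, he⟩ := Set.ncard_eq_two.1 (by omega : S.ncard = 2)
          refine ht u (by simp [he]) v (by simp [he]) ⟨huv, fun y hy h1 h2 => ?_⟩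
          simp [he, h1, h2] at hy
        obtain ⟨a, ha⟩ := Set.ncard_eq_one.1 h1
        exact ⟨a, [], by simp, fun x => by simp [ha], .nil a⟩
    · push Not at hc
      obtain ⟨x, hx, hbx⟩ := hc
      let T : Set V := {y | G.ConnIn S b y}
      have hT : T ⊆ S := fun y hy => hy.right_mem
      have hsep : ∀ y ∈ T, ∀ z ∈ S \ T, ¬ G.Adj y z := fun y hy z hz hyz =>
        hz.2 (hy.tail hyz hz.1)
      have h1 : T.ncard < k := hk ▸ Set.ncard_lt_ncard ⟨hT, fun h => hbx (h hx)⟩ hf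
      have h2 : (S \ T).ncard < k := hk ▸ Set.ncard_lt_ncard
        ⟨Set.sdiff_subset, fun h => (h hb).2 (ConnIn.refl hb)⟩ hf
      obtain ⟨a, as, has⟩ := ih _ h1 T (hf.subset hT) rfl ⟨b, ConnIn.refl hb⟩ (by
        intro u hu v hv huv
        refine ht u (hT hu) v (hT hv) ⟨huv.1, fun y hy h1 h2 => ?_⟩
        by_cases hyT : y ∈ T
        · exact huv.2 y hyT h1 h2
        · exact iff_of_false (hsep u hu y ⟨hy, hyT⟩) (hsep v hv y ⟨hy, hyT⟩))
      obtain ⟨c, cs, hcs⟩ := ih _ h2 (S \ T) hf.sdiff rfl ⟨x, hx, hbx⟩ (by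
        intro u hu v hv huv
        refine ht u hu.1 v hv.1 ⟨huv.1, fun y hy h1 h2 => ?_⟩
        by_cases hyT : y ∈ T
        · exact iff_of_false (fun h => hsep y hyT u hu h.symm) (fun h => hsep y hyT v hv h.symm)
        · exact huv.2 y ⟨hy, hyT⟩ h1 h2)
      refine ⟨a, as ++ c :: cs, ?_, fun y => ?_, has.2.2.append hcs.2.2 fun y hy z hz =>
        hsep y ((has.2.1 y).1 hy) z ((hcs.2.1 z).1 hz)⟩
      · rw [← List.cons_append]
        exact has.1.append hcs.1 fun y hy hy' => ((hcs.2.1 y).1 hy').2 ((has.2.1 y).1 hy)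
      · rw [← List.cons_append, List.mem_append, has.2.1, hcs.2.1]
        exact ⟨fun h => h.elim (fun h => hT h) (fun h => h.1), fun h =>
          (em (y ∈ T)).imp_right fun h' => ⟨h, h'⟩⟩

end SimpleGraph

namespace SimpleGraph

/-! ### Permutation graphs -/

section Permutation

variable {V : Type*} {G : SimpleGraph V} {S : Set V}

/-- The subgraph induced by `S` is represented by the two orders which the injections `f` and `g`
define on `S`. -/
structure Represents (G : SimpleGraph V) (S : Set V) (f g : V → ℤ) : Prop where
  inj_left : Set.InjOn f S
  inj_right : Set.InjOn g S
  adj_iff : ∀ u ∈ S, ∀ v ∈ S, G.Adj u v ↔ (f u < f v ∧ g v < g u) ∨ (f v < f u ∧ g u < g v)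

theorem Represents.swap {f g : V → ℤ} (h : G.Represents S f g) : G.Represents S g f :=
  ⟨h.inj_right, h.inj_left, fun u hu v hv => by rw [h.adj_iff u hu v hv]; tauto⟩

/-- A vertex `c` is added to a representation. -/
theorem Represents.insert {f g : V → ℤ} (h : G.Represents S f g) {c : V} (hc : c ∉ S) (i j : ℤ)
    (hi : ∀ y ∈ S, 2 * f y ≠ i) (hj : ∀ y ∈ S, 2 * g y ≠ j)
    (hadj : ∀ y ∈ S, G.Adj c y ↔ (i < 2 * f y ∧ 2 * g y < j) ∨ (2 * f y < i ∧ j < 2 * g y))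
    [DecidableEq V] :
    G.Represents (insert c S) (fun x => if x = c then i else 2 * f x)
      (fun x => if x = c then j else 2 * g x) := by
  have hne : ∀ y ∈ S, y ≠ c := by rintro y hy rfl; exact hc hy
  have aux : ∀ (f : V → ℤ) (i : ℤ), Set.InjOn f S → (∀ y ∈ S, 2 * f y ≠ i) →
      Set.InjOn (fun x => if x = c then i else 2 * f x) (Insert.insert c S) := by
    intro f i hf hi x hx y hy hxy
    rcases hx with rfl | hx <;> rcases hy with rfl | hy
    · rfl
    · simp only [if_true, hne y hy, if_false] at hxy
      exact absurd hxy.symm (hi y hy)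
    · simp only [if_true, hne x hx, if_false] at hxy
      exact absurd hxy (hi x hx)
    · simp only [hne x hx, hne y hy, if_false] at hxy
      exact hf hx hy (by omega)
  refine ⟨aux f i h.inj_left hi, aux g j h.inj_right hj, ?_⟩
  rintro x (rfl | hx) y (rfl | hy)
  · simp
  · simpa [hne y hy] using hadj y hy
  · rw [G.adj_comm]
    simp only [hne x hx, if_true, if_false]
    rw [hadj x hx]
    tauto
  · simp only [hne x hx, hne y hy, if_false]
    rw [h.adj_iff x hx y hy]
    omega

theorem Represents.congr_set {T : Set V} {f g : V → ℤ} (h : G.Represents S f g) (e : S = T) :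
    G.Represents T f g := e ▸ h

theorem exists_forall_lt_of_finite (hS : S.Finite) (f : V → ℤ) :
    ∃ N, ∀ y ∈ S, f y < N := by
  obtain ⟨N, hN⟩ := (hS.image f).bddAbove
  exact ⟨N + 1, fun y hy => Int.lt_add_one_iff.2 (hN ⟨y, hy, rfl⟩)⟩

/-- A twin `c` of a vertex `b` of a representation is added to the representation, so that `b` stays
maximal in the second order if it was. -/
theorem Represents.insert_twin {f g : V → ℤ} (h : G.Represents S f g) {b c : V}
    (hc : c ∉ S) (hb : b ∈ S) (ht : ∀ y ∈ S, y ≠ b → (G.Adj b y ↔ G.Adj c y)) :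
    ∃ f' g' : V → ℤ, G.Represents (Insert.insert c S) f' g' ∧
      ((∀ y ∈ S, y ≠ b → g y < g b) → ∀ y ∈ Insert.insert c S, y ≠ b → g' y < g' b) := by
  classical
  have hne : ∀ y ∈ S, y ≠ c := by rintro y hy rfl; exact hc hy
  by_cases hbc : G.Adj c b
  -- Old coordinates are doubled, so odd values next to those of `b` are free. The second coordinate
  -- is taken below that of `b` in both cases, to keep `b` maximal; the first decides whether `b`
  -- and `c` cross.
  · refine ⟨_, _, h.insert hc (2 * f b + 1) (2 * g b - 1) (fun y _ => by omega)
      (fun y _ => by omega) fun y hy => ?_, fun hm y hy hyb => ?_⟩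
    · by_cases hyb : y = b
      · subst hyb
        simp only [hbc, true_iff]
        omega
      · rw [← ht y hy hyb, h.adj_iff b hb y hy]
        have h1 : f y ≠ f b := fun e => hyb (h.inj_left hy hb e)
        have h2 : g y ≠ g b := fun e => hyb (h.inj_right hy hb e)
        omega
    · simp only [(hne b hb), if_false]
      rcases hy with rfl | hy
      · simp
      · have := hm y hy hyb
        simp only [hne y hy, if_false]
        omega
  · refine ⟨_, _, h.insert hc (2 * f b - 1) (2 * g b - 1) (fun y _ => by omega)
      (fun y _ => by omega) fun y hy => ?_, fun hm y hy hyb => ?_⟩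
    · by_cases hyb : y = b
      · subst hyb
        simp only [hbc, false_iff]
        omega
      · rw [← ht y hy hyb, h.adj_iff b hb y hy]
        have h1 : f y ≠ f b := fun e => hyb (h.inj_left hy hb e)
        have h2 : g y ≠ g b := fun e => hyb (h.inj_right hy hb e)
        omega
    · simp only [(hne b hb), if_false]
      rcases hy with rfl | hy
      · simp
      · have := hm y hy hyb
        simp only [hne y hy, if_false]
        omega

/-- With the root last in the second order, a vertex placed last in the first order and just below
the root in the second crosses the root alone. For `pendant`, this is where a neighbour of the root
goes; a non-neighbour goes first in both orders. For `shift`, the old root gets this place relative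
to the new one, and exchanging the two orders makes it last in the second; if the two roots are not
adjacent, it goes last in both. -/
theorem Thread.exists_represents {b : V} {cs : List V} (h : G.Thread b cs)
    (hn : (b :: cs).Nodup) : ∃ f g : V → ℤ, G.Represents {x | x ∈ b :: cs} f g ∧
      ∀ y ∈ cs, g y < g b := by
  classical
  induction h with
  | nil b =>
    refine ⟨fun _ => 0, fun _ => 0, ⟨?_, ?_, ?_⟩, by simp⟩
    · intro x hx y hy _
      simp only [List.mem_singleton, Set.mem_ofPred_eq] at hx hy
      exact hx.trans hy.symm
    · intro x hx y hy _
      simp only [List.mem_singleton, Set.mem_ofPred_eq] at hx hy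
      exact hx.trans hy.symm
    · intro x hx y hy
      simp only [List.mem_singleton, Set.mem_ofPred_eq] at hx hy
      subst hx hy
      simp
  | @twin b c cs h hs ih =>
    simp only [List.nodup_cons, List.mem_cons, not_or] at hn
    obtain ⟨f, g, hr, hm⟩ := ih (by simp [hn])
    obtain ⟨f', g', hr', hm'⟩ := hr.insert_twin (b := b) (c := c)
      (by simp only [List.mem_cons, Set.mem_ofPred_eq, not_or]; exact ⟨Ne.symm hn.1.1, hn.2.1⟩)
      (by simp) (fun y hy hyb => h y (by simpa [hyb] using hy))
    refine ⟨f', g', hr'.congr_set ?_, fun y hy => hm' (fun z hz hzb =>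
      hm z (by simpa [hzb] using hz)) y ?_ ?_⟩
    · ext x
      simp only [List.mem_cons, Set.mem_insert_iff, Set.mem_ofPred_eq]
      tauto
    · simp only [List.mem_cons, Set.mem_insert_iff, Set.mem_ofPred_eq] at hy ⊢
      tauto
    · rintro rfl
      exact absurd (List.mem_cons.1 hy) (by simp [hn])
  | @pendant b c cs h hs ih =>
    simp only [List.nodup_cons, List.mem_cons, not_or] at hn
    obtain ⟨f, g, hr, hm⟩ := ih (by simp [hn])
    have hcS : c ∉ {x | x ∈ b :: cs} := by
      simp only [List.mem_cons, Set.mem_ofPred_eq, not_or]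
      exact ⟨Ne.symm hn.1.1, hn.2.1⟩
    have hset : Insert.insert c {x | x ∈ b :: cs} = {x | x ∈ b :: c :: cs} := by
      ext x
      simp only [List.mem_cons, Set.mem_insert_iff, Set.mem_ofPred_eq]
      tauto
    have hfin : {x | x ∈ b :: cs}.Finite := List.finite_toSet _
    by_cases hbc : G.Adj c b
    · obtain ⟨N, hN⟩ := exists_forall_lt_of_finite hfin f
      refine ⟨_, _, (hr.insert hcS (2 * N) (2 * g b - 1) (fun y hy => ?_) (fun y _ => by omega)
        fun y hy => ?_).congr_set hset, fun y hy => ?_⟩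
      · have := hN y hy
        omega
      · have h1 := hN y hy
        rcases List.mem_cons.1 hy with rfl | hy
        · simp only [hbc, true_iff]
          omega
        · have := hm y hy
          simp only [h y hy, false_iff]
          omega
      · simp only [hn.1.1, if_false]
        rcases List.mem_cons.1 hy with rfl | hyc
        · simp
        · have := hm y hyc
          have h2 : y ≠ c := by rintro rfl; exact hn.2.1 hyc
          simp only [h2, if_false]
          omega
    · obtain ⟨N, hN⟩ := exists_forall_lt_of_finite hfin (fun y => - f y)
      obtain ⟨M, hM⟩ := exists_forall_lt_of_finite hfin (fun y => - g y)
      refine ⟨_, _, (hr.insert hcS (- 2 * N) (- 2 * M) (fun y hy => ?_) (fun y hy => ?_)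
        fun y hy => ?_).congr_set hset, fun y hy => ?_⟩
      · have := hN y hy
        omega
      · have := hM y hy
        omega
      · have h1 := hN y hy
        have h2 := hM y hy
        have h3 : ¬ G.Adj c y := by
          rcases List.mem_cons.1 hy with rfl | hy
          · exact hbc
          · exact h y hy
        simp only [h3, false_iff]
        omega
      · simp only [hn.1.1, if_false]
        have h3 := hM b (by simp)
        rcases List.mem_cons.1 hy with rfl | hyc
        · simp only [if_true]
          omega
        · have := hm y hyc
          have h2 : y ≠ c := by rintro rfl; exact hn.2.1 hyc
          simp only [h2, if_false]
          omega
  | @shift b c cs h hs ih =>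
    simp only [List.nodup_cons, List.mem_cons, not_or] at hn
    obtain ⟨f, g, hr, hm⟩ := ih (by simp [hn])
    have hcS : b ∉ {x | x ∈ c :: cs} := by
      simp only [List.mem_cons, Set.mem_ofPred_eq, not_or]
      exact hn.1
    have hset : Insert.insert b {x | x ∈ c :: cs} = {x | x ∈ b :: c :: cs} := by
      ext x
      simp
    have hfin : {x | x ∈ c :: cs}.Finite := List.finite_toSet _
    obtain ⟨N, hN⟩ := exists_forall_lt_of_finite hfin f
    by_cases hbc : G.Adj b c
    · refine ⟨_, _, ((hr.insert hcS (2 * N) (2 * g c - 1) (fun y hy => ?_) (fun y _ => by omega)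
        fun y hy => ?_).congr_set hset).swap, fun y hy => ?_⟩
      · have := hN y hy
        omega
      · have h1 := hN y hy
        rcases List.mem_cons.1 hy with rfl | hy
        · simp only [hbc, true_iff]
          omega
        · have := hm y hy
          simp only [h y hy, false_iff]
          omega
      · have h2 : y ≠ b := by rintro rfl; exact hcS hy
        have := hN y hy
        simp only [h2, if_true, if_false]
        omega
    · obtain ⟨M, hM⟩ := exists_forall_lt_of_finite hfin g
      refine ⟨_, _, (hr.insert hcS (2 * N) (2 * M) (fun y hy => ?_) (fun y hy => ?_)
        fun y hy => ?_).congr_set hset, fun y hy => ?_⟩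
      · have := hN y hy
        omega
      · have := hM y hy
        omega
      · have h1 := hN y hy
        have h2 := hM y hy
        have h3 : ¬ G.Adj b y := by
          rcases List.mem_cons.1 hy with rfl | hy
          · exact hbc
          · exact h y hy
        simp only [h3, false_iff]
        omega
      · have h2 : y ≠ b := by rintro rfl; exact hcS hy
        have := hM y hy
        simp only [h2, if_true, if_false]
        omega

theorem IsDistanceHereditary.exists_represents (hG : G.IsDistanceHereditary) (hA : G.IsATFree)
    (k : ℕ) : ∀ S : Set V, S.Finite → S.ncard = k → ∃ f g : V → ℤ, G.Represents S f g := by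
  induction k with
  | zero =>
    intro S hf hk
    rw [Set.ncard_eq_zero hf] at hk
    subst hk
    exact ⟨fun _ => 0, fun _ => 0, by simp, by simp, by simp⟩
  | succ k ih =>
    intro S hf hk
    by_cases ht : ∃ u ∈ S, ∃ v ∈ S, G.TwinsIn S u v
    · obtain ⟨u, hu, v, hv, ht⟩ := ht
      obtain ⟨f, g, hr⟩ := ih (S \ {v}) hf.sdiff (by
        rw [Set.ncard_sdiff_singleton_of_mem hv]
        omega)
      obtain ⟨f', g', hr', -⟩ := hr.insert_twin (b := u) (c := v) (by simp) ⟨hu, ht.1⟩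
        fun y hy hyu => ht.2 y hy.1 hyu hy.2
      exact ⟨f', g', hr'.congr_set (Set.insert_sdiff_self_of_mem hv)⟩
    · push Not at ht
      obtain ⟨b, cs, h⟩ := hG.exists_thread hA (k + 1) S hf hk
        (Set.nonempty_of_ncard_ne_zero (by omega)) ht
      obtain ⟨f, g, hr, -⟩ := h.2.2.exists_represents h.1
      exact ⟨f, g, hr.congr_set (Set.ext h.2.1)⟩

theorem exists_equiv_fin_lt_iff [Finite V] (f : V → ℤ) (hf : Function.Injective f) :
    ∃ σ : V ≃ Fin (Nat.card V), ∀ u v, σ u < σ v ↔ f u < f v := by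
  classical
  have := Fintype.ofFinite V
  let _ : LinearOrder V := LinearOrder.lift' f hf
  let e := (Fintype.orderIsoFinOfCardEq V (Nat.card_eq_fintype_card (α := V)).symm).symm
  refine ⟨e.toEquiv, fun u v => ?_⟩
  exact e.lt_iff_lt

theorem Represents.isPermutationGraph [Finite V] {f g : V → ℤ}
    (h : G.Represents Set.univ f g) : G.IsPermutationGraph := by
  obtain ⟨σ, hσ⟩ := exists_equiv_fin_lt_iff f (Set.injOn_univ.1 h.inj_left)
  obtain ⟨τ, hτ⟩ := exists_equiv_fin_lt_iff g (Set.injOn_univ.1 h.inj_right)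
  refine ⟨σ, τ, fun u v => ?_⟩
  rw [h.adj_iff u trivial v trivial, hσ, hσ, hτ, hτ]

/-- A vertex other than `y` and not adjacent to it lies on the same side of `y` in both orders, and
adjacent vertices cannot lie on different sides. So a path missing `y` stays on one side, which is
impossible for the vertex of the triple that is in the middle of `σ`. -/
theorem IsPermutationGraph.isATFree (h : G.IsPermutationGraph) : G.IsATFree := by
  obtain ⟨σ, τ, h⟩ := h
  have hlt : ∀ u v, u ≠ v → ¬ G.Adj u v → (σ u < σ v ∧ τ u < τ v) ∨ (σ v < σ u ∧ τ v < τ u) := by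
    intro u v hne hadj
    rw [h] at hadj
    have h1 : σ u ≠ σ v := fun e => hne (σ.injective e)
    have h2 : τ u ≠ τ v := fun e => hne (τ.injective e)
    omega
  have key : ∀ x y z, G.JoinedMissing x z y → σ x < σ y → σ z < σ y := by
    rintro x y z ⟨p, -, hp⟩ hx
    induction p with
    | nil => exact hx
    | @cons a b c hab p ih =>
      refine ih (fun w hw => hp w (by simp [hw])) ?_
      have h1 := hp a (by simp)
      have h2 := hp b (by simp)
      have h3 := hlt a y h1.1 h1.2
      have h4 := hlt b y h2.1 h2.2
      rw [h] at hab
      omega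
  have hsymm : ∀ x y z, G.JoinedMissing x z y → G.JoinedMissing z x y := by
    rintro x y z ⟨p, hp, h⟩
    exact ⟨p.reverse, hp.reverse, by simpa using h⟩
  rintro x y z ⟨h1, h2, h3⟩
  have hne : ∀ {x y z}, G.JoinedMissing x y z → σ x ≠ σ z ∧ σ y ≠ σ z := by
    rintro x y z ⟨p, -, hp⟩
    exact ⟨fun e => (hp x (by simp)).1 (σ.injective e),
      fun e => (hp y (by simp)).1 (σ.injective e)⟩
  have a1 := key _ _ _ h1
  have a2 := key _ _ _ (hsymm _ _ _ h1)
  have b1 := key _ _ _ h2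
  have b2 := key _ _ _ (hsymm _ _ _ h2)
  have c1 := key _ _ _ h3
  have c2 := key _ _ _ (hsymm _ _ _ h3)
  have d1 := hne h1
  have d2 := hne h2
  have d3 := hne h3
  omega

theorem isATFree_and_iff_isPermutationGraph_and [Finite V] :
    (G.IsATFree ∧ G.IsDistanceHereditary) ↔ (G.IsPermutationGraph ∧ G.IsDistanceHereditary) := by
  refine ⟨fun ⟨hA, hG⟩ => ⟨?_, hG⟩, fun ⟨hP, hG⟩ => ⟨hP.isATFree, hG⟩⟩
  obtain ⟨f, g, h⟩ := hG.exists_represents hA _ Set.univ Set.finite_univ rfl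
  exact h.isPermutationGraph

end Permutation

end SimpleGraph

/-! ### Contraction sequences -/

namespace SimpleGraph

/-- `G.Prunes a b cs s`: `s` lists the contractions by which a pendant vertex `a` with neighbour `b`
and the further vertices `cs`, treated in turn, are contracted to a single vertex. -/
inductive Prunes {V : Type*} (G : SimpleGraph V) : V → V → List V → List (V × V) → Prop
  | last (a b : V) : Prunes G a b [] [(a, b)]
  | twin {a b c : V} {cs : List V} {s : List (V × V)} (h : ∀ y ∈ cs, G.Adj b y ↔ G.Adj c y)
      (hs : Prunes G a b cs s) : Prunes G a b (c :: cs) ((b, c) :: s)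
  | pendant {a b c : V} {cs : List V} {s : List (V × V)} (h : ∀ y ∈ cs, ¬ G.Adj c y)
      (hs : Prunes G a b cs s) : Prunes G a b (c :: cs) ((a, c) :: s)
  | shift {a b c : V} {cs : List V} {s : List (V × V)} (h : ∀ y ∈ cs, ¬ G.Adj b y)
      (hs : Prunes G a c cs s) : Prunes G a b (c :: cs) ((a, b) :: s)

theorem Thread.exists_prunes {V : Type*} {G : SimpleGraph V} {b : V} {cs : List V}
    (h : G.Thread b cs) (a : V) : ∃ s, G.Prunes a b cs s := by
  induction h with
  | nil b => exact ⟨_, .last a b⟩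
  | twin h _ ih => exact ⟨_, .twin h ih.choose_spec⟩
  | pendant h _ ih => exact ⟨_, .pendant h ih.choose_spec⟩
  | shift h _ ih => exact ⟨_, .shift h ih.choose_spec⟩

end SimpleGraph

namespace Trigraph

variable {V : Type*} {G : SimpleGraph V} {T : Trigraph V}

theorem ext_of_eq {T T' : Trigraph V} (h1 : T.verts = T'.verts) (h2 : T.black = T'.black)
    (h3 : T.red = T'.red) : T = T' := by
  cases T
  cases T'
  cases h1
  cases h2
  cases h3
  rfl

/-- The trigraph without red edges that a graph induces on a set of vertices. -/
def restrict (G : SimpleGraph V) (S : Set V) : Trigraph V where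
  verts := S
  black :=
    { Adj := fun x y => x ∈ S ∧ y ∈ S ∧ G.Adj x y
      symm := ⟨fun _ _ h => ⟨h.2.1, h.1, h.2.2.symm⟩⟩
      loopless := ⟨fun x h => G.loopless.irrefl x h.2.2⟩ }
  red := ⊥
  black_mem := fun h => h.1
  red_mem := fun h => h.elim
  not_black_and_red := fun _ h => h

theorem restrict_univ : restrict G Set.univ = ofGraph G := by
  refine ext_of_eq rfl ?_ rfl
  ext x y
  simp [restrict, ofGraph]

theorem underlying_contract (u v : V) : (T.contract u v).underlying = T.contractUnderlying u v := by
  refine sup_sdiff_cancel_right ?_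
  intro x y h
  exact ⟨h.1, h.2.1, h.2.2.1.ne, .inl (.inl h.2.2.1)⟩

/-- Twins agree on every other vertex of `S`, so their contraction makes no red edge and amounts to
a deletion. -/
theorem contract_restrict_of_twinsIn {S : Set V} {u v : V} (hv : v ∈ S)
    (h : G.TwinsIn S u v) : (restrict G S).contract u v = restrict G (S \ {v}) := by
  have hb : ∀ x y, (restrict G (S \ {v})).black.Adj x y →
      ((restrict G S).contractBlack u v).Adj x y := by
    rintro x y ⟨h1, h2, h3⟩
    refine ⟨h1, h2, ⟨h1.1, h2.1, h3⟩, ?_, ?_⟩ <;> rintro rfl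
    · exact ⟨hv, h2.1, (h.2 y h2.1 h3.ne' h2.2).1 h3⟩
    · exact ⟨hv, h1.1, (h.2 x h1.1 h3.ne h1.2).1 h3.symm⟩
  have hu : ∀ x y, ((restrict G S).contractUnderlying u v).Adj x y →
      (restrict G (S \ {v})).black.Adj x y := by
    have key : ∀ x y, x ∈ S → x ≠ v → x ≠ y → (restrict G S).underlying.Adj v x → y = u →
        G.Adj x y := by
      rintro x y hx hxv hxy (h1 | h1) rfl
      · exact ((h.2 x hx hxy hxv).2 h1.2.2).symm
      · exact h1.elim
    rintro x y ⟨h1, h2, h3, h4 | ⟨h4, h5⟩ | ⟨h4, h5⟩⟩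
    · rcases h4 with h4 | h4
      · exact ⟨h1, h2, h4.2.2⟩
      · exact h4.elim
    · exact ⟨h1, h2, (key y x h2.1 h2.2 h3.symm h5 h4).symm⟩
    · exact ⟨h1, h2, key x y h1.1 h1.2 h3 h5 h4⟩
  refine ext_of_eq rfl ?_ ?_
  · ext x y
    exact ⟨fun h => ⟨h.1, h.2.1, h.2.2.1.2.2⟩, hb x y⟩
  · ext x y
    exact ⟨fun h => h.2 (hb x y (hu x y h.1)), fun h => h.elim⟩

/-- A contraction sequence from `T` to a single vertex in which every trigraph has at most one red
edge, which is pendant. -/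
inductive PendantRun : Trigraph V → List (Trigraph V) → Prop
  | single (T : Trigraph V) (v : V) (hv : T.verts = {v}) (hT : T.HasAtMostPendantRedEdge) :
      PendantRun T [T]
  | cons (T : Trigraph V) (u v : V) (l : List (Trigraph V)) (hu : u ∈ T.verts) (hv : v ∈ T.verts)
      (huv : u ≠ v) (hT : T.HasAtMostPendantRedEdge) (hl : PendantRun (T.contract u v) l) :
      PendantRun T (T :: l)

theorem HasAtMostPendantRedEdge.encard_le (h : T.HasAtMostPendantRedEdge) (x : V) :
    (T.red.neighborSet x).encard ≤ (1 : ℕ) := by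
  rw [Nat.cast_one, Set.encard_le_one_iff]
  intro y z hy hz
  have h1 := h.1 (show s(x, y) ∈ T.red.edgeSet from hy) (show s(x, z) ∈ T.red.edgeSet from hz)
  exact Sym2.congr_right.1 h1

theorem PendantRun.head? {l : List (Trigraph V)} (h : PendantRun T l) : l.head? = some T := by
  cases h <;> rfl

theorem PendantRun.forall_mem {l : List (Trigraph V)} (h : PendantRun T l) :
    ∀ T' ∈ l, T'.HasAtMostPendantRedEdge := by
  induction h with
  | single T v hv hT => simpa using hT
  | cons T u v l hu hv huv hT hl ih => simpa using ⟨hT, ih⟩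

theorem PendantRun.isDSequence {l : List (Trigraph V)} (h : PendantRun (ofGraph G) l) :
    IsDSequence G 1 l := by
  refine ⟨⟨h.head?, ?_, ?_⟩, fun T hT x => (h.forall_mem T hT).encard_le x⟩
  · generalize ofGraph G = T at h
    induction h with
    | single T v hv hT => exact List.isChain_singleton _
    | cons T u v l hu hv huv hT hl ih =>
      refine List.isChain_cons.2 ⟨fun T' hT' => ?_, ih⟩
      rw [hl.head?] at hT'
      obtain rfl : _ = T' := Option.some.inj hT'
      exact ⟨u, v, hu, hv, huv, rfl⟩
  · generalize ofGraph G = T at h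
    induction h with
    | single T v hv hT => exact ⟨T, rfl, v, hv⟩
    | cons T u v l hu hv huv hT hl ih =>
      obtain ⟨T', h1, h2⟩ := ih
      refine ⟨T', ?_, h2⟩
      cases hl <;> simpa [List.getLast?_cons] using h1

/-- The trigraph met while a graph is pruned: `a` is adjacent to nothing but `b`, and the edge `a b`
is the only one that may be red. -/
structure IsPruned (G : SimpleGraph V) (T : Trigraph V) (a b : V) (cs : List V) : Prop where
  nodup : (a :: b :: cs).Nodup
  mem_verts : ∀ x, x ∈ T.verts ↔ x ∈ a :: b :: cs
  black_iff : ∀ x ∈ b :: cs, ∀ y ∈ b :: cs, T.black.Adj x y ↔ G.Adj x y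
  red : ∀ x y, T.red.Adj x y → (x = a ∧ y = b) ∨ (x = b ∧ y = a)
  not_black : ∀ y ∈ cs, ¬ T.black.Adj a y

theorem hasAtMostPendantRedEdge_of_forall {a b : V}
    (h : ∀ x y, T.red.Adj x y → (x = a ∧ y = b) ∨ (x = b ∧ y = a))
    (ha : ∀ y, T.underlying.Adj a y → y = b) : T.HasAtMostPendantRedEdge := by
  constructor
  · have : ∀ e ∈ T.red.edgeSet, e = s(a, b) := by
      intro e
      induction e with
      | _ x y =>
        intro hxy
        rcases h x y hxy with ⟨rfl, rfl⟩ | ⟨rfl, rfl⟩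
        · rfl
        · exact Sym2.eq_swap
    exact fun e he e' he' => (this e he).trans (this e' he').symm
  · intro x y hxy
    have hab : T.red.Adj a b := by
      rcases h x y hxy with ⟨rfl, rfl⟩ | ⟨rfl, rfl⟩
      · exact hxy
      · exact hxy.symm
    have : T.underlying.neighborSet a = {b} := by
      ext z
      exact ⟨fun hz => ha z hz, by rintro rfl; exact Or.inr hab⟩
    rcases h x y hxy with ⟨rfl, rfl⟩ | ⟨rfl, rfl⟩
    · exact .inl this
    · exact .inr this

/-- Away from `a`, the black graph contains `G` and the underlying graph is contained in it, which
leaves no room for red. At `a`, only `b` remains as a possible neighbour. -/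
theorem IsPruned.of_underlying {a b : V} {cs : List V} (hn : (a :: b :: cs).Nodup)
    (hv : ∀ x, x ∈ T.verts ↔ x ∈ a :: b :: cs)
    (hb : ∀ x ∈ b :: cs, ∀ y ∈ b :: cs, G.Adj x y → T.black.Adj x y)
    (hu : ∀ x ∈ b :: cs, ∀ y ∈ b :: cs, T.underlying.Adj x y → G.Adj x y)
    (ha : ∀ y ∈ cs, ¬ T.underlying.Adj a y) : IsPruned G T a b cs := by
  refine ⟨hn, hv, fun x hx y hy => ⟨fun h => hu x hx y hy (.inl h), hb x hx y hy⟩, ?_,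
    fun y hy h => ha y hy (.inl h)⟩
  have key : ∀ y, T.red.Adj a y → y = b := by
    intro y hy
    have h1 := (hv y).1 (T.red_mem hy.symm)
    rcases List.mem_cons.1 h1 with rfl | h1
    · exact absurd hy (T.red.loopless.irrefl _)
    · rcases List.mem_cons.1 h1 with rfl | h1
      · rfl
      · exact absurd (.inr hy) (ha y h1)
  intro x y hxy
  rcases List.mem_cons.1 ((hv x).1 (T.red_mem hxy)) with rfl | hx
  · exact .inl ⟨rfl, key y hxy⟩
  · rcases List.mem_cons.1 ((hv y).1 (T.red_mem hxy.symm)) with rfl | hy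
    · exact .inr ⟨key x hxy.symm, rfl⟩
    · exact absurd hxy (T.not_black_and_red (hb x hx y hy (hu x hx y hy (.inr hxy))))

theorem underlying_mem {x y : V} (h : T.underlying.Adj x y) : x ∈ T.verts :=
  h.elim T.black_mem T.red_mem

theorem IsPruned.hasAtMostPendantRedEdge {a b : V} {cs : List V} (h : IsPruned G T a b cs) :
    T.HasAtMostPendantRedEdge := by
  refine hasAtMostPendantRedEdge_of_forall h.red fun y hy => ?_
  have h1 := (h.mem_verts y).1 (underlying_mem hy.symm)
  simp only [List.mem_cons] at h1
  rcases h1 with rfl | rfl | h1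
  · exact absurd hy (T.underlying.loopless.irrefl _)
  · rfl
  · rcases hy with hy | hy
    · exact absurd hy (h.not_black y h1)
    · rcases h.red _ _ hy with h2 | h2
      · exact h2.2
      · have := h.nodup
        simp [h2.1] at this

theorem IsPruned.mem_cases {a b : V} {cs : List V} (h : IsPruned G T a b cs) {x : V} :
    x ∈ T.verts ↔ x = a ∨ x = b ∨ x ∈ cs := by
  rw [h.mem_verts]
  simp

theorem IsPruned.adj_of_underlying {a b : V} {cs : List V} (h : IsPruned G T a b cs) {x y : V}
    (hx : x ∈ b :: cs) (hy : y ∈ b :: cs) (hxy : T.underlying.Adj x y) : G.Adj x y := by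
  have ha : a ∉ b :: cs := (List.nodup_cons.1 h.nodup).1
  rcases hxy with hxy | hxy
  · exact (h.black_iff x hx y hy).1 hxy
  · rcases h.red x y hxy with h1 | h1
    · exact absurd (h1.1 ▸ hx) ha
    · exact absurd (h1.2 ▸ hy) ha

theorem IsPruned.not_underlying {a b : V} {cs : List V} (h : IsPruned G T a b cs) {y : V}
    (hy : y ∈ cs) : ¬ T.underlying.Adj a y := by
  have hn := h.nodup
  simp only [List.nodup_cons, List.mem_cons, not_or] at hn
  rintro (hay | hay)
  · exact h.not_black y hy hay
  · rcases h.red a y hay with h1 | h1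
    · exact hn.2.1 (h1.2 ▸ hy)
    · exact hn.1.1 h1.1

/-- A twin contraction of `b` and `c` can be noticed only by `a`, so only the edge `a b` can turn
red. In the other steps, the vertex merged into `a` has no neighbour to come besides the next root,
so the result is again adjacent to at most the root. The edge `a b` need not be present. -/
theorem IsPruned.pendantRun {a b : V} {cs : List V} {s : List (V × V)}
    (h : IsPruned G T a b cs) (hs : G.Prunes a b cs s) : PendantRun T (T.trace s) := by
  induction hs generalizing T with
  | last b =>
    have hn := h.nodup
    simp only [List.nodup_cons, List.mem_cons, not_or, List.not_mem_nil, not_false_eq_true,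
      and_true] at hn
    have hv : (T.contract a b).verts = {a} := by
      ext x
      simp only [contract, Set.mem_sdiff, h.mem_cases, Set.mem_singleton_iff, List.not_mem_nil,
        or_false]
      constructor
      · rintro ⟨h1 | h1, h2⟩
        · exact h1
        · exact absurd h1 h2
      · rintro rfl
        exact ⟨.inl rfl, hn.1⟩
    refine .cons T a b _ (h.mem_cases.2 (.inl rfl)) (h.mem_cases.2 (.inr (.inl rfl))) hn.1
      h.hasAtMostPendantRedEdge (.single _ a hv ?_)
    have : ∀ x y, ¬ (T.contract a b).red.Adj x y := by
      intro x y hxy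
      have h1 : x ∈ (T.contract a b).verts := (T.contract a b).red_mem hxy
      have h2 : y ∈ (T.contract a b).verts := (T.contract a b).red_mem hxy.symm
      rw [hv] at h1 h2
      exact hxy.ne (h1.trans h2.symm)
    refine ⟨fun e => ?_, fun x y hxy => absurd hxy (this x y)⟩
    induction e with
    | _ x y => exact fun hxy => absurd hxy (this x y)
  | @twin b c cs s hc hs ih =>
    have hn := h.nodup
    simp only [List.nodup_cons, List.mem_cons, not_or] at hn
    refine .cons T b c _ (h.mem_cases.2 (by simp)) (h.mem_cases.2 (by simp)) hn.2.1.1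
      h.hasAtMostPendantRedEdge (ih ?_)
    have hsub : ∀ x ∈ b :: cs, x ∈ b :: c :: cs := fun x hx => by
      rcases List.mem_cons.1 hx with rfl | hx <;> simp [*]
    have hne : ∀ x ∈ b :: cs, x ≠ c := by
      rintro x hx rfl
      rcases List.mem_cons.1 hx with hx | hx
      · exact hn.2.1.1 hx.symm
      · exact hn.2.2.1 hx
    have hv : ∀ x ∈ b :: cs, x ∈ T.verts ∧ x ≠ c := fun x hx =>
      ⟨h.mem_cases.2 (.inr (List.mem_cons.1 (hsub x hx))), hne x hx⟩
    refine .of_underlying (by simp [hn]) (fun x => ?_) (fun x hx y hy hxy => ?_)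
      (fun x hx y hy hxy => ?_) (fun y hy hay => ?_)
    · have hc1 : c ∉ cs := hn.2.2.1
      simp only [contract, Set.mem_sdiff, h.mem_cases, Set.mem_singleton_iff, List.mem_cons]
      constructor
      · tauto
      · rintro (rfl | rfl | h1)
        · simp [hn]
        · simp [hn]
        · exact ⟨by simp [h1], by rintro rfl; exact hc1 h1⟩
    · have key : ∀ y ∈ b :: cs, G.Adj b y → T.black.Adj c y := by
        intro y hy hby
        rcases List.mem_cons.1 hy with rfl | hy'
        · exact absurd hby (G.loopless.irrefl _)
        · exact (h.black_iff c (by simp) y (hsub y hy)).2 ((hc y hy').1 hby)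
      exact ⟨hv x hx, hv y hy, (h.black_iff x (hsub x hx) y (hsub y hy)).2 hxy,
        fun e => key y hy (e ▸ hxy), fun e => key x hx (e ▸ hxy.symm)⟩
    · rw [underlying_contract] at hxy
      obtain ⟨-, -, h1, h2⟩ := hxy
      have key : ∀ y ∈ b :: cs, b ≠ y → T.underlying.Adj c y → G.Adj b y := by
        intro y hy hby hcy
        rcases List.mem_cons.1 hy with rfl | hy'
        · exact absurd rfl hby
        · exact (hc y hy').2 (h.adj_of_underlying (by simp) (hsub y hy) hcy)
      rcases h2 with h2 | ⟨rfl, h2⟩ | ⟨rfl, h2⟩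
      · exact h.adj_of_underlying (hsub x hx) (hsub y hy) h2
      · exact key y hy h1 h2
      · exact (key x hx h1.symm h2).symm
    · rw [underlying_contract] at hay
      obtain ⟨-, -, h1, h2 | h2 | h2⟩ := hay
      · exact h.not_underlying (by simp [hy]) h2
      · exact hn.1.1 h2.1
      · exact h.not_underlying (by simp) h2.2.symm
  | @pendant b c cs s hc hs ih =>
    have hn := h.nodup
    simp only [List.nodup_cons, List.mem_cons, not_or] at hn
    refine .cons T a c _ (h.mem_cases.2 (by simp)) (h.mem_cases.2 (by simp)) hn.1.2.1
      h.hasAtMostPendantRedEdge (ih ?_)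
    have hsub : ∀ x ∈ b :: cs, x ∈ b :: c :: cs := fun x hx => by
      rcases List.mem_cons.1 hx with rfl | hx <;> simp [*]
    have hne : ∀ x ∈ b :: cs, x ≠ c := by
      rintro x hx rfl
      rcases List.mem_cons.1 hx with hx | hx
      · exact hn.2.1.1 hx.symm
      · exact hn.2.2.1 hx
    have hv : ∀ x ∈ b :: cs, x ∈ T.verts ∧ x ≠ c := fun x hx =>
      ⟨h.mem_cases.2 (.inr (List.mem_cons.1 (hsub x hx))), hne x hx⟩
    refine .of_underlying (by simp [hn]) (fun x => ?_) (fun x hx y hy hxy => ?_)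
      (fun x hx y hy hxy => ?_) (fun y hy hay => ?_)
    · have hc1 : c ∉ cs := hn.2.2.1
      simp only [contract, Set.mem_sdiff, h.mem_cases, Set.mem_singleton_iff, List.mem_cons]
      constructor
      · tauto
      · rintro (rfl | rfl | h1)
        · simp [hn]
        · simp [hn]
        · exact ⟨by simp [h1], by rintro rfl; exact hc1 h1⟩
    · have hxa : ∀ x ∈ b :: cs, x ≠ a := by
        rintro x hx rfl
        rcases List.mem_cons.1 hx with hx | hx
        · exact hn.1.1 hx
        · exact hn.1.2.2 hx
      exact ⟨hv x hx, hv y hy, (h.black_iff x (hsub x hx) y (hsub y hy)).2 hxy,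
        fun e => absurd e (hxa x hx), fun e => absurd e (hxa y hy)⟩
    · rw [underlying_contract] at hxy
      have hxa : ∀ x ∈ b :: cs, x ≠ a := by
        rintro x hx rfl
        rcases List.mem_cons.1 hx with hx | hx
        · exact hn.1.1 hx
        · exact hn.1.2.2 hx
      obtain ⟨-, -, h1, h2 | h2 | h2⟩ := hxy
      · exact h.adj_of_underlying (hsub x hx) (hsub y hy) h2
      · exact absurd h2.1 (hxa x hx)
      · exact absurd h2.1 (hxa y hy)
    · rw [underlying_contract] at hay
      obtain ⟨-, -, h1, h2 | h2 | h2⟩ := hay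
      · exact h.not_underlying (by simp [hy]) h2
      · exact hc y hy (h.adj_of_underlying (by simp) (by simp [hy]) h2.2)
      · exact h1 h2.1.symm
  | @shift b c cs s hc hs ih =>
    have hn := h.nodup
    simp only [List.nodup_cons, List.mem_cons, not_or] at hn
    refine .cons T a b _ (h.mem_cases.2 (by simp)) (h.mem_cases.2 (by simp)) hn.1.1
      h.hasAtMostPendantRedEdge (ih ?_)
    have hsub : ∀ x ∈ c :: cs, x ∈ b :: c :: cs := fun x hx => by simp [hx]
    have hne : ∀ x ∈ c :: cs, x ≠ b := by
      rintro x hx rfl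
      exact not_or.2 hn.2.1 (List.mem_cons.1 hx)
    have hxa : ∀ x ∈ c :: cs, x ≠ a := by
      rintro x hx rfl
      exact not_or.2 hn.1.2 (List.mem_cons.1 hx)
    have hv : ∀ x ∈ c :: cs, x ∈ T.verts ∧ x ≠ b := fun x hx =>
      ⟨h.mem_cases.2 (.inr (.inr hx)), hne x hx⟩
    refine .of_underlying (by simp [hn]) (fun x => ?_) (fun x hx y hy hxy => ?_)
      (fun x hx y hy hxy => ?_) (fun y hy hay => ?_)
    · simp only [contract, Set.mem_sdiff, h.mem_cases, Set.mem_singleton_iff]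
      constructor
      · rintro ⟨h1 | h1 | h1, h2⟩
        · simp [h1]
        · exact absurd h1 h2
        · simp [h1]
      · intro h1
        rcases List.mem_cons.1 h1 with rfl | h1
        · exact ⟨.inl rfl, hn.1.1⟩
        · exact ⟨.inr (.inr h1), hne x h1⟩
    · exact ⟨hv x hx, hv y hy, (h.black_iff x (hsub x hx) y (hsub y hy)).2 hxy,
        fun e => absurd e (hxa x hx), fun e => absurd e (hxa y hy)⟩
    · rw [underlying_contract] at hxy
      obtain ⟨-, -, h1, h2 | h2 | h2⟩ := hxy
      · exact h.adj_of_underlying (hsub x hx) (hsub y hy) h2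
      · exact absurd h2.1 (hxa x hx)
      · exact absurd h2.1 (hxa y hy)
    · rw [underlying_contract] at hay
      obtain ⟨-, -, h1, h2 | h2 | h2⟩ := hay
      · exact h.not_underlying (by simp [hy]) h2
      · exact hc y hy (h.adj_of_underlying (by simp) (by simp [hy]) h2.2)
      · exact h1 h2.1.symm

theorem isPruned_restrict {S : Set V} {a b : V} {cs : List V} (hn : (a :: b :: cs).Nodup)
    (hS : ∀ x, x ∈ a :: b :: cs ↔ x ∈ S) (ha : ∀ y ∈ cs, ¬ G.Adj a y) :
    IsPruned G (restrict G S) a b cs := by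
  refine .of_underlying hn (fun x => (hS x).symm) (fun x hx y hy h => ?_)
    (fun x _ y _ h => ?_) (fun y hy h => ?_)
  · exact ⟨(hS x).1 (List.mem_cons_of_mem _ hx), (hS y).1 (List.mem_cons_of_mem _ hy), h⟩
  · exact h.elim (fun h => h.2.2) (fun h => h.elim)
  · exact h.elim (fun h => ha y hy h.2.2) (fun h => h.elim)

theorem restrict_hasAtMostPendantRedEdge (S : Set V) :
    (restrict G S).HasAtMostPendantRedEdge := by
  refine ⟨fun e => ?_, fun x y h => h.elim⟩
  induction e with
  | _ x y => exact fun h => h.elim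

/-- Initial twin steps are contractions without red edges. At the first other step, the vertex that
the thread would remove (`c` for `pendant`, the old root `b` for `shift`) is kept as the pendant
vertex `a`, and the rest is pruned. -/
theorem exists_pendantRun_of_thread {b : V} {cs : List V} (h : G.Thread b cs) (S : Set V)
    (hn : (b :: cs).Nodup) (hS : ∀ x, x ∈ b :: cs ↔ x ∈ S) :
    ∃ l, PendantRun (restrict G S) l := by
  induction h generalizing S with
  | nil b =>
    refine ⟨_, .single _ b ?_ (restrict_hasAtMostPendantRedEdge S)⟩
    ext x
    rw [Set.mem_singleton_iff, ← List.mem_singleton, hS]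
    rfl
  | @twin b c cs h hs ih =>
    simp only [List.nodup_cons, List.mem_cons, not_or] at hn
    have hb : b ∈ S := (hS b).1 (by simp)
    have hc : c ∈ S := (hS c).1 (by simp)
    obtain ⟨l, hl⟩ := ih (S \ {c}) (by simp [hn]) (fun x => by
      rw [Set.mem_sdiff, ← hS, Set.mem_singleton_iff, List.mem_cons, List.mem_cons, List.mem_cons]
      constructor
      · rintro (rfl | hx)
        · exact ⟨.inl rfl, hn.1.1⟩
        · exact ⟨.inr (.inr hx), by rintro rfl; exact hn.2.1 hx⟩
      · tauto)
    rw [← contract_restrict_of_twinsIn hc ⟨hn.1.1, fun y hy h1 h2 => h y (by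
      simpa [h1, h2] using (hS y).2 hy)⟩] at hl
    exact ⟨_, .cons _ b c l hb hc hn.1.1 (restrict_hasAtMostPendantRedEdge S) hl⟩
  | @pendant b c cs h hs ih =>
    obtain ⟨s, hs⟩ := hs.exists_prunes c
    refine ⟨_, (isPruned_restrict ((List.Perm.swap _ _ _).nodup_iff.1 hn) (fun x => ?_) h).pendantRun
      hs⟩
    rw [← hS, (List.Perm.swap _ _ _).mem_iff]
  | @shift b c cs h hs ih =>
    obtain ⟨s, hs⟩ := hs.exists_prunes b
    exact ⟨_, (isPruned_restrict hn hS h).pendantRun hs⟩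

theorem exists_pendantRun (hG : G.IsDistanceHereditary) (hA : G.IsATFree) (k : ℕ) :
    ∀ S : Set V, S.Finite → S.ncard = k → S.Nonempty → ∃ l, PendantRun (restrict G S) l := by
  induction k with
  | zero =>
    intro S hf hk hS
    rw [Set.ncard_eq_zero hf] at hk
    exact absurd hk hS.ne_empty
  | succ k ih =>
    intro S hf hk hS
    by_cases ht : ∃ u ∈ S, ∃ v ∈ S, G.TwinsIn S u v
    · obtain ⟨u, hu, v, hv, ht⟩ := ht
      obtain ⟨l, hl⟩ := ih (S \ {v}) hf.sdiff (by
        rw [Set.ncard_sdiff_singleton_of_mem hv]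
        omega) ⟨u, hu, ht.1⟩
      rw [← contract_restrict_of_twinsIn hv ht] at hl
      exact ⟨_, .cons _ u v l hu hv ht.1 (restrict_hasAtMostPendantRedEdge S) hl⟩
    · push Not at ht
      obtain ⟨b, cs, h⟩ := hG.exists_thread hA (k + 1) S hf hk hS ht
      exact exists_pendantRun_of_thread h.2.2 S h.1 h.2.1

end Trigraph

theorem SimpleGraph.IsATFree.twinWidth_le_one {V : Type*} [Finite V] [Nonempty V]
    {G : SimpleGraph V} (hA : G.IsATFree) (hG : G.IsDistanceHereditary) : G.twinWidth ≤ 1 := by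
  obtain ⟨l, hl⟩ := Trigraph.exists_pendantRun hG hA _ Set.univ Set.finite_univ rfl Set.univ_nonempty
  rw [Trigraph.restrict_univ] at hl
  exact sInf_le ⟨1, rfl, l, hl.isDSequence⟩

/-! ### Parents in trees; split-free distance-hereditary graphs -/

namespace SimpleGraph

theorem IsTree.eq_of_dist {V : Type*} {G : SimpleGraph V} (hG : G.IsTree) {r u u' v : V}
    (h : G.Adj u v) (h' : G.Adj u' v) (hd : G.dist r u + 1 = G.dist r v)
    (hd' : G.dist r u' + 1 = G.dist r v) : u = u' := by
  obtain ⟨p, hp⟩ := hG.connected.exists_walk_length_eq_dist r u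
  obtain ⟨p', hp'⟩ := hG.connected.exists_walk_length_eq_dist r u'
  have h1 : (p.concat h).IsPath := Walk.isPath_of_length_eq_dist _ (by simp [hp, hd])
  have h2 : (p'.concat h').IsPath := Walk.isPath_of_length_eq_dist _ (by simp [hp', hd'])
  have h3 : p.concat h = p'.concat h' :=
    congrArg Subtype.val ((hG.isAcyclic.subsingleton_path _ _).elim ⟨_, h1⟩ ⟨_, h2⟩)
  simpa using congrArg Walk.penultimate h3

/-- A connected distance-hereditary graph without a split is a clique or a star. -/
theorem IsDistanceHereditary.eq_top_or_star {W : Type*} [Finite W] {H : SimpleGraph W}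
    (hH : H.IsDistanceHereditary) (hc : H.Connected) (h3 : 3 ≤ Nat.card W)
    (hs : ∀ A, ¬ H.IsSplit A) : H = ⊤ ∨ ∃ z, H = starGraph z := by
  -- On four or more vertices, any two vertices leave a nontrivial complement. Twins are one side of
  -- a split; without twins the graph is prime, and a pendant vertex with its neighbour is one side
  -- of a split. A connected graph on three vertices is a triangle or a star.
  by_cases h4 : 4 ≤ Nat.card W
  · exfalso
    have hcompl : ∀ u v : W, u ≠ v → ({u, v} : Set W).Nontrivial ∧ ({u, v}ᶜ : Set W).Nontrivial := by
      intro u v huv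
      refine ⟨Set.nontrivial_pair huv, ?_⟩
      rw [← Set.one_lt_ncard_iff_nontrivial]
      have h1 := Set.ncard_add_ncard_compl ({u, v} : Set W)
      rw [Set.ncard_pair huv] at h1
      omega
    have ht : ∀ u v, ¬ H.AreTwins u v := by
      intro u v huv
      obtain ⟨h1, h2⟩ := hcompl u v huv.1
      refine hs {u, v} ⟨h1, h2, fun x hx x' hx' y _ y' hy' _ hxy' => ?_⟩
      rcases huv.isModule y' hy' with h | h
      · exact (h x hx).symm
      · exact absurd hxy'.symm (h x' hx')
    have hp := hH.isModularPrime hc ht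
    obtain ⟨w⟩ := hc.nonempty
    obtain ⟨x, q, -, -, hx⟩ := hH.exists_extremePendant hp h3 w
    have hxq : H.Adj x q := (hx.1 q).2 rfl
    obtain ⟨h1, h2⟩ := hcompl x q hxq.ne
    have key : ∀ a ∈ ({x, q} : Set W), ∀ y ∈ ({x, q}ᶜ : Set W), H.Adj a y → a = q := by
      rintro a (rfl | rfl) y hy hay
      · exact absurd (by simp [(hx.1 y).1 hay]) hy
      · rfl
    exact hs {x, q} ⟨h1, h2, fun a ha a' ha' y hy y' hy' hay hay' =>
      (key a ha y hy hay).trans (key a' ha' y' hy' hay').symm ▸ hay'⟩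
  · by_cases htop : H = ⊤
    · exact .inl htop
    right
    obtain ⟨u, v, huv, hnadj⟩ : ∃ u v, u ≠ v ∧ ¬ H.Adj u v := by
      by_contra hcon
      push Not at hcon
      refine htop ?_
      ext u v
      simpa using ⟨fun h => h.ne, hcon u v⟩
    have : ∃ w, w ≠ u ∧ w ≠ v := by
      by_contra hcon
      push Not at hcon
      have : (Set.univ : Set W) ⊆ {u, v} := fun w _ => by
        by_cases hw : w = u
        · exact .inl hw
        · exact .inr (hcon w hw)
      have h1 := Set.ncard_le_ncard this
      rw [Set.ncard_univ, Set.ncard_pair huv] at h1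
      omega
    obtain ⟨w, hwu, hwv⟩ := this
    have huniv : ∀ y, y = u ∨ y = v ∨ y = w := by
      have h1 : ({u, v, w} : Set W) = Set.univ := by
        refine Set.eq_of_subset_of_ncard_le (Set.subset_univ _) ?_
        have : ({u, v, w} : Set W).ncard = 3 :=
          Set.ncard_eq_three.2 ⟨u, v, w, huv, hwu.symm, hwv.symm, rfl⟩
        rw [this, Set.ncard_univ]
        omega
      intro y
      have : y ∈ ({u, v, w} : Set W) := h1 ▸ Set.mem_univ y
      simpa using this
    have hu : H.Adj u w := by
      obtain ⟨t, ht, -⟩ := (hc.preconnected v u).exists_adj_dist huv.symm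
      rcases huniv t with rfl | rfl | rfl
      · exact absurd ht (H.loopless.irrefl _)
      · exact absurd ht hnadj
      · exact ht
    have hv : H.Adj v w := by
      obtain ⟨t, ht, -⟩ := (hc.preconnected u v).exists_adj_dist huv
      rcases huniv t with rfl | rfl | rfl
      · exact absurd ht.symm hnadj
      · exact absurd ht (H.loopless.irrefl _)
      · exact ht
    have hnadj' : ¬ H.Adj v u := fun h => hnadj h.symm
    refine ⟨w, ?_⟩
    ext x y
    rw [starGraph_adj]
    rcases huniv x with rfl | rfl | rfl <;> rcases huniv y with rfl | rfl | rfl <;>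
      simp [hnadj, hnadj', hu, hv, hu.symm, hv.symm, hu.ne, hv.ne, hu.ne', hv.ne', huv]

end SimpleGraph

namespace GraphLabelledTree

open Sum SimpleGraph

variable {V : Type u} {D : GraphLabelledTree V}

/-! ### Branches of a graph-labelled tree -/

/-- The markers of the tree-edges from `n` to `w` and `w'` are adjacent in the label of `n`. -/
def Lab (D : GraphLabelledTree V) (n : D.Node) (w w' : V ⊕ D.Node) : Prop :=
  ∃ (h : w ∈ D.tree.neighborSet (inr n)) (h' : w' ∈ D.tree.neighborSet (inr n)),
    (D.label n).Adj ⟨w, h⟩ ⟨w', h'⟩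

theorem Lab.symm {n : D.Node} {w w' : V ⊕ D.Node} (h : D.Lab n w w') : D.Lab n w' w :=
  ⟨h.2.1, h.1, h.2.2.symm⟩

theorem Lab.ne {n : D.Node} {w w' : V ⊕ D.Node} (h : D.Lab n w w') : w ≠ w' := by
  rintro rfl
  exact (D.label n).loopless.irrefl _ h.2.2

theorem IsCliqueNode.lab_iff {n : D.Node} (h : D.IsCliqueNode n) {w w' : V ⊕ D.Node}
    (hw : D.tree.Adj (inr n) w) (hw' : D.tree.Adj (inr n) w') : D.Lab n w w' ↔ w ≠ w' := by
  refine ⟨fun h => h.ne, fun hne => ⟨hw, hw', ?_⟩⟩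
  rw [show D.label n = ⊤ from h, top_adj]
  exact fun e => hne (congrArg Subtype.val e)

theorem IsStarNode.lab_iff {n : D.Node} {z : V ⊕ D.Node} (h : D.IsStarNode n z) {w w' : V ⊕ D.Node}
    (hw : D.tree.Adj (inr n) w) (hw' : D.tree.Adj (inr n) w') :
    D.Lab n w w' ↔ w ≠ w' ∧ (w = z ∨ w' = z) := by
  obtain ⟨hz, h⟩ := h
  constructor
  · rintro ⟨h1, h2, h3⟩
    rw [h, starGraph_adj] at h3
    simpa using h3
  · rintro ⟨h1, h2⟩
    refine ⟨hw, hw', ?_⟩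
    rw [h, starGraph_adj]
    simpa [Subtype.ext_iff] using ⟨h1, h2⟩

theorem leaf_unique {v : V} {z z' : V ⊕ D.Node} (h : D.tree.Adj (inl v) z)
    (h' : D.tree.Adj (inl v) z') : z = z' := by
  obtain ⟨a, ha⟩ := Set.encard_eq_one.1 (D.leaf_degree v)
  have h1 : z ∈ ({a} : Set _) := ha ▸ h
  have h2 : z' ∈ ({a} : Set _) := ha ▸ h'
  exact Eq.trans h1 (Eq.symm h2)

/-- The leaf `x` lies behind the tree-edge from `n` to `w`. -/
inductive Branch (D : GraphLabelledTree V) : D.Node → V ⊕ D.Node → V → Prop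
  | leaf {n : D.Node} {v : V} (h : D.tree.Adj (inr n) (inl v)) : Branch D n (inl v) v
  | node {n m : D.Node} {w : V ⊕ D.Node} {x : V} (h : D.tree.Adj (inr n) (inr m))
      (hw : w ≠ inr n) (hs : Branch D m w x) : Branch D n (inr m) x

/-- The leaf `x` lies behind the tree-edge from `n` to `w` and is accessible from it. -/
inductive Reach (D : GraphLabelledTree V) : D.Node → V ⊕ D.Node → V → Prop
  | leaf {n : D.Node} {v : V} (h : D.tree.Adj (inr n) (inl v)) : Reach D n (inl v) v
  | node {n m : D.Node} {w : V ⊕ D.Node} {x : V} (h : D.tree.Adj (inr n) (inr m))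
      (hl : D.Lab m (inr n) w) (hs : Reach D m w x) : Reach D n (inr m) x

theorem Reach.branch {n : D.Node} {w : V ⊕ D.Node} {x : V} (h : D.Reach n w x) :
    D.Branch n w x := by
  induction h with
  | leaf h => exact .leaf h
  | node h hl _ ih => exact .node h hl.ne.symm ih

theorem Branch.adj {n : D.Node} {w : V ⊕ D.Node} {x : V} (h : D.Branch n w x) :
    D.tree.Adj (inr n) w := by
  cases h with
  | leaf h => exact h
  | node h _ _ => exact h

/-- All markers met on the listed part of a tree-path are adjacent. -/
def Passes (D : GraphLabelledTree V) (l : List (V ⊕ D.Node)) : Prop :=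
  ∀ (n : D.Node) (w w' : D.tree.neighborSet (inr n)),
    [(w : V ⊕ D.Node), inr n, (w' : V ⊕ D.Node)] <:+: l → (D.label n).Adj w w'

theorem passes_cons_cons {n : D.Node} {a b : V ⊕ D.Node} {l : List (V ⊕ D.Node)}
    (ha : D.tree.Adj (inr n) a) (hb : D.tree.Adj (inr n) b) :
    D.Passes (a :: inr n :: b :: l) ↔ D.Lab n a b ∧ D.Passes (inr n :: b :: l) := by
  constructor
  · intro h
    exact ⟨⟨ha, hb, h n ⟨a, ha⟩ ⟨b, hb⟩ ⟨[], l, by simp⟩⟩,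
      fun m w w' hw => h m w w' (hw.trans (List.infix_cons_iff.2 (.inr (List.infix_refl _))))⟩
  · rintro ⟨h1, h2⟩ m w w' hw
    rcases List.infix_cons_iff.1 hw with hw | hw
    · simp only [List.cons_prefix_cons, List.nil_prefix, and_true, inr.injEq] at hw
      obtain ⟨h3, rfl, h4⟩ := hw
      obtain ⟨_, _, h5⟩ := h1
      convert h5
    · exact h2 m w w' hw

theorem path_unique {a b : V ⊕ D.Node} {p q : D.tree.Walk a b} (hp : p.IsPath) (hq : q.IsPath) :
    p = q :=
  congrArg Subtype.val ((D.isTree.isAcyclic.subsingleton_path _ _).elim ⟨p, hp⟩ ⟨q, hq⟩)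

/-- In an acyclic graph a walk is a path as soon as it never turns back along the edge just used. -/
theorem cons_cons_isPath {a b c d : V ⊕ D.Node} (h : D.tree.Adj a b) (h' : D.tree.Adj b c)
    (q : D.tree.Walk c d) (hq : (Walk.cons h' q).IsPath) (hac : c ≠ a) :
    (Walk.cons h (Walk.cons h' q)).IsPath := by
  rw [D.isTree.isAcyclic.isPath_iff_isChain] at hq ⊢
  rw [Walk.edges_cons] at hq ⊢
  rw [Walk.edges_cons, List.isChain_cons_cons]
  refine ⟨?_, hq⟩
  intro e
  rw [Sym2.eq_swap, Sym2.congr_right] at e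
  exact hac e.symm

theorem Branch.eq {n : D.Node} {w w' : V ⊕ D.Node} {x : V} (h₁ : D.Branch n w x)
    (h₂ : D.Branch n w' x) : w = w' := by
  have key : ∀ {w}, D.Branch n w x → ∃ (hw : D.tree.Adj (inr n) w) (q : D.tree.Walk w (inl x)),
      (Walk.cons hw q).IsPath := by
    intro w h
    clear h₁ h₂
    induction h with
    | leaf h => exact ⟨h, .nil, by simp⟩
    | node h hw _ ih =>
      obtain ⟨hw', q, hq⟩ := ih
      exact ⟨h, _, cons_cons_isPath h hw' q hq hw⟩
  obtain ⟨hw, q, hq⟩ := key h₁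
  obtain ⟨hw', q', hq'⟩ := key h₂
  simpa using congrArg Walk.snd (path_unique hq hq')

theorem reach_node_iff {n m : D.Node} {w : V ⊕ D.Node} {x : V} (h : D.tree.Adj (inr n) (inr m))
    (hx : D.Branch m w x) : D.Reach n (inr m) x ↔ D.Lab m (inr n) w ∧ D.Reach m w x := by
  refine ⟨fun h' => ?_, fun h' => .node h h'.1 h'.2⟩
  cases h' with
  | node _ hl hs =>
    obtain rfl := hx.eq hs.branch
    exact ⟨hl, hs⟩

theorem reach_leaf_iff {n : D.Node} {v x : V} (h : D.tree.Adj (inr n) (inl v)) :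
    D.Reach n (inl v) x ↔ x = v := by
  constructor
  · intro h'
    cases h' with
    | leaf _ => rfl
  · rintro rfl
    exact .leaf h

/-- This connects the inductive predicates with tree paths. The path starts at `n` itself, so its
passing condition says nothing about the label of `n`, in accordance with `Reach`. -/
theorem Branch.exists_path {n : D.Node} {w : V ⊕ D.Node} {x : V} (h : D.Branch n w x) :
    ∃ (hw : D.tree.Adj (inr n) w) (q : D.tree.Walk w (inl x)),
      (Walk.cons hw q).IsPath ∧ (D.Reach n w x ↔ D.Passes (Walk.cons hw q).support) := by
  induction h with
  | leaf h =>
    refine ⟨h, .nil, by simp, fun _ m w w' hw => ?_, fun _ => .leaf h⟩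
    simpa using hw.length_le
  | @node n m w x h hw hs ih =>
    obtain ⟨hw', q, hq, hr⟩ := ih
    refine ⟨h, _, cons_cons_isPath h hw' q hq hw, ?_⟩
    rw [reach_node_iff h hs, hr, Walk.support_cons, Walk.support_cons, Walk.support_cons,
      ← q.cons_tail_support, passes_cons_cons h.symm hw']

theorem exists_branch (D : GraphLabelledTree V) (n : D.Node) (x : V) : ∃ w, D.Branch n w x := by
  have key : ∀ (u v : V ⊕ D.Node) (p : D.tree.Walk u v), p.IsPath → ∀ (n : D.Node) (x : V),
      u = inr n → v = inl x → D.Branch n p.snd x := by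
    intro u v p
    induction p with
    | nil =>
      rintro - n x rfl h
      simp at h
    | @cons u t v h q ih =>
      rintro hp n x rfl rfl
      rw [Walk.cons_isPath_iff] at hp
      rw [Walk.snd_cons]
      rcases t with y | m
      · cases q with
        | nil => exact .leaf h
        | cons h2 q2 =>
          obtain rfl := leaf_unique h.symm h2
          simp at hp
      · refine .node h ?_ (ih hp.1 m x rfl rfl)
        intro e
        exact hp.2 (e ▸ q.getVert_mem_support 1)
  obtain ⟨p, hp, -⟩ := D.isTree.existsUnique_path (inr n) (inl x)
  exact ⟨_, key _ _ p hp n x rfl rfl⟩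

theorem accessible_iff_of_leaf {n : D.Node} {x y : V} {w : V ⊕ D.Node}
    (hx : D.tree.Adj (inr n) (inl x)) (hy : D.Branch n w y) (hne : w ≠ inl x) :
    D.Accessible x y ↔ D.Lab n (inl x) w ∧ D.Reach n w y := by
  obtain ⟨hw, q, hq, hr⟩ := hy.exists_path
  have hp := cons_cons_isPath hx.symm hw q hq hne
  have : D.Accessible x y ↔ D.Passes (Walk.cons hx.symm (Walk.cons hw q)).support := by
    refine ⟨?_, fun h => ⟨_, hp, h⟩⟩
    rintro ⟨p, hp', h⟩
    rwa [path_unique hp hp']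
  rw [this, hr, Walk.support_cons, Walk.support_cons, ← q.cons_tail_support, passes_cons_cons hx hw]

/-- Leaves in different branches of a node are accessible from each other if and only if both are
accessible from the node, through adjacent markers. -/
theorem Branch.accessible_iff {n : D.Node} {x y : V} {w w' : V ⊕ D.Node} (hx : D.Branch n w x)
    (hy : D.Branch n w' y) (hne : w ≠ w') :
    D.Accessible x y ↔ D.Reach n w x ∧ D.Lab n w w' ∧ D.Reach n w' y := by
  induction hx generalizing w' with
  | leaf h =>
    rw [accessible_iff_of_leaf h hy hne.symm, reach_leaf_iff h]
    simp
  | @node n m w x h hw hs ih =>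
    -- The base node moves one step towards `x`; seen from `m`, the leaf `y` lies behind `n`. The
    -- label condition at `m` passes from the reach of `x` to the middle condition, and that at `n`
    -- to the reach of `y`.
    have hy' : D.Branch m (inr n) y := .node h.symm hne.symm hy
    rw [ih hy' hw, reach_node_iff h hs, reach_node_iff h.symm hy]
    constructor
    · rintro ⟨h1, h2, h3, h4⟩
      exact ⟨⟨h2.symm, h1⟩, h3, h4⟩
    · rintro ⟨⟨h1, h2⟩, h3, h4⟩
      exact ⟨h2, h1.symm, h3, h4⟩

theorem Branch.adj_iff {n : D.Node} {x y : V} {w w' : V ⊕ D.Node} (hx : D.Branch n w x)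
    (hy : D.Branch n w' y) (hne : w ≠ w') :
    D.accessibilityGraph.Adj x y ↔ D.Reach n w x ∧ D.Lab n w w' ∧ D.Reach n w' y := by
  rw [← hx.accessible_iff hy hne]
  refine ⟨fun h => h.2, fun h => ⟨?_, h⟩⟩
  rintro rfl
  exact hne (hx.eq hy)

/-- Walk away from `n`. At each node, connectedness of the label offers a marker adjacent to the one
of entry, and following it increases the distance from `n`. Distances are bounded, so a leaf is met;
`k` counts the steps still possible. -/
theorem exists_reach [Finite V] (hc : ∀ n, (D.label n).Connected) {n : D.Node} {w : V ⊕ D.Node}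
    (h : D.tree.Adj (inr n) w) : ∃ x, D.Reach n w x := by
  have := D.finite_node
  have := Fintype.ofFinite (V ⊕ D.Node)
  have hlt : ∀ z, D.tree.dist (inr n) z < Fintype.card (V ⊕ D.Node) := by
    intro z
    obtain ⟨p, hp, hd⟩ := D.isTree.connected.exists_path_of_dist (inr n) z
    rw [← hd]
    exact hp.length_lt
  have key : ∀ (k : ℕ) (m : D.Node) (w : V ⊕ D.Node), D.tree.Adj (inr m) w →
      D.tree.dist (inr n) (inr m) + 1 = D.tree.dist (inr n) w →
      Fintype.card (V ⊕ D.Node) ≤ D.tree.dist (inr n) w + k → ∃ x, D.Reach m w x := by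
    intro k
    induction k with
    | zero =>
      intro m w _ _ hk
      have := hlt w
      omega
    | succ k ih =>
      intro m w hmw hd hk
      rcases w with v | m'
      · exact ⟨v, .leaf hmw⟩
      · have : Nontrivial (D.tree.neighborSet (inr m')) :=
          Set.nontrivial_coe_sort.2 (Set.one_lt_encard_iff_nontrivial.1
            (lt_of_lt_of_le (by norm_num) (D.node_degree m')))
        obtain ⟨⟨w', hw'⟩, hl⟩ := (hc m').preconnected.exists_adj_of_nontrivial ⟨inr m, hmw.symm⟩
        have hl' : D.Lab m' (inr m) w' := ⟨_, _, hl⟩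
        have hd' : D.tree.dist (inr n) (inr m') + 1 = D.tree.dist (inr n) w' := by
          rcases D.isTree.dist_eq_dist_add_one_of_adj (inr n) (show D.tree.Adj (inr m') w' from hw')
            with h1 | h1
          · exact absurd (D.isTree.eq_of_dist hmw (SimpleGraph.Adj.symm hw') hd h1.symm) hl'.ne
          · exact h1.symm
        obtain ⟨x, hx⟩ := ih m' w' hw' hd' (by omega)
        exact ⟨x, .node hmw hl' hx⟩
  exact key _ n w h (by rw [dist_self, dist_eq_one_iff_adj.2 h]) le_add_self

/-! ### Labels of a canonical split decomposition -/

namespace IsCanonicalSplitDecomposition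

variable {G : SimpleGraph V}

theorem card_ge (h : D.IsCanonicalSplitDecomposition G) [Finite V] (n : D.Node) :
    3 ≤ Nat.card (D.tree.neighborSet (inr n)) := by
  have := D.finite_node
  have h1 := h.three_le_degree n
  rw [← Set.Finite.cast_ncard_eq (Set.toFinite _)] at h1
  exact_mod_cast h1

theorem label_connected (h : D.IsCanonicalSplitDecomposition G) [Finite V] (n : D.Node) :
    (D.label n).Connected := by
  have h3 := h.card_ge n
  have hne : Nonempty (D.tree.neighborSet (inr n)) := (Nat.card_pos_iff.1 (by omega)).1
  rcases h.label_cases n with h1 | ⟨z, hz, h1⟩ | h1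
  · rw [show D.label n = ⊤ from h1]
    exact connected_top
  · rw [h1]
    exact (isTree_starGraph _).connected
  · exact h1.1

theorem exists_reach (h : D.IsCanonicalSplitDecomposition G) [Finite V] {n : D.Node}
    {w : V ⊕ D.Node} (hw : D.tree.Adj (inr n) w) : ∃ x, D.Reach n w x :=
  GraphLabelledTree.exists_reach h.label_connected hw

theorem adj_iff (h : D.IsCanonicalSplitDecomposition G) {n : D.Node} {x y : V} {w w' : V ⊕ D.Node}
    (hx : D.Branch n w x) (hy : D.Branch n w' y) (hne : w ≠ w') :
    G.Adj x y ↔ D.Reach n w x ∧ D.Lab n w w' ∧ D.Reach n w' y := by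
  rw [← h.accessibilityGraph_eq]
  exact hx.adj_iff hy hne

/-- The labels of the canonical split decomposition of a distance-hereditary graph are cliques and
stars. -/
theorem clique_or_star (h : D.IsCanonicalSplitDecomposition G) [Finite V]
    (hG : G.IsDistanceHereditary) (n : D.Node) :
    D.IsCliqueNode n ∨ ∃ z, D.IsStarNode n z := by
  rcases h.label_cases n with h1 | h1 | h1
  · exact .inl h1
  · exact .inr h1
  have := D.finite_node
  -- One accessible leaf behind each marker embeds the label into `G` as an induced subgraph. The
  -- label is therefore distance-hereditary, and without a split it must be a clique or a star.
  choose f hf using fun w : D.tree.neighborSet (inr n) => h.exists_reach w.2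
  have hne : ∀ w w' : D.tree.neighborSet (inr n), w ≠ w' → (w : V ⊕ D.Node) ≠ w' :=
    fun _ _ hww e => hww (Subtype.ext e)
  let e : D.label n ↪g G :=
    { toFun := f
      inj' := fun w w' hw => by
        by_contra hcon
        exact hne _ _ hcon ((hf w).branch.eq (by
          have := (hf w').branch
          rwa [← hw] at this))
      map_rel_iff' := by
        intro w w'
        change G.Adj (f w) (f w') ↔ _
        by_cases hww : w = w'
        · subst hww
          exact iff_of_false (G.loopless.irrefl _) ((D.label n).loopless.irrefl _)
        · rw [h.adj_iff (hf w).branch (hf w').branch (hne _ _ hww)]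
          exact ⟨fun h => h.2.1.2.2, fun h => ⟨hf w, ⟨w.2, w'.2, h⟩, hf w'⟩⟩ }
  rcases (hG.of_embedding e).eq_top_or_star h1.1 (h.card_ge n) h1.2 with h2 | ⟨z, h2⟩
  · exact .inl h2
  · exact .inr ⟨z, z.2, h2⟩

end IsCanonicalSplitDecomposition

end GraphLabelledTree

/-! ### Extreme pendant vertices, geodesics in trees and ranked chains -/

namespace SimpleGraph

variable {V : Type*} {G : SimpleGraph V}

/-- A walk that enters `b` comes from a neighbour of `b` or from `a`, and leaves to another
neighbour. The hypothesis `hb` replaces such a detour by a connection that avoids `a` and `b`; the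
second half of `key` remembers the neighbour from which `b` was entered. -/
theorem isExtremePendant_of_adj (hc : G.Connected) {a b : V} (ha : ∀ y, G.Adj a y ↔ y = b)
    (hb : ∀ u v, G.Adj b u → G.Adj b v → u ≠ a → v ≠ a → G.ConnIn {a, b}ᶜ u v) :
    G.IsExtremePendant a b := by
  refine ⟨ha, fun x y hxa hxb hya hyb => ?_⟩
  have hmem : ∀ v, v ≠ a → v ≠ b → v ∈ ({a, b}ᶜ : Set V) := fun v h1 h2 => by simp [h1, h2]
  obtain ⟨-, h⟩ := (hc.preconnected x y).connIn_univ
  have key : (y ≠ a → y ≠ b → G.ConnIn {a, b}ᶜ x y) ∧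
      (y = b ∨ y = a → ∃ u, G.Adj b u ∧ u ≠ a ∧ G.ConnIn {a, b}ᶜ x u) := by
    clear hya hyb
    induction h with
    | refl => exact ⟨fun _ _ => .refl (hmem x hxa hxb), fun h => by tauto⟩
    | @tail z y _ hzy ih =>
      have hzy := hzy.1
      refine ⟨fun h1 h2 => ?_, ?_⟩
      · by_cases hza : z = a
        · subst hza
          exact absurd ((ha y).1 hzy) h2
        · by_cases hzb : z = b
          · subst hzb
            obtain ⟨u, hu, hua, hxu⟩ := ih.2 (.inl rfl)
            exact hxu.trans (hb u y hu hzy hua h1)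
          · exact (ih.1 hza hzb).tail hzy (hmem y h1 h2)
      · rintro (rfl | rfl)
        · by_cases hza : z = a
          · exact ih.2 (.inr hza)
          · exact ⟨z, hzy.symm, hza, ih.1 hza hzy.ne⟩
        · exact ih.2 (.inl ((ha z).1 hzy.symm))
  exact key.1 hya hyb

/-- Any two of the three vertices survive the deletion of the third and its neighbour, and are
joined in what is left. As the third has no other neighbour, the joining path misses it. -/
theorem IsATFree.not_three_extremePendant (hA : G.IsATFree) {a b a' b' a'' b'' : V}
    (h : G.IsExtremePendant a b) (h' : G.IsExtremePendant a' b')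
    (h'' : G.IsExtremePendant a'' b'')
    (h1 : a ≠ a' ∧ a ≠ b') (h2 : a ≠ a'' ∧ a ≠ b'') (h3 : a' ≠ a'' ∧ a' ≠ b'')
    (h4 : a' ≠ b) (h5 : a'' ≠ b) (h6 : a'' ≠ b') : False := by
  have key : ∀ {x q u v : V}, G.IsExtremePendant x q → u ≠ x → u ≠ q → v ≠ x → v ≠ q →
      G.JoinedMissing u v x := by
    intro x q u v h h1 h2 h3 h4
    obtain ⟨p, hp, hp'⟩ := (h.2 u v h1 h2 h3 h4).exists_isPath
    refine ⟨p, hp, fun w hw => ?_⟩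
    have := hp' w hw
    simp only [Set.mem_compl_iff, Set.mem_insert_iff, Set.mem_singleton_iff, not_or] at this
    exact ⟨this.1, fun e => this.2 ((h.1 w).1 e.symm)⟩
  exact hA a a' a'' ⟨key h'' h2.1 h2.2 h3.1 h3.2, key h h1.1.symm h4 h2.1.symm h5,
    key h' h1.1 h1.2 h3.1.symm h6⟩

theorem IsTree.eq_of_dist_add_dist {T : SimpleGraph V} (hT : T.IsTree) {r : V} (k : ℕ) :
    ∀ {m m' y : V}, T.dist m y = k → T.dist r y = T.dist r m + T.dist m y →
      T.dist r y = T.dist r m' + T.dist m' y → T.dist r m = T.dist r m' → m = m' := by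
  have hc := hT.connected
  induction k with
  | zero =>
    intro m m' y h1 h2 h3 h4
    obtain rfl := hc.dist_eq_zero_iff.1 h1
    exact (hc.dist_eq_zero_iff.1 (by omega)).symm
  | succ k ih =>
    intro m m' y h1 h2 h3 h4
    have key : ∀ m, T.dist m y = k + 1 → T.dist r y = T.dist r m + T.dist m y →
        ∃ z, T.Adj z y ∧ T.dist r z + 1 = T.dist r y ∧ T.dist m z = k ∧
          T.dist r z = T.dist r m + T.dist m z := by
      intro m h1 h2
      obtain ⟨z, hz, hzd⟩ := (hc.preconnected m y).exists_adj_dist (by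
        rintro rfl
        simp at h1)
      have h5 := hc.dist_triangle (u := r) (v := m) (w := z)
      have h6 := hc.dist_le_succ r hz.symm
      exact ⟨z, hz.symm, by omega, by omega, by omega⟩
    obtain ⟨z, hz, hz1, hz2, hz3⟩ := key m h1 h2
    obtain ⟨z', hz', hz1', hz2', hz3'⟩ := key m' (by omega) h3
    obtain rfl := hT.eq_of_dist hz hz' hz1 hz1'
    exact ih hz2 hz3 hz3' h4

end SimpleGraph

theorem List.sublist_pair_of_lt {α : Type*} {f : α → ℕ} {l : List α}
    (hl : l.Pairwise fun x y => f x < f y) {m n : α} (hm : m ∈ l) (hn : n ∈ l) (h : f m < f n) :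
    [m, n].Sublist l := by
  induction l with
  | nil => simp at hm
  | cons x l ih =>
    rw [List.pairwise_cons] at hl
    rcases List.mem_cons.1 hm with rfl | hm'
    · rcases List.mem_cons.1 hn with rfl | hn
      · exact absurd h (lt_irrefl _)
      · exact (List.singleton_sublist.2 hn).cons_cons m
    · rcases List.mem_cons.1 hn with rfl | hn
      · exact absurd (hl.1 m hm') (not_lt.2 h.le)
      · exact (ih hl.2 hm' hn).cons x

/-- Start from an element of maximal rank and follow predecessors down to rank zero. By injectivity
this meets every element; the list is then reversed. -/
theorem List.exists_chain_of_rank {α : Type*} [Finite α] (R : α → α → Prop) (f : α → ℕ)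
    (hf : Function.Injective f) (r : α) (hr : f r = 0)
    (hpred : ∀ x k, f x = k + 1 → ∃ y, R y x ∧ f y = k) :
    ∃ l : List α, l.Nodup ∧ (∀ x, x ∈ l) ∧ l.IsChain R ∧ l.head? = some r ∧
      l.Pairwise fun x y => f x < f y := by
  have key : ∀ k x, f x = k → ∃ l : List α, (∀ y, y ∈ x :: l ↔ f y ≤ k) ∧
      (x :: l).IsChain (fun x y => R y x) ∧ (x :: l).getLast? = some r ∧
      (x :: l).Pairwise fun x y => f y < f x := by
    intro k
    induction k with
    | zero =>
      intro x hx
      obtain rfl := hf (hx.trans hr.symm)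
      refine ⟨[], fun y => ?_, List.isChain_singleton _, rfl, List.pairwise_singleton _ _⟩
      rw [List.mem_singleton]
      exact ⟨fun h => (h ▸ hx).le, fun h => hf (by omega)⟩
    | succ k ih =>
      intro x hx
      obtain ⟨y, hy, hyk⟩ := hpred x k hx
      obtain ⟨l, h1, h2, h3, h4⟩ := ih y hyk
      refine ⟨y :: l, fun z => ?_, ?_, ?_, ?_⟩
      · rw [List.mem_cons, h1]
        constructor
        · rintro (rfl | h) <;> omega
        · intro h
          by_cases hz : f z = k + 1
          · exact .inl (hf (hz.trans hx.symm))
          · exact .inr (by omega)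
      · exact List.isChain_cons_cons.2 ⟨hy, h2⟩
      · rw [List.getLast?_cons_cons]
        exact h3
      · refine List.pairwise_cons.2 ⟨fun z hz => ?_, h4⟩
        have := (h1 z).1 hz
        omega
  obtain ⟨x, -, hx⟩ := Set.exists_max_image Set.univ f Set.finite_univ ⟨r, trivial⟩
  obtain ⟨l, h1, h2, h3, h4⟩ := key _ x rfl
  refine ⟨(x :: l).reverse, ?_, fun y => ?_, ?_, ?_, ?_⟩
  · rw [List.nodup_reverse]
    exact h4.imp fun h e => by simp [e] at h
  · rw [List.mem_reverse, h1]
    exact hx y trivial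
  · rw [List.isChain_reverse]
    exact h2
  · rw [List.head?_reverse]
    exact h3
  · rw [List.pairwise_reverse]
    exact h4

/-! ### End nodes and the existence of a reading -/

namespace GraphLabelledTree

open Sum SimpleGraph

variable {V : Type u} {D : GraphLabelledTree V} {G : SimpleGraph V}

/-- A node with at most one neighbouring node. -/
def IsEndNode (D : GraphLabelledTree V) (n : D.Node) : Prop :=
  ∀ m m' : D.Node, D.tree.Adj (inr n) (inr m) → D.tree.Adj (inr n) (inr m') → m = m'

theorem exists_node_of_leaf (D : GraphLabelledTree V) (h3 : 3 ≤ Nat.card V) (v : V) :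
    ∃ n : D.Node, D.tree.Adj (inl v) (inr n) := by
  obtain ⟨z, hz⟩ := Set.encard_eq_one.1 (D.leaf_degree v)
  have hvz : D.tree.Adj (inl v) z := by
    have : z ∈ D.tree.neighborSet (inl v) := hz ▸ rfl
    exact this
  rcases z with w | n
  · exfalso
    obtain ⟨x, hx⟩ : ∃ x, x ∉ ({v, w} : Set V) := by
      by_contra hcon
      push Not at hcon
      have h1 := ncard_pair_le v w
      rw [Set.eq_univ_of_forall hcon, Set.ncard_univ] at h1
      omega
    obtain ⟨p⟩ := D.isTree.connected.preconnected (inl v) (inl x)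
    obtain ⟨d, -, h4, h5⟩ := p.exists_boundary_dart ({inl v, inl w} : Set (V ⊕ D.Node)) (by simp)
      (by simpa using hx)
    rcases h4 with h4 | h4
    · have := d.adj
      rw [h4] at this
      exact h5 (.inr (leaf_unique this hvz))
    · have := d.adj
      rw [show d.fst = inl w from h4] at this
      exact h5 (.inl (leaf_unique this hvz.symm))
  · exact ⟨n, hvz⟩

theorem Branch.eq_of_leaf {n : D.Node} {v x : V} (h : D.Branch n (inl v) x) : x = v := by
  cases h
  rfl

theorem exists_adj_of_three_le {n : D.Node}
    (h : 3 ≤ (D.tree.neighborSet (inr n)).encard) (z z' : V ⊕ D.Node) :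
    ∃ w, D.tree.Adj (inr n) w ∧ w ≠ z ∧ w ≠ z' := by
  by_contra hcon
  push Not at hcon
  have h1 : D.tree.neighborSet (inr n) ⊆ {z, z'} := fun w hw => by
    by_cases hwz : w = z
    · exact .inl hwz
    · exact .inr (hcon w hw hwz)
  have h2 := h.trans ((Set.encard_le_encard h1).trans (Set.encard_insert_le {z'} z))
  rw [Set.encard_singleton] at h2
  norm_num at h2

namespace IsCanonicalSplitDecomposition

/-- Adjacency to any other leaf depends only on the marker behind which that leaf lies. Leaves of
`n` whose markers are not distinguished would be twins of `G`. -/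
theorem not_twin_leaves (h : D.IsCanonicalSplitDecomposition G) [Finite V]
    (hp : G.IsModularPrime) (h3 : 3 ≤ Nat.card V) {n : D.Node} {x y : V} (hxy : x ≠ y)
    (hx : D.tree.Adj (inr n) (inl x)) (hy : D.tree.Adj (inr n) (inl y))
    (hl : ∀ w, D.tree.Adj (inr n) w → w ≠ inl x → w ≠ inl y →
      (D.Lab n (inl x) w ↔ D.Lab n (inl y) w)) : False := by
  refine hp.not_areTwins h3 x y ⟨hxy, fun z hzx hzy => ?_⟩
  obtain ⟨w, hw⟩ := D.exists_branch n z
  have h1 : w ≠ inl x := by rintro rfl; exact hzx hw.eq_of_leaf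
  have h2 : w ≠ inl y := by rintro rfl; exact hzy hw.eq_of_leaf
  rw [h.adj_iff (.leaf hx) hw h1.symm, h.adj_iff (.leaf hy) hw h2.symm, hl w hw.adj h1 h2,
    reach_leaf_iff hx, reach_leaf_iff hy]
  simp

theorem exists_adj_of_ne (h : D.IsCanonicalSplitDecomposition G) [Finite V] (n : D.Node)
    (z z' : V ⊕ D.Node) : ∃ w, D.tree.Adj (inr n) w ∧ w ≠ z ∧ w ≠ z' :=
  exists_adj_of_three_le (h.three_le_degree n) z z'

/-- Having degree at least three and at most one neighbouring node, `n` has two leaves. In a clique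
they would be twins, and so would two leaves of a star neither of which is the centre. Hence there
are exactly two leaves, one of them the centre. -/
theorem exists_leaves_of_isEndNode (h : D.IsCanonicalSplitDecomposition G) [Finite V]
    (hG : G.IsDistanceHereditary) (hp : G.IsModularPrime) (h3 : 3 ≤ Nat.card V) {n : D.Node}
    (hn : D.IsEndNode n) : ∃ a b, a ≠ b ∧ D.IsStarNode n (inl b) ∧
      ∀ v, D.tree.Adj (inl v) (inr n) ↔ v = a ∨ v = b := by
  obtain ⟨x, y, hxy, hx, hy⟩ : ∃ x y : V, x ≠ y ∧ D.tree.Adj (inr n) (inl x) ∧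
      D.tree.Adj (inr n) (inl y) := by
    have hleaf : ∀ z z' : V ⊕ D.Node, (∀ m, D.tree.Adj (inr n) (inr m) → inr m = z ∨ inr m = z') →
        ∃ x : V, D.tree.Adj (inr n) (inl x) ∧ inl x ≠ z ∧ inl x ≠ z' := by
      intro z z' hz
      obtain ⟨w, hw, h1, h2⟩ := h.exists_adj_of_ne n z z'
      rcases w with x | m
      · exact ⟨x, hw, h1, h2⟩
      · exact ((hz m hw).elim h1 h2).elim
    by_cases hm : ∃ m, D.tree.Adj (inr n) (inr m)
    · obtain ⟨m, hm⟩ := hm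
      obtain ⟨x, hx, -⟩ := hleaf (inr m) (inr m) fun m' hm' => .inl (congrArg inr (hn m' m hm' hm))
      obtain ⟨y, hy, -, hyx⟩ := hleaf (inr m) (inl x)
        fun m' hm' => .inl (congrArg inr (hn m' m hm' hm))
      exact ⟨x, y, fun e => hyx (congrArg inl e.symm), hx, hy⟩
    · push Not at hm
      obtain ⟨w, hw, -⟩ := h.exists_adj_of_ne n (inr n) (inr n)
      rcases w with x | m
      · obtain ⟨y, hy, -, hyx⟩ := hleaf (inl x) (inl x) fun m hm' => (hm m hm').elim
        exact ⟨x, y, fun e => hyx (congrArg inl e.symm), hw, hy⟩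
      · exact (hm m hw).elim
  rcases h.clique_or_star hG n with hc | ⟨z, hz⟩
  · refine (h.not_twin_leaves hp h3 hxy hx hy fun w hw h1 h2 => ?_).elim
    rw [hc.lab_iff hx hw, hc.lab_iff hy hw]
    exact iff_of_true h1.symm h2.symm
  · have key : ∀ u v : V, u ≠ v → D.tree.Adj (inr n) (inl u) → D.tree.Adj (inr n) (inl v) →
        inl u = z ∨ inl v = z := by
      intro u v huv hu hv
      by_contra hcon
      push Not at hcon
      refine h.not_twin_leaves hp h3 huv hu hv fun w hw h1 h2 => ?_
      rw [hz.lab_iff hu hw, hz.lab_iff hv hw]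
      simp [hcon, h1.symm, h2.symm]
    obtain ⟨a, b, hab, ha, hb, hbz⟩ : ∃ a b, a ≠ b ∧ D.tree.Adj (inr n) (inl a) ∧
        D.tree.Adj (inr n) (inl b) ∧ inl b = z := by
      rcases key x y hxy hx hy with hz | hz
      · exact ⟨y, x, hxy.symm, hy, hx, hz⟩
      · exact ⟨x, y, hxy, hx, hy, hz⟩
    subst hbz
    refine ⟨a, b, hab, hz, fun v => ⟨fun hv => ?_, ?_⟩⟩
    · by_contra hcon
      push Not at hcon
      rcases key a v hcon.1.symm ha hv.symm with h1 | h1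
      · exact hab (inl_injective h1)
      · exact hcon.2 (inl_injective h1)
    · rintro (rfl | rfl)
      · exact ha.symm
      · exact hb.symm

/-- The other neighbours of `b` are the leaves accessible through the only neighbouring node `m`.
Canonicity forbids that `m` is a star centred at `n`. So if two of these leaves come through
different markers of `m`, then `m` is a clique and they are adjacent; if through the same one, a
leaf accessible through a third marker is adjacent to both. -/
theorem isExtremePendant (h : D.IsCanonicalSplitDecomposition G) [Finite V]
    (hG : G.IsDistanceHereditary) (hc : G.Connected) {n : D.Node} (hn : D.IsEndNode n) {a b : V}
    (hab : a ≠ b) (hb : D.IsStarNode n (inl b))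
    (hl : ∀ v, D.tree.Adj (inl v) (inr n) ↔ v = a ∨ v = b) : G.IsExtremePendant a b := by
  have ha' : D.tree.Adj (inr n) (inl a) := ((hl a).2 (.inl rfl)).symm
  have hb' : D.tree.Adj (inr n) (inl b) := ((hl b).2 (.inr rfl)).symm
  have hGab : G.Adj a b := by
    rw [h.adj_iff (.leaf ha') (.leaf hb') fun e => hab (inl_injective e), hb.lab_iff ha' hb']
    exact ⟨.leaf ha', ⟨fun e => hab (inl_injective e), .inr rfl⟩, .leaf hb'⟩
  refine isExtremePendant_of_adj hc (fun y => ⟨fun hay => ?_, fun e => e ▸ hGab⟩) ?_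
  · obtain ⟨w, hw⟩ := D.exists_branch n y
    have h1 : w ≠ inl a := by rintro rfl; exact hay.ne hw.eq_of_leaf.symm
    rw [h.adj_iff (.leaf ha') hw h1.symm, hb.lab_iff ha' hw.adj] at hay
    rcases hay.2.1.2 with h2 | h2
    · exact absurd (inl_injective h2) hab
    · subst h2
      exact hw.eq_of_leaf
  · have key : ∀ u, G.Adj b u → u ≠ a → ∃ m, D.tree.Adj (inr n) (inr m) ∧ D.Reach n (inr m) u := by
      intro u hbu hua
      obtain ⟨w, hw⟩ := D.exists_branch n u
      have h1 : w ≠ inl b := by rintro rfl; exact hbu.ne hw.eq_of_leaf.symm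
      rw [h.adj_iff (.leaf hb') hw h1.symm] at hbu
      rcases w with v | m
      · rcases (hl v).1 hw.adj.symm with rfl | rfl
        · exact absurd hw.eq_of_leaf hua
        · exact absurd rfl h1
      · exact ⟨m, hw.adj, hbu.2.2⟩
    intro u v hbu hbv hua hva
    obtain ⟨m, hm, hu⟩ := key u hbu hua
    obtain ⟨m', hm', hv⟩ := key v hbv hva
    obtain rfl := hn m m' hm hm'
    have hmem : ∀ {w x}, w ≠ inr n → D.Branch m w x → x ∈ ({a, b}ᶜ : Set V) := by
      rintro w x hw hx
      simp only [Set.mem_compl_iff, Set.mem_insert_iff, Set.mem_singleton_iff, not_or]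
      constructor <;> rintro rfl
      · exact hw (hx.eq (.node hm.symm (by simp) (.leaf ha')))
      · exact hw (hx.eq (.node hm.symm (by simp) (.leaf hb')))
    cases hu with
    | @node _ _ w _ _ hw hu =>
    cases hv with
    | @node _ _ w' _ _ hw' hv =>
    have hum := hmem hw.ne.symm hu.branch
    have hvm := hmem hw'.ne.symm hv.branch
    have hstar : ¬ D.IsStarNode m (inr n) := fun hs => by
      have := h.star_star m n hm.symm (inl b) hs hb
      simp at this
    by_cases hww : w = w'
    · subst hww
      obtain ⟨t, ht, htn, htw⟩ := h.exists_adj_of_ne m (inr n) w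
      obtain ⟨z, hz⟩ := h.exists_reach ht
      have hlab : D.Lab m w t := by
        rcases h.clique_or_star hG m with hm' | ⟨c, hc⟩
        · exact (hm'.lab_iff hu.branch.adj ht).2 htw.symm
        · refine (hc.lab_iff hu.branch.adj ht).2 ⟨htw.symm, .inl ?_⟩
          rcases ((hc.lab_iff hm.symm hu.branch.adj).1 hw).2 with h1 | h1
          · exact absurd (h1 ▸ hc) hstar
          · exact h1
      have h1 : G.Adj u z := (h.adj_iff hu.branch hz.branch htw.symm).2 ⟨hu, hlab, hz⟩
      have h2 : G.Adj v z := (h.adj_iff hv.branch hz.branch htw.symm).2 ⟨hv, hlab, hz⟩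
      exact ((ConnIn.refl hum).tail h1 (hmem htn hz.branch)).tail h2.symm hvm
    · refine (ConnIn.refl hum).tail ((h.adj_iff hu.branch hv.branch hww).2 ⟨hu, ?_, hv⟩) hvm
      rcases h.clique_or_star hG m with hm' | ⟨c, hc⟩
      · exact (hm'.lab_iff hu.branch.adj hv.branch.adj).2 hww
      · have h1 := ((hc.lab_iff hm.symm hu.branch.adj).1 hw).2
        have h2 := ((hc.lab_iff hm.symm hv.branch.adj).1 hw').2
        have h4 : inr n ≠ c := fun e => hstar (e ▸ hc)
        exact absurd ((h1.resolve_left h4).trans (h2.resolve_left h4).symm) hww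

theorem not_three_isEndNode (h : D.IsCanonicalSplitDecomposition G) [Finite V]
    (hG : G.IsDistanceHereditary) (hA : G.IsATFree) (hp : G.IsModularPrime) (h3 : 3 ≤ Nat.card V)
    {n n' n'' : D.Node} (hn : D.IsEndNode n) (hn' : D.IsEndNode n') (hn'' : D.IsEndNode n'')
    (h1 : n ≠ n') (h2 : n ≠ n'') (h4 : n' ≠ n'') : False := by
  have hc := hp.connected h3
  obtain ⟨a, b, hab, hb, hl⟩ := h.exists_leaves_of_isEndNode hG hp h3 hn
  obtain ⟨a', b', hab', hb', hl'⟩ := h.exists_leaves_of_isEndNode hG hp h3 hn'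
  obtain ⟨a'', b'', hab'', hb'', hl''⟩ := h.exists_leaves_of_isEndNode hG hp h3 hn''
  have key : ∀ {n n' : D.Node} {v w : V}, n ≠ n' → D.tree.Adj (inl v) (inr n) →
      D.tree.Adj (inl w) (inr n') → v ≠ w := by
    rintro n n' v w hne h1 h2 rfl
    exact hne (inr_injective (leaf_unique h1 h2))
  have ha := (hl a).2 (.inl rfl)
  have ha' := (hl' a').2 (.inl rfl)
  have ha'' := (hl'' a'').2 (.inl rfl)
  have hb := (hl b).2 (.inr rfl)
  have hb' := (hl' b').2 (.inr rfl)
  have hb'' := (hl'' b'').2 (.inr rfl)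
  exact hA.not_three_extremePendant (h.isExtremePendant hG hc hn hab ‹_› hl)
    (h.isExtremePendant hG hc hn' hab' ‹_› hl') (h.isExtremePendant hG hc hn'' hab'' ‹_› hl'')
    ⟨key h1 ha ha', key h1 ha hb'⟩ ⟨key h2 ha ha'', key h2 ha hb''⟩
    ⟨key h4 ha' ha'', key h4 ha' hb''⟩ (key h1.symm ha' hb) (key h2.symm ha'' hb)
    (key h4.symm ha'' hb')

end IsCanonicalSplitDecomposition

/-- Among the nodes whose geodesic from `r` passes through `m`, take a farthest one. All its
neighbouring nodes are closer to `r`, and in a tree there is only one such neighbour. -/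
theorem exists_isEndNode_beyond (D : GraphLabelledTree V) (r m : D.Node) :
    ∃ y : D.Node, D.IsEndNode y ∧
      D.tree.dist (inr r) (inr y) = D.tree.dist (inr r) (inr m) + D.tree.dist (inr m) (inr y) := by
  have := D.finite_node
  have hc := D.isTree.connected
  obtain ⟨y, hy, hmax⟩ := Set.exists_max_image {y : D.Node | D.tree.dist (inr r) (inr y) =
    D.tree.dist (inr r) (inr m) + D.tree.dist (inr m) (inr y)}
    (fun y => D.tree.dist (inr r) (inr y)) (Set.toFinite _) ⟨m, by simp⟩
  have hy : D.tree.dist (inr r) (inr y) =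
    D.tree.dist (inr r) (inr m) + D.tree.dist (inr m) (inr y) := hy
  have key : ∀ z, D.tree.Adj (inr y) (inr z) →
      D.tree.dist (inr r) (inr z) + 1 = D.tree.dist (inr r) (inr y) := by
    intro z hz
    rcases D.isTree.dist_eq_dist_add_one_of_adj (inr r) hz with h | h
    · exact h.symm
    · exfalso
      have h1 := hc.dist_triangle (u := inr r) (v := inr m) (w := inr z)
      have h2 := hc.dist_le_succ (inr m) hz
      have := hmax z (show _ = _ by omega)
      omega
  exact ⟨y, fun z z' hz hz' =>
    inr_injective (D.isTree.eq_of_dist hz.symm hz'.symm (key z hz) (key z' hz')), hy⟩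

theorem exists_node_pred (D : GraphLabelledTree V) {r m : D.Node} {k : ℕ}
    (h : D.tree.dist (inr r) (inr m) = k + 1) :
    ∃ y : D.Node, D.tree.Adj (inr y) (inr m) ∧ D.tree.dist (inr r) (inr y) = k := by
  have hc := D.isTree.connected
  obtain ⟨z, hz, hzd⟩ := (hc.preconnected (inr r) (inr m)).exists_adj_dist (by
    intro e
    rw [e, dist_self] at h
    omega)
  rcases z with v | y
  · exfalso
    obtain ⟨t, ht, htd⟩ := (hc.preconnected (inr r) (inl v)).exists_adj_dist (by simp)
    obtain rfl := leaf_unique ht hz.symm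
    omega
  · exact ⟨y, hz.symm, by omega⟩

/-- The canonical split decomposition of a prime AT-free distance-hereditary graph is a caterpillar
and has a reading. -/
theorem IsCanonicalSplitDecomposition.exists_isReading (h : D.IsCanonicalSplitDecomposition G)
    [Finite V] (hG : G.IsDistanceHereditary) (hA : G.IsATFree) (hp : G.IsModularPrime)
    (h3 : 3 ≤ Nat.card V) : ∃ nodes a b rest, D.IsReading nodes a b rest := by
  classical
  have := D.finite_node
  have := Fintype.ofFinite V
  have hc := D.isTree.connected
  have hV : Nonempty V := (Nat.card_pos_iff.1 (by omega)).1
  obtain ⟨v₀⟩ := hV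
  choose nd hnd using D.exists_node_of_leaf h3
  obtain ⟨r, hr, -⟩ := D.exists_isEndNode_beyond (nd v₀) (nd v₀)
  let f : D.Node → ℕ := fun m => D.tree.dist (inr r) (inr m)
  -- Two nodes at the same distance from the end node `r` would have different end nodes beyond
  -- them, three end nodes in all. Hence distances from `r` line the nodes up along a path.
  have hf : Function.Injective f := by
    intro m m' hmm
    by_contra hne
    have hmm' : D.tree.dist (inr r) (inr m) = D.tree.dist (inr r) (inr m') := hmm
    obtain ⟨y, hy, hyd⟩ := D.exists_isEndNode_beyond r m
    obtain ⟨y', hy', hyd'⟩ := D.exists_isEndNode_beyond r m'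
    have hpos : 0 < D.tree.dist (inr r) (inr m) := by
      by_contra h0
      have h1 := hc.dist_eq_zero_iff.1 (by omega : D.tree.dist (inr r) (inr m) = 0)
      have h2 := hc.dist_eq_zero_iff.1 (by omega : D.tree.dist (inr r) (inr m') = 0)
      exact hne (inr_injective (h1.symm.trans h2))
    refine h.not_three_isEndNode hG hA hp h3 hr hy hy' ?_ ?_ ?_
    · rintro rfl
      rw [dist_self] at hyd
      omega
    · rintro rfl
      rw [dist_self] at hyd'
      omega
    · rintro rfl
      exact hne (inr_injective (D.isTree.eq_of_dist_add_dist _ rfl hyd hyd' hmm'))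
  obtain ⟨nodes, h1, h2, h4, h5, h6⟩ := List.exists_chain_of_rank
    (fun m n : D.Node => D.tree.Adj (inr m) (inr n)) f hf r (dist_self)
    (fun x k hx => D.exists_node_pred hx)
  obtain ⟨a, b, hab, hb, hl⟩ := h.exists_leaves_of_isEndNode hG hp h3 hr
  let le : V → V → Bool := fun v w => decide (f (nd v) ≤ f (nd w))
  let l := (Finset.univ.filter fun v : V => v ≠ a ∧ v ≠ b).toList
  have hmem : ∀ v, v ∈ l.mergeSort le ↔ v ≠ a ∧ v ≠ b := by
    intro v
    rw [(List.mergeSort_perm l le).mem_iff, Finset.mem_toList]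
    simp
  have hsort : (l.mergeSort le).Pairwise fun v w => f (nd v) ≤ f (nd w) := by
    refine (List.pairwise_mergeSort (le := le) ?_ ?_ l).imp fun h => ?_
    · intro x y z h1 h2
      simp only [le, decide_eq_true_eq] at h1 h2 ⊢
      exact h1.trans h2
    · intro x y
      simpa [le] using le_total _ _
    · simpa [le] using h
  have hpair : ∀ v w, f (nd v) ≤ f (nd w) → ∀ m n : D.Node, D.tree.Adj (inl v) (inr m) →
      D.tree.Adj (inl w) (inr n) → m = n ∨ [m, n].Sublist nodes := by
    intro v w hvw m n hm hn
    obtain rfl := inr_injective (leaf_unique hm (hnd v))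
    obtain rfl := inr_injective (leaf_unique hn (hnd w))
    rcases hvw.eq_or_lt with h | h
    · exact .inl (hf h)
    · exact .inr (List.sublist_pair_of_lt h6 (h2 _) (h2 _) h)
  have hzero : ∀ v, v = a ∨ v = b → ∀ w, f (nd v) ≤ f (nd w) := by
    intro v hv w
    have : nd v = r := inr_injective (leaf_unique (hnd v) ((hl v).2 hv))
    rw [this]
    simp [f]
  refine ⟨nodes, a, b, l.mergeSort le, h1, h2, h4, ?_, fun v => ?_, ?_, r, h5, hb, hl⟩
  · simp only [List.nodup_cons, List.mem_cons, hmem, not_or]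
    refine ⟨⟨hab, by simp⟩, by simp, ?_⟩
    exact (List.mergeSort_perm l le).nodup_iff.2 (Finset.nodup_toList _)
  · simp only [List.mem_cons, hmem]
    tauto
  · refine List.Pairwise.imp (R := fun v w => f (nd v) ≤ f (nd w)) (fun h => hpair _ _ h) ?_
    exact List.pairwise_cons.2 ⟨fun w _ => hzero a (.inl rfl) w,
      List.pairwise_cons.2 ⟨fun w _ => hzero b (.inr rfl) w, hsort⟩⟩

end GraphLabelledTree

theorem List.Nodup.pairwise_idxOf_lt {α : Type*} [BEq α] [LawfulBEq α] {l : List α}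
    (h : l.Nodup) : l.Pairwise fun x y => l.idxOf x < l.idxOf y := by
  rw [List.pairwise_iff_getElem]
  intro i j hi hj hij
  rwa [h.idxOf_getElem, h.idxOf_getElem]

namespace GraphLabelledTree

open Sum SimpleGraph

variable {V : Type u} {D : GraphLabelledTree V} {G : SimpleGraph V}

/-! ### Caterpillars -/

/-- `f` numbers the nodes along a path of the tree. -/
structure IsRank (D : GraphLabelledTree V) (f : D.Node → ℕ) : Prop where
  inj : Function.Injective f
  adj_iff : ∀ m n, D.tree.Adj (inr m) (inr n) ↔ f m + 1 = f n ∨ f n + 1 = f m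
  exists_pred : ∀ m k, f m = k + 1 → ∃ y, f y = k

theorem IsRank.exists_eq {f : D.Node → ℕ} (hf : D.IsRank f) {k : ℕ} (m : D.Node) (h : k ≤ f m) :
    ∃ y, f y = k := by
  obtain ⟨j, hj⟩ := Nat.exists_eq_add_of_le h
  induction j generalizing m with
  | zero => exact ⟨m, by omega⟩
  | succ j ih =>
    obtain ⟨y, hy⟩ := hf.exists_pred m (k + j) (by omega)
    exact ih y (by omega) hy

theorem IsRank.branch_up {f : D.Node → ℕ} (hf : D.IsRank f) {n n' m : D.Node} {y : V}
    (hy : D.tree.Adj (inr n') (inl y)) (hm : f n + 1 = f m) (h : f m ≤ f n') :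
    D.Branch n (inr m) y := by
  obtain ⟨j, hj⟩ := Nat.exists_eq_add_of_le h
  induction j generalizing m n with
  | zero =>
    obtain rfl := hf.inj (hj : f n' = f m)
    exact .node ((hf.adj_iff _ _).2 (.inl hm)) (by simp) (.leaf hy)
  | succ j ih =>
    obtain ⟨t, ht⟩ := hf.exists_eq (k := f m + 1) n' (by omega)
    refine .node ((hf.adj_iff _ _).2 (.inl hm)) ?_ (ih ht.symm (by omega) (by omega))
    intro e
    obtain rfl := inr_injective e
    omega

/-- A step back towards `r` would go to the unique parent of the current node. The condition `hx`,
that this parent does not occur later, is maintained because it has just been visited. -/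
theorem pairwise_dist_of_isChain (r x : D.Node) (l : List D.Node) (hn : (x :: l).Nodup)
    (hc : (x :: l).IsChain fun m n => D.tree.Adj (inr m) (inr n))
    (hx : ∀ w : D.Node, D.tree.Adj (inr w) (inr x) →
      D.tree.dist (inr r) (inr w) + 1 = D.tree.dist (inr r) (inr x) → w ∉ l) :
    (x :: l).Pairwise fun m n => D.tree.dist (inr r) (inr m) < D.tree.dist (inr r) (inr n) := by
  induction l generalizing x with
  | nil => exact List.pairwise_singleton _ _
  | cons y l ih =>
    rw [List.isChain_cons_cons] at hc
    have hxy : D.tree.dist (inr r) (inr x) + 1 = D.tree.dist (inr r) (inr y) := by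
      rcases D.isTree.dist_eq_dist_add_one_of_adj (inr r) hc.1 with h | h
      · exact absurd (by simp) (hx y hc.1.symm h.symm)
      · exact h.symm
    have h1 := ih y (List.nodup_cons.1 hn).2 hc.2 (by
      intro w hw hd hwl
      obtain rfl := inr_injective (D.isTree.eq_of_dist hw hc.1 hd hxy)
      exact (List.nodup_cons.1 hn).1 (by simp [hwl]))
    refine List.pairwise_cons.2 ⟨fun z hz => ?_, h1⟩
    rcases List.mem_cons.1 hz with rfl | hz
    · omega
    · have := (List.pairwise_cons.1 h1).1 z hz
      omega

theorem IsReading.exists_isRank {nodes : List D.Node} {a b : V} {rest : List V}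
    (h : D.IsReading nodes a b rest) :
    ∃ f, D.IsRank f ∧ ∀ m n, [m, n].Sublist nodes ↔ f m < f n := by
  obtain ⟨r, hr, -⟩ := h.pendant
  obtain ⟨l, rfl⟩ : ∃ l, nodes = r :: l := by
    cases nodes with
    | nil => simp at hr
    | cons x l => exact ⟨l, by simpa using hr⟩
  have hpw := D.pairwise_dist_of_isChain r r l h.nodes_nodup h.nodes_chain (by simp)
  let f : D.Node → ℕ := fun m => D.tree.dist (inr r) (inr m)
  have hsub : ∀ m n, [m, n].Sublist (r :: l) ↔ f m < f n := fun m n =>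
    ⟨fun hs => by simpa using hpw.sublist hs,
      List.sublist_pair_of_lt hpw (h.mem_nodes m) (h.mem_nodes n)⟩
  have hinj : Function.Injective f := by
    intro m n hmn
    refine List.inj_on_of_nodup_map (f := f) (l := r :: l) ?_ (h.mem_nodes m) (h.mem_nodes n) hmn
    rw [List.Nodup, List.pairwise_map]
    exact hpw.imp fun h => h.ne
  refine ⟨f, ⟨hinj, fun m n => ⟨fun hmn => ?_, ?_⟩, fun m k hm => ?_⟩, hsub⟩
  · exact (D.isTree.dist_eq_dist_add_one_of_adj (inr r) hmn).symm.imp Eq.symm Eq.symm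
  · have key : ∀ m n, f m + 1 = f n → D.tree.Adj (inr m) (inr n) := by
      intro m n hmn
      obtain ⟨y, hy, hyd⟩ := D.exists_node_pred (k := f m) hmn.symm
      obtain rfl := hinj hyd
      exact hy
    rintro (h | h)
    · exact key m n h
    · exact (key n m h).symm
  · obtain ⟨y, -, hy⟩ := D.exists_node_pred hm
    exact ⟨y, hy⟩

/-- A reading together with the ranks of the nodes and of the leaves. -/
structure IsRankedReading (D : GraphLabelledTree V) (nodes : List D.Node) (leaves : List V)
    (f : D.Node → ℕ) (g : V → ℕ) : Prop where
  isRank : D.IsRank f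
  nodes_iff : ∀ m n, [m, n].Sublist nodes ↔ f m < f n
  leaves_iff : ∀ v w, [v, w].Sublist leaves ↔ g v < g w
  inj : Function.Injective g
  mono : ∀ v w m n, D.tree.Adj (inl v) (inr m) → D.tree.Adj (inl w) (inr n) → g v ≤ g w → f m ≤ f n

theorem IsReading.exists_isRankedReading [DecidableEq V] {nodes : List D.Node} {a b : V}
    {rest : List V} (h : D.IsReading nodes a b rest) :
    ∃ f, D.IsRankedReading nodes (a :: b :: rest) f fun v => (a :: b :: rest).idxOf v := by
  obtain ⟨f, hf, hfs⟩ := h.exists_isRank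
  have hpw := h.leaves_nodup.pairwise_idxOf_lt
  have hinj : Function.Injective fun v => (a :: b :: rest).idxOf v :=
    fun v w hvw => (List.idxOf_inj (h.mem_leaves v)).1 hvw
  have hiff : ∀ v w, [v, w].Sublist (a :: b :: rest) ↔
      (a :: b :: rest).idxOf v < (a :: b :: rest).idxOf w := fun v w =>
    ⟨fun hs => by simpa using hpw.sublist hs,
      List.sublist_pair_of_lt hpw (h.mem_leaves v) (h.mem_leaves w)⟩
  refine ⟨f, hf, hfs, hiff, hinj, fun v w m n hm hn hvw => ?_⟩
  rcases hvw.eq_or_lt with hvw | hvw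
  · obtain rfl := hinj hvw
    exact (congrArg f (inr_injective (leaf_unique hm hn))).le
  · have := h.leaves_sorted.sublist ((hiff v w).2 hvw)
    rcases (by simpa using this : ∀ m n : D.Node, D.tree.Adj (inl v) (inr m) →
      D.tree.Adj (inl w) (inr n) → m = n ∨ [m, n].Sublist nodes) m n hm hn with rfl | h1
    · exact le_rfl
    · exact ((hfs m n).1 h1).le

namespace IsRankedReading

variable {nodes : List D.Node} {leaves : List V} {f : D.Node → ℕ} {g : V → ℕ}
  {n n' : D.Node} {b c c' y : V} {w z : V ⊕ D.Node}

theorem before_leaf (h : D.IsRankedReading nodes leaves f g) {v : V} :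
    D.Before nodes leaves n c (inl v) ↔ g v < g c := h.leaves_iff v c

theorem before_node (h : D.IsRankedReading nodes leaves f g) {m : D.Node} :
    D.Before nodes leaves n c (inr m) ↔ f m < f n := h.nodes_iff m n

theorem after_leaf (h : D.IsRankedReading nodes leaves f g) {v : V} :
    D.After nodes leaves n c (inl v) ↔ g c < g v := h.leaves_iff c v

theorem after_node (h : D.IsRankedReading nodes leaves f g) {m : D.Node} :
    D.After nodes leaves n c (inr m) ↔ f n < f m := h.nodes_iff n m

theorem Before.ne_after (h : D.IsRankedReading nodes leaves f g)
    (hw : D.Before nodes leaves n c w) (hz : D.After nodes leaves n c z) : w ≠ z := by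
  rintro rfl
  rcases w with v | m
  · exact absurd (h.before_leaf.1 hw) (h.after_leaf.1 hz).not_gt
  · exact absurd (h.before_node.1 hw) (h.after_node.1 hz).not_gt

theorem Before.ne (h : D.IsRankedReading nodes leaves f g)
    (hw : D.Before nodes leaves n c w) : w ≠ inl c := by
  rintro rfl
  exact absurd (h.before_leaf.1 hw) (lt_irrefl _)

theorem After.ne (h : D.IsRankedReading nodes leaves f g)
    (hw : D.After nodes leaves n c w) : w ≠ inl c := by
  rintro rfl
  exact absurd (h.after_leaf.1 hw) (lt_irrefl _)

theorem cases (h : D.IsRankedReading nodes leaves f g) (hz : D.tree.Adj (inr n) z) (c : V) :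
    z = inl c ∨ D.Before nodes leaves n c z ∨ D.After nodes leaves n c z := by
  rcases z with v | m
  · rw [h.before_leaf, h.after_leaf]
    rcases lt_trichotomy (g v) (g c) with h1 | h1 | h1
    · exact .inr (.inl h1)
    · exact .inl (congrArg inl (h.inj h1))
    · exact .inr (.inr h1)
  · rw [h.before_node, h.after_node]
    have := (h.isRank.adj_iff _ _).1 hz
    omega

theorem exists_branch_after (h : D.IsRankedReading nodes leaves f g)
    (hc : D.tree.Adj (inl c) (inr n)) (hy : D.tree.Adj (inl y) (inr n')) (hcy : g c < g y) :
    ∃ w, D.Branch n w y ∧ D.After nodes leaves n c w := by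
  rcases (h.mono c y n n' hc hy hcy.le).eq_or_lt with h1 | h1
  · obtain rfl := h.isRank.inj h1
    exact ⟨inl y, .leaf hy.symm, h.after_leaf.2 hcy⟩
  · obtain ⟨m, hm⟩ := h.isRank.exists_eq (k := f n + 1) n' (by omega)
    exact ⟨inr m, h.isRank.branch_up hy.symm hm.symm (by omega), h.after_node.2 (by omega)⟩

/-- Every node of a canonical split decomposition which is a caterpillar has a leaf. -/
theorem exists_leaf (h : D.IsRankedReading nodes leaves f g) [Finite V]
    (hD : D.IsCanonicalSplitDecomposition G) (n : D.Node) :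
    ∃ v : V, D.tree.Adj (inl v) (inr n) := by
  have key : ∀ k, ∃ z : V ⊕ D.Node, ∀ m, f m = k → inr m = z := by
    intro k
    by_cases hk : ∃ m, f m = k
    · obtain ⟨m, hm⟩ := hk
      exact ⟨inr m, fun m' hm' => congrArg inr (h.isRank.inj (hm'.trans hm.symm))⟩
    · exact ⟨inr n, fun m hm => absurd ⟨m, hm⟩ hk⟩
  obtain ⟨z, hz⟩ := key (f n + 1)
  obtain ⟨z', hz'⟩ := key (f n - 1)
  obtain ⟨w, hw, h1, h2⟩ := hD.exists_adj_of_ne n z z'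
  rcases w with v | m
  · exact ⟨v, hw.symm⟩
  · rcases (h.isRank.adj_iff _ _).1 hw with h3 | h3
    · exact absurd (hz m h3.symm) h1
    · exact absurd (hz' m (by omega)) h2

end IsRankedReading

/-! ### The invariant of a reading -/

theorem IsStarNode.centre_unique {n : D.Node} {z z' : V ⊕ D.Node}
    (h3 : 3 ≤ (D.tree.neighborSet (inr n)).encard) (h : D.IsStarNode n z)
    (h' : D.IsStarNode n z') : z = z' := by
  by_contra hne
  obtain ⟨w, hw, h1, h2⟩ := exists_adj_of_three_le h3 z z'
  have h3 := (h.lab_iff h.1 hw).2 ⟨h1.symm, .inl rfl⟩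
  rw [h'.lab_iff h.1 hw] at h3
  tauto

theorem IsStarNode.not_isCliqueNode {n : D.Node} {z : V ⊕ D.Node}
    (h3 : 3 ≤ (D.tree.neighborSet (inr n)).encard) (h : D.IsStarNode n z)
    (h' : D.IsCliqueNode n) : False := by
  obtain ⟨w, hw, h1, -⟩ := exists_adj_of_three_le h3 z z
  obtain ⟨w', hw', h2, h3⟩ := exists_adj_of_three_le h3 z w
  have h4 := (h'.lab_iff hw hw').2 h3.symm
  rw [h.lab_iff hw hw'] at h4
  tauto

/-- The state before the leaf `c` of `n` is read: the root `b` is accessible from `n` through the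
marker `w`, which is the centre of the label of `n` if that centre was already passed. -/
structure RootBefore (D : GraphLabelledTree V) (nodes : List D.Node) (leaves : List V)
    (n : D.Node) (c b : V) (w : V ⊕ D.Node) : Prop where
  before : D.Before nodes leaves n c w
  reach : D.Reach n w b
  eq_centre : ∀ z, D.IsStarNode n z → D.Before nodes leaves n c z → w = z

/-- The state after the leaf `c` of `n` is read. -/
structure RootAfter (D : GraphLabelledTree V) (nodes : List D.Node) (leaves : List V)
    (n : D.Node) (c b : V) (w : V ⊕ D.Node) : Prop where
  before : w = inl c ∨ D.Before nodes leaves n c w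
  reach : D.Reach n w b
  eq_centre : ∀ z, D.IsStarNode n z → z = inl c ∨ D.Before nodes leaves n c z → w = z

/-- Within a node, being before `c'` means being `c` or before `c`. Otherwise `n'` is the very next
node, since every node has a leaf and `c'` directly follows `c`. The marker of `n` at `n'` then
leads to `b`: in a star label of `n`, either the centre was passed and is `w`, or it is still to
come, and then it is `n'` since no leaf of `n` remains. A centre of `n'` that was already passed can
only be `n`. -/
theorem RootAfter.next {nodes : List D.Node} {leaves : List V} {f : D.Node → ℕ} {g : V → ℕ}
    {n n' : D.Node} {b c c' : V} {w : V ⊕ D.Node} [Finite V]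
    (hR : D.RootAfter nodes leaves n c b w) (h : D.IsRankedReading nodes leaves f g)
    (hD : D.IsCanonicalSplitDecomposition G) (hG : G.IsDistanceHereditary)
    (hc : D.tree.Adj (inl c) (inr n)) (hc' : D.tree.Adj (inl c') (inr n'))
    (hcc : g c' = g c + 1) : ∃ w, D.RootBefore nodes leaves n' c' b w := by
  rcases (h.mono c c' n n' hc hc' (by omega)).eq_or_lt with h1 | h1
  · obtain rfl := h.isRank.inj h1
    have key : ∀ z, D.Before nodes leaves n c' z ↔ z = inl c ∨ D.Before nodes leaves n c z := by
      rintro (v | m)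
      · rw [h.before_leaf, h.before_leaf, hcc, Nat.lt_succ_iff_lt_or_eq, or_comm]
        exact or_congr_left ⟨fun e => congrArg inl (h.inj e), fun e => by rw [inl_injective e]⟩
      · rw [h.before_node, h.before_node]
        simp
    exact ⟨w, (key w).2 hR.before, hR.reach, fun z hz hz' => hR.eq_centre z hz ((key z).1 hz')⟩
  · have h2 : f n' = f n + 1 := by
      by_contra hne
      obtain ⟨m, hm⟩ := h.isRank.exists_eq (k := f n + 1) n' (by omega)
      obtain ⟨v, hv⟩ := h.exists_leaf hD m
      have h3 : g c < g v := by
        by_contra hlt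
        have := h.mono v c m n hv hc (by omega)
        omega
      have := h.mono c' v n' m hc' hv (by omega)
      omega
    have hnn : D.tree.Adj (inr n') (inr n) := (h.isRank.adj_iff _ _).2 (.inr h2.symm)
    have hwn : w ≠ inr n' := by
      rintro rfl
      rcases hR.before with h3 | h3
      · simp at h3
      · have := h.before_node.1 h3
        omega
    refine ⟨inr n, h.before_node.2 h1, .node hnn ?_ hR.reach, fun z hz hz' => ?_⟩
    · rcases hD.clique_or_star hG n with h3 | ⟨z, hz⟩
      · exact (h3.lab_iff hnn.symm hR.reach.branch.adj).2 hwn.symm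
      · refine (hz.lab_iff hnn.symm hR.reach.branch.adj).2 ⟨hwn.symm, ?_⟩
        have hzn : D.tree.Adj (inr n) z := hz.1
        rcases h.cases hzn c with h3 | h3 | h3
        · exact .inr (hR.eq_centre z hz (.inl h3))
        · exact .inr (hR.eq_centre z hz (.inr h3))
        · left
          rcases z with v | m
          · have h4 := h.after_leaf.1 h3
            have := h.mono c' v n' n hc' hzn.symm (by omega)
            omega
          · have h4 := h.after_node.1 h3
            have h5 := (h.isRank.adj_iff _ _).1 hzn
            exact congrArg inr (h.isRank.inj (by omega))
    · have hzn : D.tree.Adj (inr n') z := hz.1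
      rcases z with v | m
      · have h3 := h.before_leaf.1 hz'
        have := h.mono v c n' n hzn.symm hc (by omega)
        omega
      · have h3 := h.before_node.1 hz'
        have h4 := (h.isRank.adj_iff _ _).1 hzn
        exact congrArg inr (h.isRank.inj (by omega))

/-- All later leaves lie behind markers after `c`, and only markers matter. In a clique, `b` and `c`
are adjacent to the same ones. With centre `c`, neither the marker of `b` nor a later one is the
centre, so `b` is finished. With the centre passed, the same holds for `c`. With the centre still to
come, the markers of `b` and `c` are adjacent to the centre only, so the two are twins for what
follows. -/
theorem ReadsOff.prunes {nodes : List D.Node} {leaves : List V} {f : D.Node → ℕ} {g : V → ℕ}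
    [Finite V] (h : D.IsRankedReading nodes leaves f g)
    (hD : D.IsCanonicalSplitDecomposition G) (hG : G.IsDistanceHereditary)
    (hnd : ∀ v : V, ∃ n : D.Node, D.tree.Adj (inl v) (inr n)) {a b : V} {cs : List V}
    {s : List (V × V)} (hs : D.ReadsOff nodes leaves a b cs s)
    (hcs : cs.IsChain fun v w => g w = g v + 1)
    (hb : ∀ c cs', cs = c :: cs' → ∀ n, D.tree.Adj (inl c) (inr n) →
      ∃ w, D.RootBefore nodes leaves n c b w) : G.Prunes a b cs s := by
  have hlater : ∀ {c : V} {cs : List V}, (c :: cs).IsChain (fun v w => g w = g v + 1) →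
      ∀ y ∈ cs, g c < g y := by
    intro c cs hcs
    have h1 : (c :: cs).IsChain fun v w => g v < g w := hcs.imp fun v w h => by omega
    rw [List.isChain_iff_pairwise] at h1
    exact (List.pairwise_cons.1 h1).1
  have hnext : ∀ {c : V} {cs : List V} {n : D.Node} {b : V} {w : V ⊕ D.Node},
      (c :: cs).IsChain (fun v w => g w = g v + 1) → D.tree.Adj (inl c) (inr n) →
      D.RootAfter nodes leaves n c b w → ∀ c' cs', cs = c' :: cs' → ∀ n,
        D.tree.Adj (inl c') (inr n) → ∃ w, D.RootBefore nodes leaves n c' b w := by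
    rintro c cs n b w hcs hc hR c' cs' rfl n' hc'
    exact hR.next h hD hG hc hc' (List.isChain_cons_cons.1 hcs).1
  have hafter : ∀ {c y : V} {n : D.Node}, D.tree.Adj (inl c) (inr n) → g c < g y →
      ∃ w, D.Branch n w y ∧ D.After nodes leaves n c w := by
    intro c y n hc hcy
    obtain ⟨n', hn'⟩ := hnd y
    exact h.exists_branch_after hc hn' hcy
  induction hs with
  | last b => exact .last a b
  | clique b c cs s n hc hn hs ih =>
    obtain ⟨w, hw⟩ := hb c cs rfl n hc
    refine .twin (fun y hy => ?_) (ih hcs.tail (hnext hcs hc (w := w) ⟨.inr hw.before, hw.reach,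
      fun z hz => (hz.not_isCliqueNode (hD.three_le_degree _) hn).elim⟩))
    obtain ⟨t, hyt, ht⟩ := hafter hc (hlater hcs y hy)
    have h1 : w ≠ t := IsRankedReading.Before.ne_after h hw.before ht
    have h2 : t ≠ inl c := IsRankedReading.After.ne h ht
    rw [hD.adj_iff hw.reach.branch hyt h1, hD.adj_iff (.leaf hc.symm) hyt h2.symm,
      hn.lab_iff hw.reach.branch.adj hyt.adj, hn.lab_iff hc.symm hyt.adj]
    simp [h1, h2.symm, hw.reach, Reach.leaf hc.symm]
  | starAtLeaf b c cs s n hc hn hs ih =>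
    obtain ⟨w, hw⟩ := hb c cs rfl n hc
    refine .shift (fun y hy hby => ?_) (ih hcs.tail (hnext hcs hc (w := inl c) ⟨.inl rfl,
      .leaf hc.symm, fun z hz _ => hn.centre_unique (hD.three_le_degree _) hz⟩))
    obtain ⟨t, hyt, ht⟩ := hafter hc (hlater hcs y hy)
    have h1 : w ≠ t := IsRankedReading.Before.ne_after h hw.before ht
    have h2 : t ≠ inl c := IsRankedReading.After.ne h ht
    have h3 : w ≠ inl c := IsRankedReading.Before.ne h hw.before
    rw [hD.adj_iff hw.reach.branch hyt h1, hn.lab_iff hw.reach.branch.adj hyt.adj] at hby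
    exact hby.2.1.2.elim h3 h2
  | starBefore b c cs s n z hc hn hz hs ih =>
    obtain ⟨w, hw⟩ := hb c cs rfl n hc
    refine .pendant (fun y hy hby => ?_) (ih hcs.tail (hnext hcs hc (w := w) ⟨.inr hw.before,
      hw.reach, fun z' hz' _ => (hw.eq_centre z hn hz).trans (hn.centre_unique (hD.three_le_degree _) hz')⟩))
    obtain ⟨t, hyt, ht⟩ := hafter hc (hlater hcs y hy)
    have h1 : z ≠ t := IsRankedReading.Before.ne_after h hz ht
    have h2 : t ≠ inl c := IsRankedReading.After.ne h ht
    have h3 : z ≠ inl c := IsRankedReading.Before.ne h hz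
    rw [hD.adj_iff (.leaf hc.symm) hyt h2.symm, hn.lab_iff hc.symm hyt.adj] at hby
    exact hby.2.1.2.elim h3.symm h1.symm
  | starAfter b c cs s n z hc hn hz hs ih =>
    obtain ⟨w, hw⟩ := hb c cs rfl n hc
    have h4 : z ≠ inl c := IsRankedReading.After.ne h hz
    refine .twin (fun y hy => ?_) (ih hcs.tail (hnext hcs hc (w := w) ⟨.inr hw.before, hw.reach,
      fun z' hz' hz'' => ?_⟩))
    · obtain ⟨t, hyt, ht⟩ := hafter hc (hlater hcs y hy)
      have h1 : w ≠ t := IsRankedReading.Before.ne_after h hw.before ht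
      have h2 : t ≠ inl c := IsRankedReading.After.ne h ht
      have h3 : w ≠ z := IsRankedReading.Before.ne_after h hw.before hz
      rw [hD.adj_iff hw.reach.branch hyt h1, hD.adj_iff (.leaf hc.symm) hyt h2.symm,
        hn.lab_iff hw.reach.branch.adj hyt.adj, hn.lab_iff hc.symm hyt.adj]
      simp [h1, h2.symm, h3, h4.symm, hw.reach, Reach.leaf hc.symm]
    · obtain rfl := hn.centre_unique (hD.three_le_degree _) hz'
      rcases hz'' with h5 | h5
      · exact absurd h5 h4
      · exact absurd rfl (IsRankedReading.Before.ne_after h h5 hz)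

theorem IsRankedReading.exists_readsOff {nodes : List D.Node} {leaves : List V}
    {f : D.Node → ℕ} {g : V → ℕ} [Finite V] (h : D.IsRankedReading nodes leaves f g)
    (hD : D.IsCanonicalSplitDecomposition G) (hG : G.IsDistanceHereditary)
    (hnd : ∀ v : V, ∃ n : D.Node, D.tree.Adj (inl v) (inr n)) (a b : V) (cs : List V) :
    ∃ s, D.ReadsOff nodes leaves a b cs s := by
  induction cs generalizing b with
  | nil => exact ⟨_, .last a b⟩
  | cons c cs ih =>
    obtain ⟨n, hn⟩ := hnd c
    rcases hD.clique_or_star hG n with h1 | ⟨z, hz⟩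
    · exact ⟨_, .clique a b c cs _ n hn h1 (ih b).choose_spec⟩
    · rcases h.cases hz.1 c with rfl | h2 | h2
      · exact ⟨_, .starAtLeaf a b c cs _ n hn hz (ih c).choose_spec⟩
      · exact ⟨_, .starBefore a b c cs _ n z hn hz h2 (ih b).choose_spec⟩
      · exact ⟨_, .starAfter a b c cs _ n z hn hz h2 (ih b).choose_spec⟩

theorem IsReading.readsOff {nodes : List D.Node} {a b : V} {rest : List V} [Finite V]
    (h : D.IsReading nodes a b rest) (hD : D.IsCanonicalSplitDecomposition G)
    (hG : G.IsDistanceHereditary) (h3 : 3 ≤ Nat.card V) :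
    (∃ s, D.ReadsOff nodes (a :: b :: rest) a b rest s) ∧
      ∀ s, D.ReadsOff nodes (a :: b :: rest) a b rest s →
        Trigraph.PendantRun (Trigraph.ofGraph G) ((Trigraph.ofGraph G).trace s) := by
  classical
  have hnd := D.exists_node_of_leaf h3
  obtain ⟨f, hf⟩ := h.exists_isRankedReading
  refine ⟨hf.exists_readsOff hD hG hnd a b rest, fun s hs => ?_⟩
  obtain ⟨r, hr, hrb, hl⟩ := h.pendant
  have ha' := (hl a).2 (.inl rfl)
  have hb' := (hl b).2 (.inr rfl)
  have hab : a ≠ b := by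
    have := h.leaves_nodup
    simp only [List.nodup_cons, List.mem_cons, not_or] at this
    exact this.1.1
  have hchain : (b :: rest).IsChain fun v w =>
      (a :: b :: rest).idxOf w = (a :: b :: rest).idxOf v + 1 := by
    rw [List.isChain_iff_getElem]
    intro i hi
    have h1 := h.leaves_nodup.idxOf_getElem (i + 1) (by simpa using Nat.lt_of_succ_lt hi)
    have h2 := h.leaves_nodup.idxOf_getElem (i + 2) (by simpa using hi)
    simp only [List.getElem_cons_succ] at h1 h2 ⊢
    omega
  -- The invariant starts after `b`, which is itself the centre of the first star.
  have hroot : D.RootAfter nodes (a :: b :: rest) r b b (inl b) :=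
    ⟨.inl rfl, .leaf hb'.symm, fun z hz _ => hrb.centre_unique (hD.three_le_degree _) hz⟩
  have hP := hs.prunes hf hD hG hnd hchain.tail (by
    rintro c cs rfl n hc
    exact hroot.next hf hD hG hb' hc (List.isChain_cons_cons.1 hchain).1)
  rw [← Trigraph.restrict_univ]
  refine (Trigraph.isPruned_restrict h.leaves_nodup (fun x => ⟨fun _ => trivial,
    fun _ => h.mem_leaves x⟩) fun y hy hay => ?_).pendantRun hP
  obtain ⟨w, hw⟩ := D.exists_branch r y
  have h1 : w ≠ inl a := by rintro rfl; exact hay.ne hw.eq_of_leaf.symm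
  rw [hD.adj_iff (.leaf ha'.symm) hw h1.symm, hrb.lab_iff ha'.symm hw.adj] at hay
  rcases hay.2.1.2 with h2 | h2
  · exact absurd (inl_injective h2) hab
  · subst h2
    obtain rfl := hw.eq_of_leaf
    have := h.leaves_nodup
    simp only [List.nodup_cons, List.mem_cons, not_or] at this
    exact this.2.1 hy

end GraphLabelledTree

/-! ### Threads as words -/

/-- The ways in which a vertex of a thread is attached to the vertices before it. -/
inductive LeafKind : Type
  | clique
  | centre
  | before
  | after

namespace LeafKind

/-- Leaves of these kinds that follow each other belong to the same node. -/
def Merges : LeafKind → LeafKind → Prop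
  | clique, clique => True
  | after, after => True
  | after, centre => True
  | centre, before => True
  | before, before => True
  | _, _ => False

end LeafKind

theorem List.pair_sublist_cons {α : Type*} {u t c : α} {l : List α} :
    [u, t].Sublist (c :: l) ↔ [u, t].Sublist l ∨ (u = c ∧ t ∈ l) := by
  rw [List.sublist_cons_iff]
  refine or_congr_right ⟨?_, ?_⟩
  · rintro ⟨r, hr, h⟩
    obtain ⟨rfl, rfl⟩ := List.cons.inj hr
    exact ⟨rfl, List.singleton_sublist.1 h⟩
  · rintro ⟨rfl, h⟩
    exact ⟨[t], rfl, List.singleton_sublist.2 h⟩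

namespace SimpleGraph

variable {V : Type*} {G : SimpleGraph V}

/-- The adjacencies of `s` to the vertices that follow it in a thread. -/
def RowSpells (G : SimpleGraph V) (op : V → LeafKind) (s : V) (l : List V) : Prop :=
  ∀ t ∈ l, G.Adj s t ↔ op s ≠ .before ∧ (∀ u, [u, t].Sublist l → op u ≠ .centre) ∧ op t ≠ .after

/-- The adjacencies between the vertices of a list are described by the kinds of these vertices. -/
def Spells (G : SimpleGraph V) (op : V → LeafKind) : List V → Prop
  | [] => True
  | s :: l => G.RowSpells op s l ∧ Spells G op l

theorem RowSpells.congr {op op' : V → LeafKind} {s : V} {l : List V} (h : G.RowSpells op s l)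
    (hs : op s = .before ↔ op' s = .before) (hl : ∀ x ∈ l, op x = op' x) :
    G.RowSpells op' s l := by
  intro t ht
  rw [h t ht, hl t ht, Ne, hs]
  refine and_congr_right fun _ => and_congr_left fun _ => forall_congr' fun u =>
    forall_congr' fun hu => ?_
  rw [hl u (hu.subset (by simp))]

theorem Spells.congr {op op' : V → LeafKind} {l : List V} (h : G.Spells op l)
    (hl : ∀ x ∈ l, op x = op' x) : G.Spells op' l := by
  induction l with
  | nil => trivial
  | cons s l ih =>
    exact ⟨h.1.congr (by rw [hl s (by simp)]) fun x hx => hl x (by simp [hx]),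
      ih h.2 fun x hx => hl x (by simp [hx])⟩

/-- A twin `c` of the root is spelled `clique` or `after`, according to its adjacency to the root; a
pendant vertex is spelled `before`; a new root is spelled `centre` and so cuts the old root off from
everything later. Connectedness is needed because no letter describes a pendant vertex or an old
root without its single edge. The letter of the first root is only required not to be `before`. -/
theorem Thread.exists_spells {b : V} {cs : List V} (h : G.Thread b cs) (hn : (b :: cs).Nodup)
    (hc : ∀ y ∈ cs, G.ConnIn {x | x ∈ b :: cs} b y) :
    ∃ op : V → LeafKind, op b ≠ .before ∧ G.Spells op (b :: cs) := by
  classical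
  induction h with
  | nil b => exact ⟨fun _ => .clique, by simp, by simp [RowSpells], trivial⟩
  | @twin b c cs h hs ih =>
    simp only [List.nodup_cons, List.mem_cons, not_or] at hn
    have hset : {x | x ∈ b :: c :: cs} \ {c} = {x | x ∈ b :: cs} := by
      ext x
      simp only [Set.mem_sdiff, Set.mem_ofPred_eq, List.mem_cons, Set.mem_singleton_iff]
      constructor
      · tauto
      · rintro (rfl | hx)
        · exact ⟨.inl rfl, hn.1.1⟩
        · exact ⟨.inr (.inr hx), by rintro rfl; exact hn.2.1 hx⟩
    obtain ⟨op, hb, hr, ho⟩ := ih (by simp [hn]) (fun y hy => by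
      rw [← hset]
      refine (hc y (by simp [hy])).diff_singleton (u := b) (by simp) hn.1.1 (fun z hz hcz => ?_)
        hn.1.1 (by rintro rfl; exact hn.2.1 hy)
      rcases List.mem_cons.1 hz with rfl | hz
      · exact .inl rfl
      · rcases List.mem_cons.1 hz with rfl | hz
        · exact absurd hcz (G.loopless.irrefl _)
        · exact .inr ((h z hz).2 hcz))
    let k : LeafKind := if G.Adj b c then .clique else .after
    have hk1 : k ≠ .before := by simp only [k]; split_ifs <;> simp
    have hk2 : k ≠ .centre := by simp only [k]; split_ifs <;> simp
    have hk3 : G.Adj b c ↔ k ≠ .after := by simp only [k]; split_ifs <;> simp [*]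
    let op' : V → LeafKind := fun x => if x = c then k else op x
    have hop : ∀ x ∈ cs, op x = op' x := fun x hx => by
      have : x ≠ c := by rintro rfl; exact hn.2.1 hx
      simp [op', this]
    have hopb : op' b = op b := by simp [op', hn.1.1]
    have hopc : op' c = k := by simp [op']
    have hr' := hr.congr (op' := op') (by rw [hopb]) hop
    refine ⟨op', hopb ▸ hb, ?_, ?_, ho.congr hop⟩
    · intro t ht
      rcases List.mem_cons.1 ht with rfl | ht
      · rw [hopb, hopc, ← hk3]
        refine ⟨fun h => ⟨hb, fun u hu => ?_, h⟩, fun h => h.2.2⟩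
        rcases List.pair_sublist_cons.1 hu with hu | ⟨-, hu⟩
        · exact absurd (hu.subset (by simp)) hn.2.1
        · exact absurd hu hn.2.1
      · rw [hr' t ht]
        refine and_congr_right fun _ => and_congr_left fun _ => ⟨fun h u hu => ?_,
          fun h u hu => h u (hu.cons c)⟩
        rcases List.pair_sublist_cons.1 hu with hu | ⟨rfl, -⟩
        · exact h u hu
        · rwa [hopc]
    · intro t ht
      rw [← h t ht, hr' t ht, hopb, hopc]
      simp [hb, hk1]
  | @pendant b c cs h hs ih =>
    simp only [List.nodup_cons, List.mem_cons, not_or] at hn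
    have hset : {x | x ∈ b :: c :: cs} \ {c} = {x | x ∈ b :: cs} := by
      ext x
      simp only [Set.mem_sdiff, Set.mem_ofPred_eq, List.mem_cons, Set.mem_singleton_iff]
      constructor
      · tauto
      · rintro (rfl | hx)
        · exact ⟨.inl rfl, hn.1.1⟩
        · exact ⟨.inr (.inr hx), by rintro rfl; exact hn.2.1 hx⟩
    have hN : ∀ z ∈ {x | x ∈ b :: c :: cs}, G.Adj c z → z = b := by
      intro z hz hcz
      rcases List.mem_cons.1 hz with rfl | hz
      · rfl
      · rcases List.mem_cons.1 hz with rfl | hz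
        · exact absurd hcz (G.loopless.irrefl _)
        · exact absurd hcz (h z hz)
    have hbc : G.Adj b c := by
      obtain ⟨-, h1⟩ := (hc c (by simp)).symm
      rcases Relation.ReflTransGen.cases_head h1 with h2 | ⟨d, hd, -⟩
      · exact absurd h2.symm hn.1.1
      · exact (hN d hd.2 hd.1) ▸ hd.1.symm
    obtain ⟨op, hb, hr, ho⟩ := ih (by simp [hn]) (fun y hy => by
      rw [← hset]
      exact (hc y (by simp [hy])).diff_singleton (u := b) (by simp) hn.1.1
        (fun z hz hcz => .inl (hN z hz hcz)) hn.1.1 (by rintro rfl; exact hn.2.1 hy))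
    let op' : V → LeafKind := fun x => if x = c then .before else op x
    have hop : ∀ x ∈ cs, op x = op' x := fun x hx => by
      have : x ≠ c := by rintro rfl; exact hn.2.1 hx
      simp [op', this]
    have hopb : op' b = op b := by simp [op', hn.1.1]
    have hopc : op' c = .before := by simp [op']
    have hr' := hr.congr (op' := op') (by rw [hopb]) hop
    refine ⟨op', hopb ▸ hb, ?_, ?_, ho.congr hop⟩
    · intro t ht
      rcases List.mem_cons.1 ht with rfl | ht
      · rw [hopb, hopc]
        refine iff_of_true hbc ⟨hb, fun u hu => ?_, by simp⟩
        rcases List.pair_sublist_cons.1 hu with hu | ⟨-, hu⟩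
        · exact absurd (hu.subset (by simp)) hn.2.1
        · exact absurd hu hn.2.1
      · rw [hr' t ht]
        refine and_congr_right fun _ => and_congr_left fun _ => ⟨fun h u hu => ?_,
          fun h u hu => h u (hu.cons c)⟩
        rcases List.pair_sublist_cons.1 hu with hu | ⟨rfl, -⟩
        · exact h u hu
        · simp [hopc]
    · intro t ht
      exact iff_of_false (h t ht) fun h => h.1 hopc
  | @shift b c cs h hs ih =>
    simp only [List.nodup_cons, List.mem_cons, not_or] at hn
    have hset : {x | x ∈ b :: c :: cs} \ {b} = {x | x ∈ c :: cs} := by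
      ext x
      simp only [Set.mem_sdiff, Set.mem_ofPred_eq, List.mem_cons, Set.mem_singleton_iff]
      constructor
      · tauto
      · rintro (rfl | hx)
        · exact ⟨.inr (.inl rfl), Ne.symm hn.1.1⟩
        · exact ⟨.inr (.inr hx), by rintro rfl; exact hn.1.2 hx⟩
    have hN : ∀ z ∈ {x | x ∈ b :: c :: cs}, G.Adj b z → z = c := by
      intro z hz hcz
      rcases List.mem_cons.1 hz with rfl | hz
      · exact absurd hcz (G.loopless.irrefl _)
      · rcases List.mem_cons.1 hz with rfl | hz
        · rfl
        · exact absurd hcz (h z hz)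
    have hbc : G.Adj b c := by
      obtain ⟨-, h1⟩ := hc c (by simp)
      rcases Relation.ReflTransGen.cases_head h1 with h2 | ⟨d, hd, -⟩
      · exact absurd h2 hn.1.1
      · exact (hN d hd.2 hd.1) ▸ hd.1
    obtain ⟨op, hb, hr, ho⟩ := ih (by simp [hn]) (fun y hy => by
      rw [← hset]
      exact ((hc c (by simp)).symm.trans (hc y (by simp [hy]))).diff_singleton (u := c) (by simp)
        (Ne.symm hn.1.1) (fun z hz hcz => .inl (hN z hz hcz)) (Ne.symm hn.1.1)
        (by rintro rfl; exact hn.1.2 hy))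
    let op' : V → LeafKind := fun x => if x = c then .centre else if x = b then .clique else op x
    have hop : ∀ x ∈ cs, op x = op' x := fun x hx => by
      have h1 : x ≠ c := by rintro rfl; exact hn.2.1 hx
      have h2 : x ≠ b := by rintro rfl; exact hn.1.2 hx
      simp [op', h1, h2]
    have hopb : op' b = .clique := by simp [op', hn.1.1]
    have hopc : op' c = .centre := by simp [op']
    refine ⟨op', by simp [hopb], ?_, hr.congr (by simp [hopc, hb]) hop, ho.congr hop⟩
    intro t ht
    rcases List.mem_cons.1 ht with rfl | ht
    · rw [hopb, hopc]
      refine iff_of_true hbc ⟨by simp, fun u hu => ?_, by simp⟩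
      rcases List.pair_sublist_cons.1 hu with hu | ⟨-, hu⟩
      · exact absurd (hu.subset (by simp)) hn.2.1
      · exact absurd hu hn.2.1
    · refine iff_of_false (h t ht) fun h => ?_
      exact h.2.1 c (List.pair_sublist_cons.2 (.inr ⟨rfl, ht⟩)) hopc

theorem Spells.adj_iff [DecidableEq V] {op : V → LeafKind} {l : List V} (h : G.Spells op l)
    (hn : l.Nodup) : ∀ x ∈ l, ∀ y ∈ l, l.idxOf x < l.idxOf y →
      (G.Adj x y ↔ op x ≠ .before ∧
        (∀ u ∈ l, l.idxOf x < l.idxOf u → l.idxOf u < l.idxOf y → op u ≠ .centre) ∧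
        op y ≠ .after) := by
  induction l with
  | nil => simp
  | cons s l ih =>
    obtain ⟨hs, hl⟩ := List.nodup_cons.1 hn
    have hidx : ∀ x ∈ l, (s :: l).idxOf x = l.idxOf x + 1 := fun x hx =>
      List.idxOf_cons_ne _ (by rintro rfl; exact hs hx)
    have hpw := hl.pairwise_idxOf_lt
    intro x hx y hy hxy
    obtain ⟨hy0, hyl⟩ : y ≠ s ∧ y ∈ l := by
      rcases List.mem_cons.1 hy with rfl | hyl
      · simp at hxy
      · exact ⟨by rintro rfl; exact hs hyl, hyl⟩
    rcases List.mem_cons.1 hx with rfl | hx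
    · rw [h.1 y hyl]
      refine and_congr_right fun _ => and_congr_left fun _ => ⟨fun h u hu h1 h2 => ?_,
        fun h u hu => ?_⟩
      · rcases List.mem_cons.1 hu with rfl | hu
        · exact absurd h1 (lt_irrefl _)
        · rw [hidx u hu, hidx y hyl] at h2
          exact h u (List.sublist_pair_of_lt hpw hu hyl (by omega))
      · have hul : u ∈ l := hu.subset (by simp)
        have h3 : l.idxOf u < l.idxOf y := by simpa using hpw.sublist hu
        refine h u (by simp [hul]) ?_ ?_
        · rw [hidx u hul, List.idxOf_cons_self]
          omega
        · rw [hidx u hul, hidx y hyl]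
          omega
    · rw [ih h.2 hl x hx y hyl (by rw [hidx x hx, hidx y hyl] at hxy; omega)]
      refine and_congr_right fun _ => and_congr_left fun _ => ⟨fun h u hu h1 h2 => ?_,
        fun h u hu h1 h2 => ?_⟩
      · rcases List.mem_cons.1 hu with rfl | hu
        · simp at h1
        · rw [hidx u hu, hidx x hx] at h1
          rw [hidx u hu, hidx y hyl] at h2
          exact h u hu (by omega) (by omega)
      · refine h u (by simp [hu]) ?_ ?_
        · rw [hidx u hu, hidx x hx]
          omega
        · rw [hidx u hu, hidx y hyl]
          omega

end SimpleGraph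

/-- A word that describes a graph on `V`: the vertices are the positions in the word. The first two
and the last two letters merge. -/
structure LeafWord (V : Type u) where
  pos : V → ℕ
  length : ℕ
  kind : ℕ → LeafKind
  inj : Function.Injective pos
  pos_lt : ∀ v, pos v < length
  exists_pos : ∀ t < length, ∃ v, pos v = t
  three_le : 3 ≤ length
  merges_first : (kind 0).Merges (kind 1)
  merges_last : (kind (length - 2)).Merges (kind (length - 1))
  first_ne : kind 0 ≠ .before
  last_ne : kind (length - 1) ≠ .after

/-- The word `W` describes the graph `G`. -/
def LeafWord.Describes {V : Type u} (W : LeafWord V) (G : SimpleGraph V) : Prop :=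
  ∀ x y, W.pos x < W.pos y → (G.Adj x y ↔ W.kind (W.pos x) ≠ .before ∧
    (∀ t, W.pos x < t → t < W.pos y → W.kind t ≠ .centre) ∧ W.kind (W.pos y) ≠ .after)

/-- The first letter matters only through not being `before`, the last only through not being
`after`. They can thus be rechosen to merge with their neighbours, which gives the end nodes two
leaves each. That the last letter of a thread is not `after` comes from its vertex having an earlier
neighbour. -/
theorem SimpleGraph.IsThreadOf.exists_leafWord {V : Type u} [Finite V] {G : SimpleGraph V}
    {b : V} {cs : List V} (h : G.IsThreadOf Set.univ b cs) (hc : G.Connected)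
    (h3 : 3 ≤ Nat.card V) : ∃ W : LeafWord V, W.Describes G := by
  classical
  obtain ⟨op, hb, hs⟩ := h.2.2.exists_spells h.1 fun y _ =>
    (hc.preconnected b y).connIn_univ.mono fun x _ => (h.2.1 x).2 trivial
  have hmem : ∀ x, x ∈ b :: cs := fun x => (h.2.1 x).2 trivial
  have hadj := hs.adj_iff h.1
  have hb0 : (b :: cs).idxOf b = 0 := List.idxOf_cons_self
  have hn := h.1
  generalize b :: cs = l at *
  have hinj : Function.Injective fun v => l.idxOf v := fun v w hvw =>
    (List.idxOf_inj (hmem v)).1 hvw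
  have hlt : ∀ v, l.idxOf v < l.length := fun v => List.idxOf_lt_length_of_mem (hmem v)
  have hex : ∀ t < l.length, ∃ v, l.idxOf v = t := fun t ht => ⟨l[t], hn.idxOf_getElem t ht⟩
  have hlen : 3 ≤ l.length := by
    have : Fintype V := Fintype.ofFinite V
    rw [Nat.card_eq_fintype_card] at h3
    rwa [← List.toFinset_card_of_nodup hn,
      Finset.eq_univ_iff_forall.2 fun x => List.mem_toFinset.2 (hmem x), Finset.card_univ]
  obtain ⟨o, ho⟩ : ∃ o : ℕ → LeafKind, ∀ v, o (l.idxOf v) = op v :=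
    ⟨Function.extend (fun v => l.idxOf v) op fun _ => .clique, fun v => hinj.extend_apply op _ v⟩
  have hlast : ∀ v, l.idxOf v = l.length - 1 → op v ≠ .after := by
    intro v hv
    have : Nontrivial V := (Finite.one_lt_card_iff_nontrivial).1 (by omega)
    obtain ⟨w, hw⟩ := hc.preconnected.exists_adj_of_nontrivial v
    have h1 : l.idxOf w < l.idxOf v := by
      have h2 := hlt w
      have h3 : l.idxOf w ≠ l.idxOf v := fun e => hw.ne (hinj e).symm
      omega
    exact ((hadj w (hmem w) v (hmem v) h1).1 hw.symm).2.2
  obtain ⟨k, hk0, hk0'⟩ : ∃ k : LeafKind, k.Merges (o 1) ∧ k ≠ .before :=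
    match o 1 with
    | .clique => ⟨.clique, trivial, by simp⟩
    | .before => ⟨.centre, trivial, by simp⟩
    | .centre => ⟨.after, trivial, by simp⟩
    | .after => ⟨.after, trivial, by simp⟩
  obtain ⟨k', hk', hk1'⟩ : ∃ k : LeafKind, (o (l.length - 2)).Merges k ∧ k ≠ .after :=
    match o (l.length - 2) with
    | .clique => ⟨.clique, trivial, by simp⟩
    | .before => ⟨.before, trivial, by simp⟩
    | .centre => ⟨.before, trivial, by simp⟩
    | .after => ⟨.centre, trivial, by simp⟩
  obtain ⟨κ, hκ0, hκl, hκ⟩ : ∃ κ : ℕ → LeafKind, κ 0 = k ∧ κ (l.length - 1) = k' ∧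
      ∀ t, t ≠ 0 → t ≠ l.length - 1 → κ t = o t := by
    refine ⟨fun t => if t = 0 then k else if t = l.length - 1 then k' else o t, by simp, ?_,
      fun t h1 h2 => by simp [h1, h2]⟩
    simp only [if_pos]
    rw [if_neg (by omega)]
  refine ⟨⟨fun v => l.idxOf v, l.length, κ, hinj, hlt, hex, hlen,
    by rwa [hκ0, hκ 1 (by omega) (by omega)],
    by rwa [hκl, hκ (l.length - 2) (by omega) (by omega)], by rwa [hκ0], by rwa [hκl]⟩, ?_⟩
  intro x y hxy
  dsimp only at hxy ⊢
  rw [hadj x (hmem x) y (hmem y) hxy]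
  have hy := hlt y
  refine and_congr ?_ (and_congr ?_ ?_)
  · by_cases h1 : l.idxOf x = 0
    · rw [h1, hκ0]
      obtain rfl : x = b := hinj (h1.trans hb0.symm)
      exact iff_of_true hb hk0'
    · rw [hκ _ h1 (by omega), ho]
  · constructor
    · intro h1 t ht ht'
      obtain ⟨u, rfl⟩ := hex t (by omega)
      rw [hκ _ (by omega) (by omega), ho]
      exact h1 u (hmem u) ht ht'
    · intro h1 u hu ht ht'
      have h2 := h1 _ ht ht'
      rwa [hκ _ (by omega) (by omega), ho] at h2
  · by_cases h1 : l.idxOf y = l.length - 1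
    · rw [h1, hκl]
      exact iff_of_true (hlast y h1) hk1'
    · rw [hκ _ (by omega) h1, ho]

namespace SimpleGraph

/-- A graph is acyclic if every vertex has at most one neighbour that is not of larger rank. -/
theorem isAcyclic_of_rank {α : Type*} {G : SimpleGraph α} (r : α → ℕ)
    (h : ∀ v u u', G.Adj v u → G.Adj v u' → r u ≤ r v → r u' ≤ r v → u = u') : G.IsAcyclic := by
  classical
  intro v c hc
  -- On a cycle, a vertex of maximal rank has two different neighbours of no larger rank.
  obtain ⟨m, hm, hmax⟩ := c.support.toFinset.exists_max_image r ⟨v, by simp⟩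
  rw [List.mem_toFinset] at hm
  have hc' := hc.rotate hm
  refine hc'.snd_ne_penultimate (h m _ _ (Walk.adj_snd hc'.not_nil)
    (Walk.adj_penultimate hc'.not_nil).symm (hmax _ ?_) (hmax _ ?_))
  · rw [List.mem_toFinset, ← c.mem_support_rotate_iff m hm]
    exact Walk.getVert_mem_support _ _
  · rw [List.mem_toFinset, ← c.mem_support_rotate_iff m hm]
    exact Walk.getVert_mem_support _ _

end SimpleGraph

theorem Set.three_le_encard_of_mem {α : Type*} {s : Set α} {x y z : α} (hx : x ∈ s) (hy : y ∈ s)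
    (hz : z ∈ s) (hxy : x ≠ y) (hxz : x ≠ z) (hyz : y ≠ z) : 3 ≤ s.encard := by
  rw [← Set.encard_eq_three.2 ⟨x, y, z, hxy, hxz, hyz, rfl⟩]
  refine Set.encard_le_encard ?_
  rintro w (rfl | rfl | rfl) <;> assumption

namespace LeafKind

/-- A leaf of the second kind may come later than a leaf of the first kind at the same node. -/
def Precedes : LeafKind → LeafKind → Prop
  | clique, clique => True
  | after, after => True
  | after, centre => True
  | after, before => True
  | centre, before => True
  | before, before => True
  | _, _ => False

theorem Merges.precedes {k k' : LeafKind} (h : k.Merges k') : k.Precedes k' := by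
  cases k <;> cases k' <;> simp_all [Merges, Precedes]

theorem Precedes.trans {k k' k'' : LeafKind} (h : k.Precedes k') (h' : k'.Precedes k'') :
    k.Precedes k'' := by
  cases k <;> cases k' <;> cases k'' <;> simp_all [Precedes]

end LeafKind

namespace LeafWord

open Sum SimpleGraph

variable {V : Type u} (W : LeafWord V)

/-! ### The runs of a word -/

open Classical in
/-- The number of the run to which a position belongs: maximal segments of letters that merge with
their successors. -/
noncomputable def run : ℕ → ℕ
  | 0 => 0
  | t + 1 => run t + if (W.kind t).Merges (W.kind (t + 1)) then 0 else 1

theorem run_succ_of_merges {t : ℕ} (h : (W.kind t).Merges (W.kind (t + 1))) :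
    W.run (t + 1) = W.run t := by
  rw [run, if_pos h, add_zero]

theorem run_succ_of_not_merges {t : ℕ} (h : ¬ (W.kind t).Merges (W.kind (t + 1))) :
    W.run (t + 1) = W.run t + 1 := by
  rw [run, if_neg h]

theorem run_mono : Monotone W.run := by
  refine monotone_nat_of_le_succ fun t => ?_
  rw [run]
  exact Nat.le_add_right _ _

theorem merges_of_run_eq {t : ℕ} (h : W.run t = W.run (t + 1)) :
    (W.kind t).Merges (W.kind (t + 1)) := by
  by_contra hcon
  rw [W.run_succ_of_not_merges hcon] at h
  omega

theorem exists_run_eq {i T : ℕ} (h : i ≤ W.run T) : ∃ t ≤ T, W.run t = i := by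
  induction T with
  | zero => exact ⟨0, le_rfl, (Nat.le_zero.1 h).symm⟩
  | succ T ih =>
    by_cases hi : i ≤ W.run T
    · obtain ⟨t, ht, hti⟩ := ih hi
      exact ⟨t, ht.trans T.le_succ, hti⟩
    · refine ⟨T + 1, le_rfl, le_antisymm ?_ h⟩
      by_cases hm : (W.kind T).Merges (W.kind (T + 1))
      · rw [W.run_succ_of_merges hm]
        omega
      · rw [W.run_succ_of_not_merges hm]
        omega

theorem exists_boundary {i T : ℕ} (h : i < W.run T) :
    ∃ t < T, W.run t = i ∧ W.run (t + 1) = i + 1 := by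
  induction T with
  | zero => exact absurd h (Nat.not_lt_zero _)
  | succ T ih =>
    by_cases hi : i < W.run T
    · obtain ⟨t, ht, hti⟩ := ih hi
      exact ⟨t, ht.trans T.lt_succ_self, hti⟩
    · by_cases hm : (W.kind T).Merges (W.kind (T + 1))
      · rw [W.run_succ_of_merges hm] at h
        exact absurd h hi
      · have h1 := W.run_succ_of_not_merges hm
        exact ⟨T, T.lt_succ_self, by omega, by omega⟩

theorem precedes {s t : ℕ} (hst : s < t) (h : W.run s = W.run t) :
    (W.kind s).Precedes (W.kind t) := by
  induction t, hst using Nat.le_induction with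
  | base => exact (W.merges_of_run_eq h).precedes
  | succ t hst ih =>
    have h1 := W.run_mono (Nat.le_of_succ_le hst)
    have h2 : W.run t ≤ W.run (t + 1) := W.run_mono t.le_succ
    exact (ih (by omega)).trans (W.merges_of_run_eq (by omega)).precedes

/-- The letters `after` and `before` do not merge directly; a run can pass from one to the other
only through a `centre`. -/
theorem exists_centre {s t : ℕ} (hst : s < t) (h : W.run s = W.run t) (hs : W.kind s = .after)
    (ht : W.kind t = .before) : ∃ u < t, W.run u = W.run t ∧ W.kind u = .centre := by
  induction t, hst using Nat.le_induction with
  | base =>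
    have h1 := W.merges_of_run_eq h
    rw [hs, ht] at h1
    exact h1.elim
  | succ t hst ih =>
    have h1 := W.run_mono (Nat.le_of_succ_le hst)
    have h2 : W.run t ≤ W.run (t + 1) := W.run_mono t.le_succ
    have h3 : W.run t = W.run (t + 1) := by omega
    have h4 := W.merges_of_run_eq h3
    rw [ht] at h4
    by_cases hc : W.kind t = .centre
    · exact ⟨t, t.lt_succ_self, h3, hc⟩
    · obtain ⟨u, hu, hu', hk⟩ := ih (by omega) (by
        revert h4 hc
        cases W.kind t <;> simp [LeafKind.Merges])
      exact ⟨u, hu.trans t.lt_succ_self, hu'.trans h3, hk⟩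

/-! ### The graph-labelled tree of a word -/

/-- The number of the last run. -/
noncomputable def lastRun : ℕ := W.run (W.length - 1)

theorem run_le {t : ℕ} (h : t < W.length) : W.run t ≤ W.lastRun :=
  W.run_mono (Nat.le_sub_one_of_lt h)

theorem run_one : W.run 1 = 0 := W.run_succ_of_merges W.merges_first

theorem run_length_sub_two : W.run (W.length - 2) = W.lastRun := by
  have h := W.three_le
  obtain ⟨n, hn⟩ : ∃ n, W.length = n + 2 := ⟨W.length - 2, by omega⟩
  have h1 := W.merges_last
  unfold lastRun
  rw [hn, show n + 2 - 2 = n by omega, show n + 2 - 1 = n + 1 by omega] at *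
  exact (W.run_succ_of_merges h1).symm

/-- The nodes: one for each run. -/
def Index : Type u := ULift.{u} (Fin (W.lastRun + 1))

/-- The number of a node. -/
def rank (n : W.Index) : ℕ := (ULift.down n).val

theorem rank_le (n : W.Index) : W.rank n ≤ W.lastRun := Nat.lt_succ_iff.1 (ULift.down n).isLt

theorem rank_injective : Function.Injective W.rank := fun _ _ h =>
  ULift.down_injective (Fin.val_injective h)

theorem exists_rank_eq {k : ℕ} (h : k ≤ W.lastRun) : ∃ n, W.rank n = k :=
  ⟨ULift.up ⟨k, Nat.lt_succ_iff.2 h⟩, rfl⟩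

/-- The caterpillar whose nodes are the runs, and whose leaves are the letters. -/
def caterpillar : SimpleGraph (V ⊕ W.Index) where
  Adj
    | inl _, inl _ => False
    | inl v, inr n => W.run (W.pos v) = W.rank n
    | inr n, inl v => W.run (W.pos v) = W.rank n
    | inr m, inr n => W.rank m + 1 = W.rank n ∨ W.rank n + 1 = W.rank m
  symm := ⟨by
    rintro (v | m) (w | n) h
    · exact h
    · exact h
    · exact h
    · exact Or.symm h⟩
  loopless := ⟨by
    rintro (v | m) h
    · exact h
    · rcases h with h | h <;> omega⟩

theorem caterpillar_adj_leaf {n : W.Index} {v : V} :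
    W.caterpillar.Adj (inr n) (inl v) ↔ W.run (W.pos v) = W.rank n := Iff.rfl

theorem caterpillar_adj_node {m n : W.Index} :
    W.caterpillar.Adj (inr m) (inr n) ↔ W.rank m + 1 = W.rank n ∨ W.rank n + 1 = W.rank m :=
  Iff.rfl

theorem exists_node (v : V) : ∃ n, W.run (W.pos v) = W.rank n := by
  obtain ⟨n, hn⟩ := W.exists_rank_eq (W.run_le (W.pos_lt v))
  exact ⟨n, hn.symm⟩

/-- Acyclicity uses ranks: leaves are placed above all nodes, so a leaf sees only its node, and the
only neighbour of a node that is not of larger rank is the preceding node. -/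
theorem isTree_caterpillar : W.caterpillar.IsTree := by
  refine ⟨?_, ?_⟩
  · obtain ⟨n₀, hn₀⟩ := W.exists_rank_eq (Nat.zero_le W.lastRun)
    have hnode : ∀ k n, W.rank n = k → W.caterpillar.Reachable (inr n) (inr n₀) := by
      intro k
      induction k with
      | zero =>
        intro n hn
        obtain rfl := W.rank_injective (hn.trans hn₀.symm)
        exact .rfl
      | succ k ih =>
        intro n hn
        obtain ⟨m, hm⟩ := W.exists_rank_eq (k := k) (by have := W.rank_le n; omega)
        exact (Adj.reachable (W.caterpillar_adj_node.2 (.inr (by omega)))).trans (ih m hm)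
    have hall : ∀ z, W.caterpillar.Reachable z (inr n₀) := by
      rintro (v | n)
      · obtain ⟨n, hn⟩ := W.exists_node v
        exact (Adj.reachable (Adj.symm (W.caterpillar_adj_leaf.2 hn))).trans (hnode _ n rfl)
      · exact hnode _ n rfl
    exact { preconnected := fun z z' => (hall z).trans (hall z').symm, nonempty := ⟨inr n₀⟩ }
  · refine isAcyclic_of_rank (Sum.elim (fun _ => W.lastRun + 1) W.rank) ?_
    rintro (v | n) (u | m) (u' | m') h h' hle hle'
    · exact h.elim
    · exact h.elim
    · exact h'.elim
    · exact congrArg inr (W.rank_injective (Eq.trans (Eq.symm h) h'))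
    · have := W.rank_le n
      simp only [elim_inl, elim_inr] at hle
      omega
    · have := W.rank_le n
      simp only [elim_inl, elim_inr] at hle
      omega
    · have := W.rank_le n
      simp only [elim_inl, elim_inr] at hle'
      omega
    · simp only [elim_inr] at hle hle'
      rw [caterpillar_adj_node] at h h'
      exact congrArg inr (W.rank_injective (by omega))

/-- An inner run has a letter and two neighbouring runs. The first and last runs have two letters,
because the end letters merge, and a neighbouring run. A single run has at least three letters. -/
theorem three_le_degree_caterpillar (n : W.Index) :
    3 ≤ (W.caterpillar.neighborSet (inr n)).encard := by
  have hlen := W.three_le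
  have hn := W.rank_le n
  have hleaf : ∀ t < W.length, W.run t = W.rank n →
      ∃ v, W.pos v = t ∧ inl v ∈ W.caterpillar.neighborSet (inr n) := by
    intro t ht htn
    obtain ⟨v, rfl⟩ := W.exists_pos t ht
    exact ⟨v, rfl, htn⟩
  have hne : ∀ v w : V, W.pos v ≠ W.pos w → (inl v : V ⊕ W.Index) ≠ inl w := by
    rintro v w h e
    exact h (congrArg W.pos (inl_injective e))
  by_cases h0 : W.rank n = 0
  · obtain ⟨v, hv, hv'⟩ := hleaf 0 (by omega) (by rw [h0, run])
    obtain ⟨w, hw, hw'⟩ := hleaf 1 (by omega) (by rw [h0, run_one])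
    by_cases h1 : W.lastRun = 0
    · obtain ⟨x, hx, hx'⟩ := hleaf 2 (by omega) (by
        have := W.run_le (t := 2) (by omega)
        omega)
      exact Set.three_le_encard_of_mem hv' hw' hx' (hne _ _ (by omega)) (hne _ _ (by omega))
        (hne _ _ (by omega))
    · obtain ⟨m, hm⟩ := W.exists_rank_eq (k := 1) (by omega)
      exact Set.three_le_encard_of_mem hv' hw'
        (show inr m ∈ _ from W.caterpillar_adj_node.2 (.inl (by omega)))
        (hne _ _ (by omega)) (by simp) (by simp)
  · obtain ⟨m, hm⟩ := W.exists_rank_eq (k := W.rank n - 1) (by omega)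
    have hm' : inr m ∈ W.caterpillar.neighborSet (inr n) :=
      W.caterpillar_adj_node.2 (.inr (by omega))
    by_cases h1 : W.rank n = W.lastRun
    · obtain ⟨v, hv, hv'⟩ := hleaf (W.length - 2) (by omega) (by rw [h1, run_length_sub_two])
      obtain ⟨w, hw, hw'⟩ := hleaf (W.length - 1) (by omega) (by rw [h1, lastRun])
      exact Set.three_le_encard_of_mem hv' hw' hm' (hne _ _ (by omega)) (by simp) (by simp)
    · obtain ⟨m', h2⟩ := W.exists_rank_eq (k := W.rank n + 1) (by omega)
      obtain ⟨t, ht, htn⟩ := W.exists_run_eq (show W.rank n ≤ W.run (W.length - 1) from hn)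
      obtain ⟨v, hv, hv'⟩ := hleaf t (by omega) htn
      refine Set.three_le_encard_of_mem hv' hm'
        (show inr m' ∈ _ from W.caterpillar_adj_node.2 (.inl h2.symm)) (by simp) (by simp) ?_
      intro e
      obtain rfl := inr_injective e
      omega

/-- The place of a marker in the word, seen from a node. -/
def place (n : W.Index) : V ⊕ W.Index → ℕ
  | inl v => W.pos v + 1
  | inr m => if W.rank m < W.rank n then 0 else W.length + 1

/-- A marker which is not a leaf whose neighbours all come before it. -/
def IsSource : V ⊕ W.Index → Prop
  | inl v => W.kind (W.pos v) ≠ .before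
  | inr _ => True

/-- A marker which is not a leaf whose neighbours all come after it. -/
def IsTarget : V ⊕ W.Index → Prop
  | inl v => W.kind (W.pos v) ≠ .after
  | inr _ => True

/-- The edges of the label of a node, from left to right. -/
structure Arc (n : W.Index) (w w' : V ⊕ W.Index) : Prop where
  lt : W.place n w < W.place n w'
  isSource : W.IsSource w
  isTarget : W.IsTarget w'
  ne_centre : ∀ t < W.length, W.run t = W.rank n → W.place n w < t + 1 → t + 1 < W.place n w' →
    W.kind t ≠ .centre

/-- The graph-labelled tree of a word. -/
abbrev decomposition : GraphLabelledTree V where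
  Node := W.Index
  finite_node := inferInstanceAs (Finite (ULift.{u} (Fin (W.lastRun + 1))))
  tree := W.caterpillar
  isTree := W.isTree_caterpillar
  leaf_degree v := by
    obtain ⟨n, hn⟩ := W.exists_node v
    refine Set.encard_eq_one.2 ⟨inr n, ?_⟩
    ext (w | m)
    · exact iff_of_false (fun h => h) (by simp)
    · refine ⟨fun h => congrArg inr (W.rank_injective (Eq.trans (Eq.symm h) hn)), fun h => ?_⟩
      obtain rfl := inr_injective h
      exact hn
  node_degree n := le_trans (by norm_num) (W.three_le_degree_caterpillar n)
  label n :=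
    { Adj := fun w w' => W.Arc n w w' ∨ W.Arc n w' w
      symm := ⟨fun _ _ h => h.symm⟩
      loopless := ⟨fun _ h => lt_irrefl _ (h.elim Arc.lt Arc.lt)⟩ }

end LeafWord

namespace LeafWord

open Sum SimpleGraph

variable {V : Type u} (W : LeafWord V)

theorem isRank_decomposition : W.decomposition.IsRank W.rank where
  inj := W.rank_injective
  adj_iff _ _ := Iff.rfl
  exists_pred m k h := W.exists_rank_eq (by have := W.rank_le m; omega)

theorem place_leaf (n : W.Index) (v : V) : W.place n (inl v) = W.pos v + 1 := rfl

theorem place_before {n m : W.Index} (h : W.rank m < W.rank n) : W.place n (inr m) = 0 :=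
  if_pos h

theorem place_after {n m : W.Index} (h : W.rank n < W.rank m) :
    W.place n (inr m) = W.length + 1 :=
  if_neg h.not_gt

theorem lab_iff_arc {n : W.decomposition.Node} {w w' : V ⊕ W.decomposition.Node}
    (hw : W.decomposition.tree.Adj (inr n) w) (hw' : W.decomposition.tree.Adj (inr n) w')
    (h : W.place n w < W.place n w') : W.decomposition.Lab n w w' ↔ W.Arc n w w' := by
  constructor
  · rintro ⟨h1, h2, h3⟩
    exact Or.resolve_right h3 fun h4 => h.not_gt h4.lt
  · exact fun h1 => ⟨hw, hw', .inl h1⟩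

theorem place_injective {n : W.Index} {w w' : V ⊕ W.Index} (hw : W.caterpillar.Adj (inr n) w)
    (hw' : W.caterpillar.Adj (inr n) w') (h : W.place n w = W.place n w') : w = w' := by
  rcases w with v | m <;> rcases w' with v' | m'
  · rw [place_leaf, place_leaf] at h
    exact congrArg inl (W.inj (by omega))
  · have := W.pos_lt v
    rw [place_leaf, place] at h
    split_ifs at h
    omega
  · have := W.pos_lt v'
    rw [place_leaf, place] at h
    split_ifs at h
    omega
  · rw [caterpillar_adj_node] at hw hw'
    rw [place, place] at h
    refine congrArg inr (W.rank_injective ?_)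
    split_ifs at h <;> omega

/-! ### Accessibility -/

/-- Each node between `n` and the node of `y` is crossed from its preceding to its following marker,
which is possible exactly when its run contains no `centre`. At the node of `y` itself, only the
letters left of `y` and the letter of `y` count. The number `k` is how many nodes follow `m` up to
that node. -/
theorem reach_up_iff {y : V} (k : ℕ) : ∀ {n m : W.decomposition.Node}, W.rank n + 1 = W.rank m →
    W.run (W.pos y) = W.rank m + k → (W.decomposition.Reach n (inr m) y ↔
      W.kind (W.pos y) ≠ .after ∧
        ∀ t, W.rank n < W.run t → t < W.pos y → W.kind t ≠ .centre) := by
  have hylt := W.pos_lt y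
  induction k with
  | zero =>
    intro n m hnm hy
    have hnm' : W.decomposition.tree.Adj (inr n) (inr m) := .inl hnm
    have hym : W.decomposition.tree.Adj (inr m) (inl y) := hy
    have hp : W.place m (inr n) = 0 := W.place_before (by omega)
    rw [GraphLabelledTree.reach_node_iff hnm' (.leaf hym),
      GraphLabelledTree.reach_leaf_iff hym,
      W.lab_iff_arc hnm'.symm hym (by rw [hp, place_leaf]; omega)]
    constructor
    · rintro ⟨h, -⟩
      refine ⟨h.isTarget, fun t ht hty => h.ne_centre t (by omega) ?_ (by rw [hp]; omega)
        (by rw [place_leaf]; omega)⟩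
      have := W.run_mono hty.le
      omega
    · rintro ⟨h1, h2⟩
      exact ⟨⟨by rw [hp, place_leaf]; omega, trivial, h1, fun t _ ht _ ht' =>
        h2 t (by omega) (by rw [place_leaf] at ht'; omega)⟩, rfl⟩
  | succ k ih =>
    intro n m hnm hy
    have hle := W.run_le hylt
    obtain ⟨m', hm'⟩ := W.exists_rank_eq (k := W.rank m + 1) (by omega)
    obtain ⟨n', hn'⟩ := W.exists_node y
    have hnm' : W.decomposition.tree.Adj (inr n) (inr m) := .inl hnm
    have hmm' : W.decomposition.tree.Adj (inr m) (inr m') := .inl hm'.symm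
    have hp : W.place m (inr n) = 0 := W.place_before (by omega)
    have hp' : W.place m (inr m') = W.length + 1 := W.place_after (by omega)
    rw [GraphLabelledTree.reach_node_iff hnm'
        (W.isRank_decomposition.branch_up (n' := n') hn' hm'.symm (by omega)),
      ih hm'.symm (by omega), W.lab_iff_arc hnm'.symm hmm' (by rw [hp, hp']; omega)]
    constructor
    · rintro ⟨h, h1, h2⟩
      refine ⟨h1, fun t ht hty => ?_⟩
      by_cases htm : W.run t = W.rank m
      · exact h.ne_centre t (by omega) htm (by rw [hp]; omega) (by rw [hp']; omega)
      · exact h2 t (by omega) hty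
    · rintro ⟨h1, h2⟩
      refine ⟨⟨by rw [hp, hp']; omega, trivial, trivial, fun t htl ht _ _ =>
        h2 t (by omega) ?_⟩, h1, fun t ht => h2 t (by omega)⟩
      by_contra hcon
      have := W.run_mono (not_lt.1 hcon)
      omega

/-- Between letters of one run, the label applies the rule of the word directly. Otherwise the
condition that no `centre` lies in between splits into the part inside the run of `x`, checked by
its label, and the part beyond it, given by `reach_up_iff`. -/
theorem accessibilityGraph_decomposition {G : SimpleGraph V} (hW : W.Describes G) :
    W.decomposition.accessibilityGraph = G := by
  have key : ∀ x y, W.pos x < W.pos y → (W.decomposition.accessibilityGraph.Adj x y ↔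
      G.Adj x y) := by
    intro x y hxy
    have hylt := W.pos_lt y
    rw [hW x y hxy]
    obtain ⟨n, hn⟩ := W.exists_node x
    obtain ⟨n', hn'⟩ := W.exists_node y
    have hx : W.decomposition.tree.Adj (inr n) (inl x) := hn
    rcases (W.run_mono hxy.le).eq_or_lt with he | hlt
    · have hy : W.decomposition.tree.Adj (inr n) (inl y) := he.symm.trans hn
      rw [GraphLabelledTree.Branch.adj_iff (.leaf hx) (.leaf hy)
          (fun e => hxy.ne (congrArg W.pos (inl_injective e))),
        GraphLabelledTree.reach_leaf_iff hx, GraphLabelledTree.reach_leaf_iff hy,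
        W.lab_iff_arc hx hy (by rw [place_leaf, place_leaf]; omega)]
      constructor
      · rintro ⟨-, h, -⟩
        refine ⟨h.isSource, fun t ht ht' => h.ne_centre t (by omega) ?_
          (by rw [place_leaf]; omega) (by rw [place_leaf]; omega), h.isTarget⟩
        have h1 := W.run_mono ht.le
        have h2 := W.run_mono ht'.le
        omega
      · rintro ⟨h1, h2, h3⟩
        exact ⟨rfl, ⟨by rw [place_leaf, place_leaf]; omega, h1, h3, fun t _ _ ht ht' =>
          h2 t (by rw [place_leaf] at ht; omega) (by rw [place_leaf] at ht'; omega)⟩, rfl⟩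
    · have hle := W.run_le hylt
      obtain ⟨m, hm⟩ := W.exists_rank_eq (k := W.rank n + 1) (by omega)
      have hnm : W.decomposition.tree.Adj (inr n) (inr m) := .inl hm.symm
      have hp : W.place n (inr m) = W.length + 1 := W.place_after (by omega)
      have hxlt := W.pos_lt x
      rw [GraphLabelledTree.Branch.adj_iff (.leaf hx)
          (W.isRank_decomposition.branch_up (n' := n') hn' hm.symm (by omega)) (by simp),
        GraphLabelledTree.reach_leaf_iff hx,
        W.reach_up_iff (W.run (W.pos y) - W.rank m) hm.symm (by omega),
        W.lab_iff_arc hx hnm (by rw [place_leaf, hp]; omega)]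
      constructor
      · rintro ⟨-, h, h1, h2⟩
        refine ⟨h.isSource, fun t ht ht' => ?_, h1⟩
        by_cases htn : W.run t = W.rank n
        · exact h.ne_centre t (by omega) htn (by rw [place_leaf]; omega) (by rw [hp]; omega)
        · have h3 := W.run_mono ht.le
          exact h2 t (by omega) ht'
      · rintro ⟨h1, h2, h3⟩
        refine ⟨rfl, ⟨by rw [place_leaf, hp]; omega, h1, trivial, fun t _ htn ht _ =>
          h2 t (by rw [place_leaf] at ht; omega) ?_⟩, h3, fun t ht => h2 t ?_⟩
        · by_contra hcon
          have := W.run_mono (not_lt.1 hcon)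
          omega
        · by_contra hcon
          have := W.run_mono (not_lt.1 hcon)
          omega
  ext x y
  rcases lt_trichotomy (W.pos x) (W.pos y) with h | h | h
  · exact key x y h
  · obtain rfl := W.inj h
    exact iff_of_false (SimpleGraph.irrefl _) (SimpleGraph.irrefl _)
  · rw [adj_comm, key y x h, adj_comm]

/-! ### The labels -/

theorem isCliqueNode_of_arc {n : W.decomposition.Node}
    (h : ∀ w w', W.caterpillar.Adj (inr n) w → W.caterpillar.Adj (inr n) w' →
      W.place n w < W.place n w' → W.Arc n w w') : W.decomposition.IsCliqueNode n := by
  refine SimpleGraph.ext ?_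
  ext ⟨w, hw⟩ ⟨w', hw'⟩
  constructor
  · exact fun h => h.ne
  · intro hne
    rcases lt_trichotomy (W.place n w) (W.place n w') with h1 | h1 | h1
    · exact .inl (h w w' hw hw' h1)
    · exact absurd (Subtype.ext (W.place_injective (w := w) (w' := w') hw hw' h1)) hne
    · exact .inr (h w' w hw' hw h1)

theorem isStarNode_of_arc {n : W.decomposition.Node} {z : V ⊕ W.decomposition.Node}
    (hz : W.caterpillar.Adj (inr n) z)
    (h : ∀ w w', W.caterpillar.Adj (inr n) w → W.caterpillar.Adj (inr n) w' →
      W.place n w < W.place n w' → (W.Arc n w w' ↔ w = z ∨ w' = z)) :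
    W.decomposition.IsStarNode n z := by
  refine ⟨hz, SimpleGraph.ext ?_⟩
  ext ⟨w, hw⟩ ⟨w', hw'⟩
  rw [starGraph_adj]
  change W.Arc n w w' ∨ W.Arc n w' w ↔ _
  simp only [ne_eq, Subtype.ext_iff]
  rcases lt_trichotomy (W.place n w) (W.place n w') with h1 | h1 | h1
  · rw [h w w' hw hw' h1]
    constructor
    · rintro (h2 | h2)
      · exact ⟨fun e => h1.ne (e ▸ rfl), h2⟩
      · exact absurd h2.lt h1.not_gt
    · exact fun h2 => .inl h2.2
  · exact iff_of_false (fun h2 => h2.elim (fun h2 => h2.lt.ne h1) fun h2 => h2.lt.ne' h1)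
      fun h2 => h2.1 (W.place_injective hw hw' h1)
  · rw [h w' w hw' hw h1]
    constructor
    · rintro (h2 | h2)
      · exact absurd h2.lt h1.not_gt
      · exact ⟨fun e => h1.ne (e ▸ rfl), h2.symm⟩
    · exact fun h2 => .inr h2.2.symm

/-- The four kinds of nodes. -/
inductive NodeCases (n : W.decomposition.Node) : Prop
  | clique (h : W.decomposition.IsCliqueNode n)
      (hk : ∀ t < W.length, W.run t = W.rank n → W.kind t = .clique)
  | centre (c : V) (h : W.decomposition.IsStarNode n (inl c)) (hc : W.run (W.pos c) = W.rank n)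
      (hk : W.kind (W.pos c) = .centre)
  | before (m : W.decomposition.Node) (hm : W.rank m + 1 = W.rank n)
      (h : W.decomposition.IsStarNode n (inr m))
      (hk : ∀ t < W.length, W.run t = W.rank n → W.kind t = .before)
  | after (m : W.decomposition.Node) (hm : W.rank n + 1 = W.rank m)
      (h : W.decomposition.IsStarNode n (inr m))
      (hk : ∀ t < W.length, W.run t = W.rank n → W.kind t = .after)

theorem exists_lt_run_eq (n : W.Index) : ∃ t < W.length, W.run t = W.rank n := by
  obtain ⟨t, ht, htn⟩ := W.exists_run_eq (show W.rank n ≤ W.run (W.length - 1) from W.rank_le n)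
  have := W.three_le
  exact ⟨t, by omega, htn⟩

theorem eq_of_place_pos {n : W.Index} {w : V ⊕ W.Index} (hw : W.caterpillar.Adj (inr n) w)
    (h : 0 < W.place n w) : (∃ v, w = inl v ∧ W.run (W.pos v) = W.rank n) ∨
      ∃ m, w = inr m ∧ W.rank n + 1 = W.rank m := by
  rcases w with v | m
  · exact .inl ⟨v, rfl, hw⟩
  · rcases hw with hw | hw
    · exact .inr ⟨m, rfl, hw⟩
    · rw [W.place_before (by omega)] at h
      exact absurd h (lt_irrefl _)

theorem eq_of_place_lt {n : W.Index} {w : V ⊕ W.Index} (hw : W.caterpillar.Adj (inr n) w)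
    (h : W.place n w < W.length + 1) : (∃ v, w = inl v ∧ W.run (W.pos v) = W.rank n) ∨
      ∃ m, w = inr m ∧ W.rank m + 1 = W.rank n := by
  rcases w with v | m
  · exact .inl ⟨v, rfl, hw⟩
  · rcases hw with hw | hw
    · rw [W.place_after (by omega)] at h
      exact absurd h (lt_irrefl _)
    · exact .inr ⟨m, rfl, hw⟩

theorem place_le (n : W.Index) (w : V ⊕ W.Index) : W.place n w ≤ W.length + 1 := by
  rcases w with v | m
  · have := W.pos_lt v
    rw [place_leaf]
    omega
  · rw [place]
    split_ifs <;> omega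

theorem isSource_of_lt {n : W.Index} {w : V ⊕ W.Index} {k : ℕ}
    (hw : W.caterpillar.Adj (inr n) w) (hk : W.place n w < k)
    (h : ∀ t < W.length, W.run t = W.rank n → t + 1 < k → W.kind t ≠ .before) : W.IsSource w := by
  rcases w with v | m
  · exact h _ (W.pos_lt v) hw hk
  · trivial

theorem isTarget_of_lt {n : W.Index} {w : V ⊕ W.Index} {k : ℕ}
    (hw : W.caterpillar.Adj (inr n) w) (hk : k < W.place n w)
    (h : ∀ t < W.length, W.run t = W.rank n → k < t + 1 → W.kind t ≠ .after) : W.IsTarget w := by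
  rcases w with v | m
  · exact h _ (W.pos_lt v) hw hk
  · trivial

theorem nodeCases_of_clique {n : W.decomposition.Node}
    (hk : ∀ t < W.length, W.run t = W.rank n → W.kind t = .clique) : W.NodeCases n := by
  refine .clique (W.isCliqueNode_of_arc fun w w' hw hw' h => ?_) hk
  exact ⟨h, W.isSource_of_lt hw h fun t ht htn _ => by simp [hk t ht htn],
    W.isTarget_of_lt hw' h fun t ht htn _ => by simp [hk t ht htn],
    fun t ht htn _ _ => by simp [hk t ht htn]⟩

theorem nodeCases_of_after {n : W.decomposition.Node}
    (hk : ∀ t < W.length, W.run t = W.rank n → W.kind t = .after) : W.NodeCases n := by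
  have hn : W.rank n ≠ W.lastRun := fun h => W.last_ne
    (hk _ (by have := W.three_le; omega) h.symm)
  have hn' := W.rank_le n
  obtain ⟨m, hm⟩ := W.exists_rank_eq (k := W.rank n + 1) (by omega)
  have hp : W.place n (inr m) = W.length + 1 := W.place_after (by omega)
  refine .after m hm.symm (W.isStarNode_of_arc (.inl hm.symm) fun w w' hw hw' h => ?_) hk
  have hle := W.place_le n w'
  constructor
  · intro ha
    rcases W.eq_of_place_pos hw' (by omega) with ⟨v, rfl, hv⟩ | ⟨m', rfl, hm'⟩
    · exact absurd (hk _ (W.pos_lt v) hv) ha.isTarget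
    · exact .inr (congrArg inr (W.rank_injective (by omega)))
  · rintro (rfl | rfl)
    · omega
    · exact ⟨h, W.isSource_of_lt hw h fun t ht htn _ => by simp [hk t ht htn], trivial,
        fun t ht htn _ _ => by simp [hk t ht htn]⟩

theorem nodeCases_of_before {n : W.decomposition.Node}
    (hk : ∀ t < W.length, W.run t = W.rank n → W.kind t = .before) : W.NodeCases n := by
  have hn : W.rank n ≠ 0 := fun h => W.first_ne
    (hk 0 (by have := W.three_le; omega) h.symm)
  have hn' := W.rank_le n
  obtain ⟨m, hm⟩ := W.exists_rank_eq (k := W.rank n - 1) (by omega)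
  have hp : W.place n (inr m) = 0 := W.place_before (by omega)
  refine .before m (by omega) (W.isStarNode_of_arc (.inr (by omega)) fun w w' hw hw' h => ?_) hk
  have hle := W.place_le n w'
  constructor
  · intro ha
    rcases W.eq_of_place_lt hw (by omega) with ⟨v, rfl, hv⟩ | ⟨m', rfl, hm'⟩
    · exact absurd (hk _ (W.pos_lt v) hv) ha.isSource
    · exact .inl (congrArg inr (W.rank_injective (by omega)))
  · rintro (rfl | rfl)
    · exact ⟨h, trivial, W.isTarget_of_lt hw' h fun t ht htn _ => by simp [hk t ht htn],
        fun t ht htn _ _ => by simp [hk t ht htn]⟩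
    · omega

theorem kind_of_lt_centre {s t : ℕ} (hst : s < t) (h : W.run s = W.run t)
    (ht : W.kind t = .centre) : W.kind s = .after := by
  have h1 := W.precedes hst h
  rw [ht] at h1
  revert h1
  cases W.kind s <;> simp [LeafKind.Precedes]

theorem kind_of_centre_lt {s t : ℕ} (hst : s < t) (h : W.run s = W.run t)
    (hs : W.kind s = .centre) : W.kind t = .before := by
  have h1 := W.precedes hst h
  rw [hs] at h1
  revert h1
  cases W.kind t <;> simp [LeafKind.Precedes]

/-- In such a run all letters before `c` are `after` and all letters behind it are `before`. Two
markers on the same side of `c` are therefore not adjacent, two on different sides are separated by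
`c`, and `c` is adjacent to all. -/
theorem nodeCases_of_centre {n : W.decomposition.Node} {c : V} (hc : W.run (W.pos c) = W.rank n)
    (hk : W.kind (W.pos c) = .centre) : W.NodeCases n := by
  have hlt : ∀ t, W.run t = W.rank n → t < W.pos c → W.kind t = .after := fun t h1 h2 =>
    W.kind_of_lt_centre h2 (h1.trans hc.symm) hk
  have hgt : ∀ t, W.run t = W.rank n → W.pos c < t → W.kind t = .before := fun t h1 h2 =>
    W.kind_of_centre_lt h2 (hc.trans h1.symm) hk
  have hp := W.place_leaf n c
  refine .centre c (W.isStarNode_of_arc hc fun w w' hw hw' h => ?_) hc hk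
  have hle := W.place_le n w'
  have hcl := W.pos_lt c
  constructor
  · intro ha
    by_contra hcon
    push Not at hcon
    have h1 : W.place n w ≠ W.place n (inl c) := fun e => hcon.1 (W.place_injective hw hc e)
    have h2 : W.place n w' ≠ W.place n (inl c) := fun e => hcon.2 (W.place_injective hw' hc e)
    rcases lt_or_gt_of_ne h1 with h1 | h1
    · rcases lt_or_gt_of_ne h2 with h2 | h2
      · rcases W.eq_of_place_pos hw' (by omega) with ⟨v, rfl, hv⟩ | ⟨m', rfl, hm'⟩
        · exact ha.isTarget (hlt _ hv (by rw [W.place_leaf n v] at h2; omega))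
        · rw [W.place_after (by omega)] at h2
          omega
      · exact ha.ne_centre _ hcl hc (by omega) (by omega) hk
    · rcases W.eq_of_place_lt hw (by omega) with ⟨v, rfl, hv⟩ | ⟨m', rfl, hm'⟩
      · exact ha.isSource (hgt _ hv (by rw [W.place_leaf n v] at h1; omega))
      · rw [W.place_before (by omega)] at h1
        omega
  · rintro (rfl | rfl)
    · refine ⟨h, ?_, W.isTarget_of_lt hw' h fun t ht htn h1 => ?_, fun t ht htn h1 _ => ?_⟩
      · simp [IsSource, hk]
      · simp [hgt t htn (by omega)]
      · simp [hgt t htn (by omega)]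
    · refine ⟨h, W.isSource_of_lt hw h fun t ht htn h1 => ?_, ?_, fun t ht htn _ h1 => ?_⟩
      · simp [hlt t htn (by omega)]
      · simp [IsTarget, hk]
      · simp [hlt t htn (by omega)]

/-- By `Precedes`, two different letters of a run without `centre` could only be `after` followed by
`before`, which `exists_centre` excludes. Such a run is constant. -/
theorem nodeCases (n : W.decomposition.Node) : W.NodeCases n := by
  by_cases hcentre : ∃ t < W.length, W.run t = W.rank n ∧ W.kind t = .centre
  · obtain ⟨t, ht, htn, hk⟩ := hcentre
    obtain ⟨c, rfl⟩ := W.exists_pos t ht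
    exact W.nodeCases_of_centre htn hk
  push Not at hcentre
  obtain ⟨s, hs, hsn⟩ := W.exists_lt_run_eq n
  have key : ∀ t < W.length, W.run t = W.rank n → W.kind t = W.kind s := by
    intro t ht htn
    have h1 := hcentre s hs hsn
    have h2 := hcentre t ht htn
    rcases lt_trichotomy s t with hst | rfl | hst
    · have h3 := W.precedes hst (hsn.trans htn.symm)
      have h4 := W.exists_centre hst (hsn.trans htn.symm)
      cases hs' : W.kind s <;> cases ht' : W.kind t <;> simp_all [LeafKind.Precedes]
      obtain ⟨u, hu, hu', hk⟩ := h4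
      exact hcentre u (by omega) hu' hk
    · rfl
    · have h3 := W.precedes hst (htn.trans hsn.symm)
      have h4 := W.exists_centre hst (htn.trans hsn.symm)
      cases hs' : W.kind s <;> cases ht' : W.kind t <;> simp_all [LeafKind.Precedes]
      obtain ⟨u, hu, hu', hk⟩ := h4
      exact hcentre u (by omega) hu' hk
  cases hk : W.kind s with
  | clique => exact W.nodeCases_of_clique fun t ht htn => (key t ht htn).trans hk
  | centre => exact absurd hk (hcentre s hs hsn)
  | before => exact W.nodeCases_of_before fun t ht htn => (key t ht htn).trans hk
  | after => exact W.nodeCases_of_after fun t ht htn => (key t ht htn).trans hk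

theorem exists_not_merges {m n : W.Index} (h : W.rank m + 1 = W.rank n) :
    ∃ t, t + 1 < W.length ∧ W.run t = W.rank m ∧ W.run (t + 1) = W.rank n ∧
      ¬ (W.kind t).Merges (W.kind (t + 1)) := by
  have h1 : W.rank m < W.run (W.length - 1) := by
    have : W.rank n ≤ W.run (W.length - 1) := W.rank_le n
    omega
  obtain ⟨t, ht, htm, htn⟩ := W.exists_boundary h1
  refine ⟨t, by omega, htm, htn.trans h, fun hm => ?_⟩
  have := W.run_succ_of_merges hm
  omega

/-- The graph-labelled tree of a word that describes `G` is the canonical split decomposition. -/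
theorem isCanonicalSplitDecomposition {G : SimpleGraph V} (hW : W.Describes G) :
    W.decomposition.IsCanonicalSplitDecomposition G := by
  have h3 : ∀ n : W.decomposition.Node,
      3 ≤ (W.decomposition.tree.neighborSet (inr n)).encard := W.three_le_degree_caterpillar
  have hcc : ∀ m n : W.decomposition.Node, W.rank m + 1 = W.rank n →
      W.decomposition.IsCliqueNode m → W.decomposition.IsCliqueNode n → False := by
    intro m n hmn hm hn
    obtain ⟨t, ht, htm, htn, hk⟩ := W.exists_not_merges hmn
    have h1 : W.kind t = .clique := by
      rcases W.nodeCases m with ⟨-, h⟩ | ⟨c, h, -⟩ | ⟨m', -, h, -⟩ | ⟨m', -, h, -⟩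
      · exact h t (by omega) htm
      all_goals exact (h.not_isCliqueNode (h3 m) hm).elim
    have h2 : W.kind (t + 1) = .clique := by
      rcases W.nodeCases n with ⟨-, h⟩ | ⟨c, h, -⟩ | ⟨m', -, h, -⟩ | ⟨m', -, h, -⟩
      · exact h (t + 1) (by omega) htn
      all_goals exact (h.not_isCliqueNode (h3 n) hn).elim
    rw [h1, h2] at hk
    exact hk trivial
  refine ⟨W.accessibilityGraph_decomposition hW, h3, fun n => ?_, ?_, ?_⟩
  · rcases W.nodeCases n with ⟨h, -⟩ | ⟨c, h, -⟩ | ⟨m', -, h, -⟩ | ⟨m', -, h, -⟩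
    · exact .inl h
    all_goals exact .inr (.inl ⟨_, h⟩)
  · rintro m n (hmn | hmn) ⟨hm, hn⟩
    · exact hcc m n hmn hm hn
    · exact hcc n m hmn hn hm
  -- If the earlier star `m` is centred at `n`, its run consists of letters `after`. A star `n`
  -- centred at a leaf starts with `after` or `centre`, and one centred further on starts with
  -- `after`; either would merge with the run of `m`. The other orientation is the mirror image,
  -- with `before` as the first letter of the run of `m`.
  · rintro m n (hmn | hmn) z hm hn
    · obtain ⟨t, ht, htm, htn, hk⟩ := W.exists_not_merges hmn
      have h1 : W.kind t = .after := by
        rcases W.nodeCases m with ⟨h, -⟩ | ⟨c, h, -⟩ | ⟨m', hm', h, -⟩ | ⟨m', -, -, h⟩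
        · exact (hm.not_isCliqueNode (h3 m) h).elim
        · exact absurd (h.centre_unique (h3 m) hm) (by simp)
        · obtain rfl := inr_injective (h.centre_unique (h3 m) hm)
          omega
        · exact h t (by omega) htm
      rw [h1] at hk
      rcases W.nodeCases n with ⟨h, -⟩ | ⟨c, h, hc, hkc⟩ | ⟨m', hm', h, -⟩ | ⟨m', -, -, h⟩
      · exact (hn.not_isCliqueNode (h3 n) h).elim
      · rcases lt_trichotomy (t + 1) (W.pos c) with h2 | h2 | h2
        · rw [W.kind_of_lt_centre h2 (htn.trans hc.symm) hkc] at hk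
          exact (hk trivial).elim
        · rw [h2, hkc] at hk
          exact (hk trivial).elim
        · have := W.run_mono (Nat.le_of_lt_succ h2)
          omega
      · obtain rfl : m' = m := W.rank_injective (by omega)
        exact hn.centre_unique (h3 n) h
      · rw [h _ ht htn] at hk
        exact (hk trivial).elim
    · obtain ⟨t, ht, htn, htm, hk⟩ := W.exists_not_merges hmn
      have h1 : W.kind (t + 1) = .before := by
        rcases W.nodeCases m with ⟨h, -⟩ | ⟨c, h, -⟩ | ⟨m', -, -, h⟩ | ⟨m', hm', h, -⟩
        · exact (hm.not_isCliqueNode (h3 m) h).elim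
        · exact absurd (h.centre_unique (h3 m) hm) (by simp)
        · exact h _ ht htm
        · obtain rfl := inr_injective (h.centre_unique (h3 m) hm)
          omega
      rw [h1] at hk
      rcases W.nodeCases n with ⟨h, -⟩ | ⟨c, h, hc, hkc⟩ | ⟨m', -, -, h⟩ | ⟨m', hm', h, -⟩
      · exact (hn.not_isCliqueNode (h3 n) h).elim
      · rcases lt_trichotomy t (W.pos c) with h2 | h2 | h2
        · have := W.run_mono (Nat.succ_le_of_lt h2)
          rw [Nat.succ_eq_add_one] at this
          omega
        · rw [h2, hkc] at hk
          exact (hk trivial).elim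
        · rw [W.kind_of_centre_lt h2 (hc.trans htn.symm) hkc] at hk
          exact (hk trivial).elim
      · rw [h t (by omega) htn] at hk
        exact (hk trivial).elim
      · obtain rfl : m' = m := W.rank_injective (by omega)
        exact hn.centre_unique (h3 n) h

end LeafWord

/-! ### Existence of the decomposition, and the main theorem -/

/-- Prime AT-free distance-hereditary graphs have a canonical split decomposition. -/
theorem SimpleGraph.IsDistanceHereditary.exists_isCanonicalSplitDecomposition {V : Type u}
    [Finite V] {G : SimpleGraph V} (hG : G.IsDistanceHereditary) (hA : G.IsATFree)
    (hp : G.IsModularPrime) (h3 : 3 ≤ Nat.card V) :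
    ∃ D : GraphLabelledTree V, D.IsCanonicalSplitDecomposition G := by
  have hc := hp.connected h3
  have := hc.nonempty
  obtain ⟨b, cs, h⟩ := hG.exists_thread hA _ Set.univ Set.finite_univ rfl Set.univ_nonempty
    fun u _ v _ huv => hp.not_areTwins h3 u v ⟨huv.1, fun y h1 h2 => huv.2 y trivial h1 h2⟩
  obtain ⟨W, hW⟩ := h.exists_leafWord hc h3
  exact ⟨W.decomposition, W.isCanonicalSplitDecomposition hW⟩

theorem mainTheorem9 {V : Type u} [Finite V] [Nonempty V] (G : SimpleGraph V) :
    ((G.IsATFree ∧ G.IsDistanceHereditary) ↔ (G.IsPermutationGraph ∧ G.IsDistanceHereditary)) ∧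
    (G.IsATFree → G.IsDistanceHereditary → G.twinWidth ≤ 1) ∧
    (G.IsATFree → G.IsDistanceHereditary → G.IsModularPrime → 3 ≤ Nat.card V →
      (∃ D : GraphLabelledTree V, D.IsCanonicalSplitDecomposition G) ∧
      ∀ D : GraphLabelledTree V, D.IsCanonicalSplitDecomposition G →
        (∃ nodes a b rest, D.IsReading nodes a b rest) ∧
        ∀ nodes a b rest, D.IsReading nodes a b rest →
          (∃ s, D.ReadsOff nodes (a :: b :: rest) a b rest s) ∧
          ∀ s, D.ReadsOff nodes (a :: b :: rest) a b rest s →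
            Trigraph.IsDSequence G 1 (Trigraph.trace (Trigraph.ofGraph G) s) ∧
            ∀ T ∈ Trigraph.trace (Trigraph.ofGraph G) s, T.HasAtMostPendantRedEdge) :=
  ⟨SimpleGraph.isATFree_and_iff_isPermutationGraph_and, fun hA hG => hA.twinWidth_le_one hG,
    fun hA hG hp h3 => ⟨hG.exists_isCanonicalSplitDecomposition hA hp h3, fun D hD =>
      ⟨hD.exists_isReading hG hA hp h3, fun nodes a b rest hr => by
        obtain ⟨h1, h2⟩ := hr.readsOff hD hG h3
        exact ⟨h1, fun s hs => ⟨(h2 s hs).isDSequence, (h2 s hs).forall_mem⟩⟩⟩⟩⟩
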